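/- **Setting.** Let $n_p\in\mathbb N$, $A_p\in\mathbb R^{n_p\times n_p}$, $B_p\in\mathbb R^{n_p\times 1}$, $C_p\in\mathbb R^{1\times n_p}$, $k_p,k_i,p_r\in\mathbb R$ (in particular $p_r\in[0,1]$), $h>0$, $n=n_p+1$, and $$\Lambda=\begin{bmatrix}A_p&B_p\\0&0\end{bmatrix},\quad \Lambda_d=\begin{bmatrix}-k_pB_pC_p&0\\-k_iC_p&0\end{bmatrix},\quad K=\begin{bmatrix}0&0\\0&-p_r\end{bmatrix}.$$ A sequence of reset instants $(t_k)_{k\ge 0}$ is called admissible if it is strictly increasing, $t_0=0$, $t_{k+1}-t_k\in[\mathcal T_m,\mathcal T_M]$ and $t_k\to\infty$. The sampled-data system is $$\dot X(t)=\Lambda X(t)+\Lambda_dX(t-h)+\Lambda K X(t_k),\quad t\in(t_k,t_{k+1}],\qquad X=\phi_X\ \text{on }[-h,0].\tag{1}$$ The PI+RI reset control system with resetting set $\mathcal S\subset\mathbb R\times\mathbb R^{n_p+2}$ is $$\dot{\mathbf x}(t)=A\mathbf x(t)+A_d\mathbf x(t-h)\ \text{ if }(t,\mathbf x(t))\notin\mathcal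 S,\quad \mathbf x(t^+)=A_R\mathbf x(t)\ \text{ if }(t,\mathbf x(t))\in\mathcal S,\quad \mathbf x=\phi\text{ on }[-h,0],\tag{2}$$ $$A=\begin{bmatrix}A_p&B_p[\,1-p_r\ \ p_r\,]\\0&0\end{bmatrix},\quad A_d=\begin{bmatrix}-k_pB_pC_p&0\\-k_i\left[\begin{smallmatrix}1\\1\end{smallmatrix}\right]C_p&0\end{bmatrix},\quad A_R=\operatorname{diag}(I_{n_p},1,0);$$ its executions are left-continuous on $(0,\infty)$, and those considered have as positive reset instants exactly $t_1<t_2<\dots$ for some admissible sequence. Initial functions are absolutely continuous on $[-h,0]$ with square integrable derivative, and $\|\phi\|_W=\max_{[-h,0]}\|\phi\|+(\int_{-h}^0\|\dot\phi\|^2)^{1/2}$. System (1) is exponentially stable with decay rate $\alpha$ if for every $\epsilon>0$ there is $\delta>0$ such that, for all admissible $(t_k)$ and all solutions, $\|\phi_X\|_W<\delta$ implies $\|X(t)\|<\epsilon e^{-\alpha t}$ for all $t\ge0$; likewise for (2) with $\phi,\mathbf x$. **Proposition.** Let $\alpha>0$, $0\le\mathcal T_m\le\mathcal T_M$, $N\ge0$,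 $M\ge1$, and let $\mathcal T_m=\mathcal T_0\le\mathcal T_1\le\dots\le\mathcal T_M$ split $[\mathcal T_m,\mathcal T_M]$ into $M$ sub-intervals. Suppose there exist a symmetric $P_N\in\mathbb R^{(N+1)n\times(N+1)n}$, symmetric positive definite $S,R,Q_i,X_i,U_i\in\mathbb R^{n\times n}$, and matrices $Z_i\in\mathbb R^{n\times n}$, $Y_i\in\mathbb R^{(N+3)n\times n}$ $(1\le i\le M)$ such that $$P_N+\tfrac{e^{-2\alpha h}}{h}\operatorname{diag}(0_n,S,3S,\dots,(2N-1)S)>0$$ and, for all $i\in\{1,\dots,M\}$, $$h_1(0)\Pi_{1,i}+h_2(0,\mathcal T)\Pi_{2,i}+h_4(0,\mathcal T_i)N_2^\top X_iN_2<0\quad\text{for }\mathcal T=\mathcal T_{i-1}\text{ and }\mathcal T=\mathcal T_i,$$ $$\begin{bmatrix}h_1(\mathcal T)\Pi_{1,i}+h_4(\mathcal T,\mathcal T_i)N_2^\top X_iN_2&h_3(\mathcal T,\mathcal T_i)Y_i\\ \star&-h_3(\mathcal T,\mathcal T_i)U_i\end{bmatrix}<0\quad\text{for }\mathcal T=\mathcal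 T_{i-1}\text{ and }\mathcal T=\mathcal T_i,$$ where $h_1(\tau)=e^{2\alpha\tau}$, $h_2(\tau,T)=\frac{e^{2\alpha T}-e^{2\alpha\tau}}{2\alpha}$, $h_3(\tau,T)=e^{2\alpha T}\frac{e^{2\alpha\tau}-1}{2\alpha}$, $h_4(\tau,T)=\big((e^{\alpha T}-4)e^{\alpha T}+1\big)e^{2\alpha\tau}+2e^{2\alpha T}$, and, with $\mathrm{He}(A)=A+A^\top$, $$\Pi_{1,i}=\mathrm{He}(G^\top P_NH)+2\alpha G^\top P_NG+\Sigma_N+h^2F^\top RF-\Gamma_N^\top R_N\Gamma_N-N_{12}^\top Q_iN_{12}-\mathrm{He}(N_{12}^\top Z_iN_2)+\mathrm{He}(Y_iN_{12}),$$ $$\Pi_{2,i}=F^\top U_iF+\mathrm{He}(F^\top Q_iN_{12})+\mathrm{He}(F^\top Z_iN_2),$$ $N_1=[I_n\ 0_{n,n(N+2)}]$, $N_2=[0_{n,n(N+2)}\ I_n]$, $N_{12}=N_1-N_2$, $F=[\Lambda\ \ \Lambda_d\ \ 0_{n,nN}\ \ \Lambda K]$, $R_N=e^{-2\alpha h}\operatorname{diag}(R,3R,\dots,(2N+1)R)$,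 $\Sigma_N=\operatorname{diag}(S,-e^{-2\alpha h}S,0_{(N+1)n})$, $$G=\begin{bmatrix}I_n&0&0_{n,nN}&0\\0&0&hI_{nN}&0\end{bmatrix},\quad H=\begin{bmatrix}F\\\Gamma(0)\\\vdots\\\Gamma(N-1)\end{bmatrix},\quad \Gamma_N=\begin{bmatrix}\Gamma(0)\\\vdots\\\Gamma(N)\end{bmatrix},$$ $\Gamma(k)=[I\ \ (-1)^{k+1}I\ \ \gamma_k^0I\ \cdots\ \gamma_k^{N-1}I\ \ 0_n]$, with $\gamma_k^i=-(2i+1)(1-(-1)^{k+i})$ for $i\le k$ and $\gamma_k^i=0$ for $i>k$. Then the sampled-data system (1) is exponentially stable with decay rate $\alpha$, and consequently, for every resetting set $\mathcal S$, the reset control system (2) is exponentially stable with decay rate $\alpha$. -/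

import Mathlib

open MeasureTheory Filter Topology

noncomputable section

namespace ResetPIRI

/-! ### Reset instants, the space `W[-h,0]` -/

/-- `t₀ = 0`, strictly increasing, `t_{k+1} - t_k ∈ [Tm, TM]`, `t_k → ∞`. -/
structure IsResetSequence (Tm TM : ℝ) (t : ℕ → ℝ) : Prop where
  zero : t 0 = 0
  strictMono : StrictMono t
  dwell : ∀ k, t (k + 1) - t k ∈ Set.Icc Tm TM
  tendsto : Tendsto t atTop atTop

section W

variable {E : Type*} [NormedAddCommGroup E] [NormedSpace ℝ E]

/-- `φ ∈ W[-h,0]`: absolutely continuous on `[-h,0]` with square integrable derivative.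
Only the restriction of `φ` to `[-h,0]` matters. -/
def MemW (h : ℝ) (φ : ℝ → E) : Prop :=
  AbsolutelyContinuousOnInterval φ (-h) 0 ∧
    MemLp (deriv φ) 2 (volume.restrict (Set.Icc (-h) 0))

/-- `‖φ‖_W = max_{[-h,0]} ‖φ‖ + (∫_{-h}^0 ‖φ'‖²)^{1/2}`. -/
def normW (h : ℝ) (φ : ℝ → E) : ℝ :=
  (⨆ θ : Set.Icc (-h) (0 : ℝ), ‖φ θ‖) + Real.sqrt (∫ θ in (-h)..0, ‖deriv φ θ‖ ^ 2)

end W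

/-! ### The sampled-data system and the reset system -/

section Systems

variable {ν : Type*} [Fintype ν] [DecidableEq ν]

/-- `X` solves `X'(s) = Λ X(s) + Λd X(s-h) + Λ u(s)`, `u(s) = K X(t_k)` for `s ∈ (t_k, t_{k+1}]`,
with `X = φ` on `[-h,0]`. At `s = t_{k+1}` the derivative is the left one, as `u` jumps there. -/
structure IsSampledSolution (Λ Λd K : Matrix ν ν ℝ) (h : ℝ) (t : ℕ → ℝ)
    (φ X : ℝ → EuclideanSpace ℝ ν) : Prop where
  init : ∀ s ∈ Set.Icc (-h) 0, X s = φ s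
  continuousOn : ContinuousOn X (Set.Ici (-h))
  flow : ∀ k, ∀ s ∈ Set.Ioc (t k) (t (k + 1)),
    HasDerivWithinAt X
      (Λ.toEuclideanLin (X s) + Λd.toEuclideanLin (X (s - h))
        + Λ.toEuclideanLin (K.toEuclideanLin (X (t k))))
      (Set.Ioc (t k) (t (k + 1))) s

/-- Exponential stability with decay rate `α` of the sampled-data system, for all reset instants
with dwell times in `[Tm, TM]` (`δ` depends on `ε` only). -/
def SampledExpStable (Λ Λd K : Matrix ν ν ℝ) (h Tm TM α : ℝ) : Prop :=
  ∀ ε > 0, ∃ δ > 0, ∀ (t : ℕ → ℝ) (φ X : ℝ → EuclideanSpace ℝ ν),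
    IsResetSequence Tm TM t → MemW h φ → IsSampledSolution Λ Λd K h t φ X →
    normW h φ < δ → ∀ s : ℝ, 0 ≤ s → ‖X s‖ < ε * Real.exp (-α * s)

/-- `x` is an execution, with reset instants `t₁ < t₂ < …`, of
`x'(s) = A x(s) + Ad x(s-h)` if `(s, x(s)) ∉ S`, `x(s⁺) = AR x(s)` if `(s, x(s)) ∈ S`,
`x = φ` on `[-h,0]`. Executions are left-continuous: `x(s)` is the value before the reset. -/
structure IsResetSolution (A Ad AR : Matrix ν ν ℝ) (h : ℝ) (S : Set (ℝ × EuclideanSpace ℝ ν))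
    (t : ℕ → ℝ) (φ x : ℝ → EuclideanSpace ℝ ν) : Prop where
  init : ∀ s ∈ Set.Icc (-h) 0, x s = φ s
  instants : ∀ s : ℝ, 0 < s → ((s, x s) ∈ S ↔ ∃ k : ℕ, t (k + 1) = s)
  left_cont : ∀ s : ℝ, 0 < s → ContinuousWithinAt x (Set.Iic s) s
  flow : ∀ s : ℝ, 0 < s → (s, x s) ∉ S →
    HasDerivAt x (A.toEuclideanLin (x s) + Ad.toEuclideanLin (x (s - h))) s
  start : (0, x 0) ∉ S → ContinuousWithinAt x (Set.Ici 0) 0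
  jump : ∀ s : ℝ, 0 ≤ s → (s, x s) ∈ S →
    Tendsto x (𝓝[>] s) (𝓝 (AR.toEuclideanLin (x s)))

/-- Exponential stability with decay rate `α` of the reset system with resetting set `S`, whose
executions have reset instants with dwell times in `[Tm, TM]`. -/
def ResetExpStable (A Ad AR : Matrix ν ν ℝ) (h : ℝ) (S : Set (ℝ × EuclideanSpace ℝ ν))
    (Tm TM α : ℝ) : Prop :=
  ∀ ε > 0, ∃ δ > 0, ∀ (t : ℕ → ℝ) (φ x : ℝ → EuclideanSpace ℝ ν),
    IsResetSequence Tm TM t → MemW h φ → IsResetSolution A Ad AR h S t φ x →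
    normW h φ < δ → ∀ s : ℝ, 0 ≤ s → ‖x s‖ < ε * Real.exp (-α * s)

end Systems

/-! ### The closed-loop matrices -/

section ClosedLoop

variable {np : ℕ} (Ap : Matrix (Fin np) (Fin np) ℝ) (Bp : Matrix (Fin np) (Fin 1) ℝ)
  (Cp : Matrix (Fin 1) (Fin np) ℝ) (kp ki pr : ℝ)

/-- Index set of the state `(x_p, x_s)` of the sampled-data system. -/
abbrev SIdx (np : ℕ) : Type := Fin np ⊕ Fin 1

/-- Index set of the state `(x_p, (x_i, x_ri))` of the reset system. -/
abbrev RIdx (np : ℕ) : Type := Fin np ⊕ Fin 2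

def Lam : Matrix (SIdx np) (SIdx np) ℝ := Matrix.fromBlocks Ap Bp 0 0

def LamD : Matrix (SIdx np) (SIdx np) ℝ :=
  Matrix.fromBlocks (-(kp • (Bp * Cp))) 0 (-(ki • Cp)) 0

def gainK (np : ℕ) (pr : ℝ) : Matrix (SIdx np) (SIdx np) ℝ :=
  Matrix.fromBlocks 0 0 0 !![-pr]

def Br : Matrix (Fin 2) (Fin 1) ℝ := ki • !![1; 1]

def Cr : Matrix (Fin 1) (Fin 2) ℝ := !![1 - pr, pr]

def clA : Matrix (RIdx np) (RIdx np) ℝ := Matrix.fromBlocks Ap (Bp * Cr pr) 0 0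

def clAd : Matrix (RIdx np) (RIdx np) ℝ :=
  Matrix.fromBlocks (-(kp • (Bp * Cp))) 0 (-(Br ki * Cp)) 0

def clAR (np : ℕ) : Matrix (RIdx np) (RIdx np) ℝ :=
  Matrix.fromBlocks 1 0 0 !![1, 0; 0, 0]

end ClosedLoop

/-! ### The weights and matrices of the LMIs -/

def h1 (α τ : ℝ) : ℝ := Real.exp (2 * α * τ)

def h2 (α τ T : ℝ) : ℝ := (Real.exp (2 * α * T) - Real.exp (2 * α * τ)) / (2 * α)

def h3 (α τ T : ℝ) : ℝ := Real.exp (2 * α * T) * ((Real.exp (2 * α * τ) - 1) / (2 * α))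

def h4 (α τ T : ℝ) : ℝ :=
  ((Real.exp (α * T) - 4) * Real.exp (α * T) + 1) * Real.exp (2 * α * τ)
    + 2 * Real.exp (2 * α * T)

section LMI

variable {ν : Type*} [Fintype ν] [DecidableEq ν]

/-- Index set of the augmented state `(χ(0), ∫ L₀ χ, …, ∫ L_{N-1} χ)`, of size `(N+1)n`. -/
abbrev AugIdx (ν : Type*) (N : ℕ) : Type _ := ν ⊕ (ν × Fin N)

/-- Index set of the block columns `[n | n | nN | n]`, of size `(N+3)n`. -/
abbrev XiIdx (ν : Type*) (N : ℕ) : Type _ := ν ⊕ (ν ⊕ ((ν × Fin N) ⊕ ν))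

/-- The row of blocks `[A B C D]` with block widths `n, n, nN, n`. -/
def rowBlocks {m : Type*} {N : ℕ} (A B : Matrix m ν ℝ) (C : Matrix m (ν × Fin N) ℝ)
    (D : Matrix m ν ℝ) : Matrix m (XiIdx ν N) ℝ :=
  Matrix.fromCols A (Matrix.fromCols B (Matrix.fromCols C D))

def He {m : Type*} (A : Matrix m m ℝ) : Matrix m m ℝ := A + A.transpose

def NegDef {m : Type*} (A : Matrix m m ℝ) : Prop := (-A).PosDef

def gammaCoeff (k i : ℕ) : ℝ :=
  if i ≤ k then -(2 * (i : ℝ) + 1) * (1 - (-1) ^ (k + i)) else 0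

/-- `Γ(k) = [I, (-1)^{k+1} I, γ_k^0 I, …, γ_k^{N-1} I, 0]`. -/
def Gam (ν : Type*) [DecidableEq ν] (N k : ℕ) : Matrix ν (XiIdx ν N) ℝ :=
  rowBlocks 1 ((-1 : ℝ) ^ (k + 1) • 1)
    (Matrix.of fun a p => if a = p.1 then gammaCoeff k p.2 else 0) 0

/-- The blocks `Γ(0), …, Γ(m-1)` stacked. -/
def GamStack (ν : Type*) [DecidableEq ν] (N m : ℕ) : Matrix (ν × Fin m) (XiIdx ν N) ℝ :=
  Matrix.of fun p j => Gam ν N p.2 p.1 j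

def matF (Λ Λd K : Matrix ν ν ℝ) (N : ℕ) : Matrix ν (XiIdx ν N) ℝ :=
  rowBlocks Λ Λd 0 (Λ * K)

def matG (ν : Type*) [DecidableEq ν] (N : ℕ) (h : ℝ) : Matrix (AugIdx ν N) (XiIdx ν N) ℝ :=
  Matrix.fromRows (rowBlocks 1 0 0 0) (rowBlocks 0 0 (h • 1) 0)

def matH (Λ Λd K : Matrix ν ν ℝ) (N : ℕ) : Matrix (AugIdx ν N) (XiIdx ν N) ℝ :=
  Matrix.fromRows (matF Λ Λd K N) (GamStack ν N N)

def N1 (ν : Type*) [DecidableEq ν] (N : ℕ) : Matrix ν (XiIdx ν N) ℝ := rowBlocks 1 0 0 0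

def N2 (ν : Type*) [DecidableEq ν] (N : ℕ) : Matrix ν (XiIdx ν N) ℝ := rowBlocks 0 0 0 1

def N12 (ν : Type*) [DecidableEq ν] (N : ℕ) : Matrix ν (XiIdx ν N) ℝ := N1 ν N - N2 ν N

/-- `diag(A, 3A, …, (2m-1)A)`. -/
def oddDiag (A : Matrix ν ν ℝ) (m : ℕ) : Matrix (ν × Fin m) (ν × Fin m) ℝ :=
  Matrix.blockDiagonal fun k : Fin m => (2 * (k : ℝ) + 1) • A

def matRN (R : Matrix ν ν ℝ) (N : ℕ) (α h : ℝ) :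
    Matrix (ν × Fin (N + 1)) (ν × Fin (N + 1)) ℝ :=
  Real.exp (-2 * α * h) • oddDiag R (N + 1)

/-- `diag(S, -e^{-2αh} S, 0_{(N+1)n})`. -/
def matSigma (S : Matrix ν ν ℝ) (N : ℕ) (α h : ℝ) : Matrix (XiIdx ν N) (XiIdx ν N) ℝ :=
  Matrix.fromBlocks S 0 0 (Matrix.fromBlocks (-(Real.exp (-2 * α * h) • S)) 0 0 0)

open Matrix in
def Pi1 (Λ Λd K : Matrix ν ν ℝ) (N : ℕ) (α h : ℝ)
    (P : Matrix (AugIdx ν N) (AugIdx ν N) ℝ) (S R Q Z : Matrix ν ν ℝ)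
    (Y : Matrix (XiIdx ν N) ν ℝ) : Matrix (XiIdx ν N) (XiIdx ν N) ℝ :=
  He ((matG ν N h)ᵀ * P * matH Λ Λd K N)
    + (2 * α) • ((matG ν N h)ᵀ * P * matG ν N h)
    + matSigma S N α h
    + h ^ 2 • ((matF Λ Λd K N)ᵀ * R * matF Λ Λd K N)
    - (GamStack ν N (N + 1))ᵀ * matRN R N α h * GamStack ν N (N + 1)
    - (N12 ν N)ᵀ * Q * N12 ν N
    - He ((N12 ν N)ᵀ * Z * N2 ν N)
    + He (Y * N12 ν N)

open Matrix in
def Pi2 (Λ Λd K : Matrix ν ν ℝ) (N : ℕ) (Q U Z : Matrix ν ν ℝ) :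
    Matrix (XiIdx ν N) (XiIdx ν N) ℝ :=
  (matF Λ Λd K N)ᵀ * U * matF Λ Λd K N
    + He ((matF Λ Λd K N)ᵀ * Q * N12 ν N)
    + He ((matF Λ Λd K N)ᵀ * Z * N2 ν N)

open Matrix in
/-- Feasibility of the LMIs, for the partition `𝒯₀ ≤ … ≤ 𝒯_M` of the interval of dwell times.
The index `i : Fin M` stands for the sub-interval from `𝒯 i.castSucc` to `𝒯 i.succ`. -/
def LMIFeasible (Λ Λd K : Matrix ν ν ℝ) (N M : ℕ) (α h : ℝ) (𝒯 : Fin (M + 1) → ℝ) : Prop :=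
  ∃ (P : Matrix (AugIdx ν N) (AugIdx ν N) ℝ) (S R : Matrix ν ν ℝ)
    (Q X U Z : Fin M → Matrix ν ν ℝ) (Y : Fin M → Matrix (XiIdx ν N) ν ℝ),
    P.IsSymm ∧ S.PosDef ∧ R.PosDef ∧
    (∀ i, (Q i).PosDef ∧ (X i).PosDef ∧ (U i).PosDef) ∧
    (P + (Real.exp (-2 * α * h) / h) • Matrix.fromBlocks 0 0 0 (oddDiag S N)).PosDef ∧
    ∀ i : Fin M,
      let T₀ := 𝒯 i.castSucc
      let T₁ := 𝒯 i.succ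
      let Pa := Pi1 Λ Λd K N α h P S R (Q i) (Z i) (Y i)
      let Pb := Pi2 Λ Λd K N (Q i) (U i) (Z i)
      let Xa := (N2 ν N)ᵀ * X i * N2 ν N
      NegDef (h1 α 0 • Pa + h2 α 0 T₀ • Pb + h4 α 0 T₁ • Xa) ∧
      NegDef (h1 α 0 • Pa + h2 α 0 T₁ • Pb + h4 α 0 T₁ • Xa) ∧
      NegDef (Matrix.fromBlocks
        (h1 α T₀ • Pa + h4 α T₀ T₁ • Xa) (h3 α T₀ T₁ • Y i)
        (h3 α T₀ T₁ • Y i)ᵀ (-(h3 α T₀ T₁ • U i))) ∧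
      NegDef (Matrix.fromBlocks
        (h1 α T₁ • Pa + h4 α T₁ T₁ • Xa) (h3 α T₁ T₁ • Y i)
        (h3 α T₁ T₁ • Y i)ᵀ (-(h3 α T₁ T₁ • U i)))

end LMI

end ResetPIRI

end

/-!
The decay of the sampled-data system is measured by a Lyapunov-Krasovskii functional `V` of the
state, its delayed history and the first `N` Legendre moments of that history. Bessel's inequality
for the Legendre polynomials bounds `V` from below by a multiple of `‖X(t)‖²`, by the first LMI,
and bounds the derivative of `e^{2αt} V` from above by a quadratic form. That form need not be
negative along trajectories, but becomes so after adding, on each sampling interval, a looped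
functional that vanishes at the start and is nonnegative at the end; hence `e^{2αt} V` does not
increase from one sampling instant to the next. The resulting matrix inequalities depend affinely
on `e^{2αT}` and on `e^{2ατ}`, where `T` is the length of the interval and `τ` the time elapsed in
it, so that it is enough to check them at the ends of each sub-interval of dwell times.

In the reset system `x_ri - x_i` is constant between resets and equals `-x_i(t_k)` after the reset
at `t_k`; hence `(x_p, x_i)` solves the sampled-data system from `t_1` on, and `x_ri` decays with
it.
-/

noncomputable section

namespace ResetPIRI

/-! ### Shifted Legendre polynomials -/

section Legendre

open Polynomial

/-- The shifted Legendre polynomial on `[0, 1]`, as a real polynomial. It is normalised to take the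
value `1` at `0`, so that it becomes the Legendre polynomial of `[-h, 0]` under `θ ↦ -θ / h`. -/
def legendreUnit (k : ℕ) : ℝ[X] := (shiftedLegendre k).map (Int.castRingHom ℝ)

lemma degree_legendreUnit (k : ℕ) : (legendreUnit k).degree = k := by
  rw [legendreUnit, degree_map_eq_of_injective (RingHom.injective_int _), degree_shiftedLegendre]

lemma legendreUnit_eval_zero (k : ℕ) : (legendreUnit k).eval 0 = 1 := by
  rw [← coeff_zero_eq_eval_zero, legendreUnit, coeff_map, coeff_shiftedLegendre]
  simp

lemma legendreUnit_eval_one (k : ℕ) : (legendreUnit k).eval 1 = (-1) ^ k := by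
  have h := shiftedLegendre_eval_symm k (1 : ℝ)
  rw [sub_self, ← eval_map_algebraMap, ← eval_map_algebraMap] at h
  rw [show map (algebraMap ℤ ℝ) (shiftedLegendre k) = legendreUnit k from rfl,
    legendreUnit_eval_zero, mul_one] at h
  exact h

lemma factorial_mul_legendreUnit (n : ℕ) :
    C (n.factorial : ℝ) * legendreUnit n = derivative^[n] ((X * (1 - X)) ^ n) := by
  have h := congrArg (Polynomial.map (Int.castRingHom ℝ)) (factorial_mul_shiftedLegendre_eq n)
  rw [Polynomial.map_mul, ← Polynomial.iterate_derivative_map] at h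
  simpa [legendreUnit, mul_pow] using h

lemma intervalIntegrable_eval_mul_eval (p q : ℝ[X]) (a b : ℝ) :
    IntervalIntegrable (fun x => p.eval x * q.eval x) volume a b :=
  (p.continuous.mul q.continuous).intervalIntegrable _ _

/-- The inner product of `L²(0, 1)`, as a bilinear form on real polynomials. -/
def unitInner : LinearMap.BilinForm ℝ ℝ[X] :=
  LinearMap.mk₂ ℝ (fun p q => ∫ x in (0 : ℝ)..1, p.eval x * q.eval x)
    (fun p p' q => by
      rw [← intervalIntegral.integral_add (intervalIntegrable_eval_mul_eval ..)
        (intervalIntegrable_eval_mul_eval ..)]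
      simp only [eval_add, add_mul])
    (fun c p q => by
      rw [smul_eq_mul, ← intervalIntegral.integral_const_mul]
      simp only [eval_smul, smul_eq_mul, mul_assoc])
    (fun p q q' => by
      rw [← intervalIntegral.integral_add (intervalIntegrable_eval_mul_eval ..)
        (intervalIntegrable_eval_mul_eval ..)]
      simp only [eval_add, mul_add])
    (fun c p q => by
      rw [smul_eq_mul, ← intervalIntegral.integral_const_mul]
      simp only [eval_smul, smul_eq_mul, mul_left_comm])

lemma unitInner_apply (p q : ℝ[X]) :
    unitInner p q = ∫ x in (0 : ℝ)..1, p.eval x * q.eval x := rfl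

lemma unitInner_comm (p q : ℝ[X]) : unitInner p q = unitInner q p := by
  simp only [unitInner_apply, mul_comm]

lemma eq_zero_of_unitInner_self {p : ℝ[X]} (hp : unitInner p p = 0) : p = 0 := by
  have hcont : ContinuousOn (fun x => p.eval x * p.eval x) (Set.Icc 0 1) :=
    (p.continuous.mul p.continuous).continuousOn
  refine eq_zero_of_infinite_isRoot p ((Set.Icc_infinite zero_lt_one).mono fun x hx => ?_)
  by_contra hx0
  exact (intervalIntegral.integral_pos zero_lt_one hcont (fun _ _ => mul_self_nonneg _)
    ⟨x, hx, mul_self_pos.2 hx0⟩).ne' hp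

lemma unitInner_derivative_left (p q : ℝ[X]) :
    unitInner (derivative p) q =
      p.eval 1 * q.eval 1 - p.eval 0 * q.eval 0 - unitInner p (derivative q) := by
  rw [unitInner_apply, unitInner_apply, ← intervalIntegral.integral_deriv_mul_eq_sub
    (fun x _ => p.hasDerivAt x) (fun x _ => q.hasDerivAt x)
    ((derivative p).continuous.intervalIntegrable _ _)
    ((derivative q).continuous.intervalIntegrable _ _),
    intervalIntegral.integral_add (intervalIntegrable_eval_mul_eval ..)
      (intervalIntegrable_eval_mul_eval ..), add_sub_cancel_right]

lemma unitInner_iterate_derivative (p q : ℝ[X]) (n : ℕ)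
    (hq0 : ∀ j < n, (derivative^[j] q).eval 0 = 0) (hq1 : ∀ j < n, (derivative^[j] q).eval 1 = 0) :
    unitInner (derivative^[n] q) p = (-1) ^ n * unitInner q (derivative^[n] p) := by
  induction n generalizing p with
  | zero => simp
  | succ n ih =>
    rw [Function.iterate_succ_apply', unitInner_derivative_left, hq0 n n.lt_succ_self,
      hq1 n n.lt_succ_self, ih _ (fun j hj => hq0 j (by lia)) (fun j hj => hq1 j (by lia)),
      ← Function.iterate_succ_apply]
    ring

lemma unitInner_legendreUnit_of_degree_lt {p : ℝ[X]} {n : ℕ} (hp : p.degree < n) :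
    unitInner (legendreUnit n) p = 0 := by
  have hdvd : ∀ j < n, X * (1 - X) ∣ derivative^[j] ((X * (1 - X) : ℝ[X]) ^ n) := fun j hj =>
    (dvd_pow_self _ (by lia)).trans (pow_sub_dvd_iterate_derivative_pow _ n j)
  have heval : ∀ x : ℝ, x * (1 - x) = 0 → ∀ j < n,
      (derivative^[j] ((X * (1 - X) : ℝ[X]) ^ n)).eval x = 0 := fun x hx j hj =>
    zero_dvd_iff.1 (by simpa [hx] using eval_dvd (hdvd j hj) (x := x))
  have hrodrigues : (n.factorial : ℝ) * unitInner (legendreUnit n) p = 0 := by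
    rw [← smul_eq_mul, ← LinearMap.smul_apply, ← map_smul, smul_eq_C_mul,
      factorial_mul_legendreUnit, unitInner_iterate_derivative _ _ _ (heval 0 (by simp))
      (heval 1 (by simp)), iterate_derivative_eq_zero_of_degree_lt hp, map_zero, mul_zero]
  exact (mul_eq_zero.1 hrodrigues).resolve_left (mod_cast n.factorial_ne_zero)

lemma degree_X_mul_derivative_sub_lt {p : ℝ[X]} {n : ℕ} (hp : p.degree ≤ n) :
    (X * derivative p - (n : ℝ) • p).degree < (n : WithBot ℕ) := by
  refine (degree_lt_iff_coeff_zero _ _).2 fun m hm => ?_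
  have hcoeff : (X * derivative p).coeff m = m * p.coeff m := by
    cases m with
    | zero => simp
    | succ m => rw [coeff_X_mul, coeff_derivative, mul_comm]; push_cast; rfl
  rw [coeff_sub, hcoeff, coeff_smul, smul_eq_mul, ← sub_mul]
  rcases hm.eq_or_lt with rfl | hm
  · rw [sub_self, zero_mul]
  · rw [coeff_eq_zero_of_degree_lt (hp.trans_lt (mod_cast hm)), mul_zero]

-- `∫ L² = [x L²] - 2 ∫ L (x L')`, and `x L' - n L` is orthogonal to `L` for degree reasons.
lemma unitInner_legendreUnit_self (n : ℕ) :
    unitInner (legendreUnit n) (legendreUnit n) = 1 / (2 * (n : ℝ) + 1) := by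
  set L := legendreUnit n
  have hparts := unitInner_derivative_left (X * L) L
  have hlow := unitInner_legendreUnit_of_degree_lt
    (degree_X_mul_derivative_sub_lt (degree_legendreUnit n).le)
  have hmove : unitInner (X * L) (derivative L) = unitInner L (X * derivative L) := by
    simp only [unitInner_apply, eval_mul, eval_X, mul_assoc, mul_left_comm]
  rw [map_sub, map_smul, smul_eq_mul] at hlow
  rw [derivative_mul, derivative_X, one_mul, map_add, LinearMap.add_apply,
    unitInner_comm (X * derivative L), hmove, eval_mul, eval_X, eval_mul, eval_X,
    legendreUnit_eval_one, one_mul, ← mul_pow, neg_one_mul, neg_neg, one_pow] at hparts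
  rw [eq_div_iff (by positivity)]
  linear_combination hparts - 2 * hlow

lemma unitInner_legendreUnit (i j : ℕ) :
    unitInner (legendreUnit i) (legendreUnit j) = if i = j then 1 / (2 * (i : ℝ) + 1) else 0 := by
  have hdeg : ∀ {i j : ℕ}, i < j → (legendreUnit i).degree < j := fun h => by
    rw [degree_legendreUnit]; exact mod_cast h
  rcases lt_trichotomy i j with h | rfl | h
  · rw [if_neg h.ne, unitInner_comm, unitInner_legendreUnit_of_degree_lt (hdeg h)]
  · rw [if_pos rfl, unitInner_legendreUnit_self]
  · rw [if_neg h.ne', unitInner_legendreUnit_of_degree_lt (hdeg h)]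

lemma eq_zero_of_forall_unitInner_legendreUnit {p : ℝ[X]} {n : ℕ} (hdeg : p.degree < n)
    (hp : ∀ i < n, unitInner p (legendreUnit i) = 0) : p = 0 := by
  let S : Sequence ℝ := ⟨legendreUnit, degree_legendreUnit⟩
  have hspan : p ∈ Submodule.span ℝ (S '' Set.Iio n) := by
    rw [S.span_degreeLT fun i _ => (leadingCoeff_ne_zero.2 (S.ne_zero i)).isUnit]
    exact mem_degreeLT.2 hdeg
  have hker : Submodule.span ℝ (S '' Set.Iio n) ≤ LinearMap.ker (unitInner p) := by
    rw [Submodule.span_le]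
    rintro _ ⟨i, hi, rfl⟩
    exact hp i hi
  exact eq_zero_of_unitInner_self (hker hspan)

lemma eq_sum_legendreUnit {p : ℝ[X]} {n : ℕ} (hdeg : p.degree < n) :
    p = ∑ i ∈ Finset.range n,
      ((2 * (i : ℝ) + 1) * unitInner p (legendreUnit i)) • legendreUnit i := by
  have hsum : (∑ i ∈ Finset.range n,
      ((2 * (i : ℝ) + 1) * unitInner p (legendreUnit i)) • legendreUnit i).degree < n := by
    refine mem_degreeLT.1 (Submodule.sum_mem _ fun i hi => Submodule.smul_mem _ _ ?_)
    rw [mem_degreeLT, degree_legendreUnit]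
    exact mod_cast Finset.mem_range.1 hi
  refine sub_eq_zero.1 (eq_zero_of_forall_unitInner_legendreUnit (n := n)
    ((degree_sub_le _ _).trans_lt (max_lt hdeg hsum)) fun j hj => ?_)
  have hj' : (2 * (j : ℝ) + 1) ≠ 0 := by positivity
  simp only [map_sub, LinearMap.sub_apply, map_sum, LinearMap.sum_apply, map_smul,
    LinearMap.smul_apply, unitInner_legendreUnit, smul_eq_mul, mul_ite, mul_zero,
    Finset.sum_ite_eq', Finset.mem_range.2 hj, if_true]
  field_simp
  ring

lemma derivative_legendreUnit (k : ℕ) :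
    derivative (legendreUnit k) = ∑ i ∈ Finset.range k, gammaCoeff k i • legendreUnit i := by
  have hne : legendreUnit k ≠ 0 := fun h => by simpa [h] using degree_legendreUnit k
  have hdeg : (derivative (legendreUnit k)).degree < k :=
    (degree_derivative_lt hne).trans_eq (degree_legendreUnit k)
  conv_lhs => rw [eq_sum_legendreUnit hdeg]
  refine Finset.sum_congr rfl fun i hi => ?_
  have hik : i < k := Finset.mem_range.1 hi
  have hi_deg : (derivative (legendreUnit i)).degree < k :=
    (degree_derivative_le).trans_lt (by rw [degree_legendreUnit]; exact mod_cast hik)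
  rw [unitInner_derivative_left, unitInner_legendreUnit_of_degree_lt hi_deg, gammaCoeff,
    if_pos hik.le]
  simp only [legendreUnit_eval_zero, legendreUnit_eval_one, ← pow_add]
  ring_nf

/-- The Legendre polynomial of the interval `[-h, 0]`, with value `1` at `0`. -/
def legendreDelay (h : ℝ) (k : ℕ) : ℝ[X] := (legendreUnit k).comp (C (-1 / h) * X)

lemma legendreDelay_eval (h : ℝ) (k : ℕ) (θ : ℝ) :
    (legendreDelay h k).eval θ = (legendreUnit k).eval (-1 / h * θ) := by
  simp [legendreDelay]

lemma legendreDelay_eval_zero (h : ℝ) (k : ℕ) : (legendreDelay h k).eval 0 = 1 := by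
  rw [legendreDelay_eval, mul_zero, legendreUnit_eval_zero]

lemma legendreDelay_eval_neg {h : ℝ} (hh : h ≠ 0) (k : ℕ) :
    (legendreDelay h k).eval (-h) = (-1) ^ k := by
  rw [legendreDelay_eval, show -1 / h * -h = 1 by field_simp, legendreUnit_eval_one]

lemma derivative_legendreDelay (h : ℝ) (k : ℕ) :
    derivative (legendreDelay h k) =
      -∑ i ∈ Finset.range k, (gammaCoeff k i / h) • legendreDelay h i := by
  have hC : derivative (C (-1 / h) * X : ℝ[X]) = C (-1 / h) := by simp
  rw [legendreDelay, derivative_comp, derivative_legendreUnit, Polynomial.sum_comp,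
    hC, ← smul_eq_C_mul, Finset.smul_sum, ← Finset.sum_neg_distrib]
  refine Finset.sum_congr rfl fun i _ => ?_
  rw [smul_comp, smul_smul, ← neg_smul, legendreDelay]
  congr 1
  ring

lemma integral_legendreDelay_mul {h : ℝ} (hh : h ≠ 0) (i j : ℕ) :
    ∫ θ in (-h)..0, (legendreDelay h i).eval θ * (legendreDelay h j).eval θ =
      if i = j then h / (2 * (i : ℝ) + 1) else 0 := by
  have hsubst := intervalIntegral.integral_comp_mul_left (a := -h) (b := 0)
    (fun x => (legendreUnit i).eval x * (legendreUnit j).eval x)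
    (div_ne_zero (neg_ne_zero.2 one_ne_zero) hh : -1 / h ≠ 0)
  simp only [legendreDelay_eval]
  rw [hsubst, show -1 / h * -h = 1 by field_simp, mul_zero, intervalIntegral.integral_symm,
    ← unitInner_apply, unitInner_legendreUnit]
  split_ifs
  · rw [smul_eq_mul]; field_simp
  · rw [neg_zero, smul_zero]

end Legendre

/-! ### Primitives of square integrable functions -/

instance isFiniteMeasure_restrict_uIoc (a b : ℝ) :
    IsFiniteMeasure (volume.restrict (Set.uIoc a b)) :=
  inferInstanceAs (IsFiniteMeasure (volume.restrict (Set.Ioc _ _)))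

lemma memLp_uIoc_of_continuous {E : Type*} [NormedAddCommGroup E] {f : ℝ → E} (hf : Continuous f)
    (a b : ℝ) : MemLp f 2 (volume.restrict (Set.uIoc a b)) := by
  obtain ⟨C, hC⟩ := isCompact_uIcc.exists_bound_of_continuousOn (s := Set.uIcc a b) hf.continuousOn
  exact MemLp.of_bound hf.aestronglyMeasurable C
    (ae_restrict_of_forall_mem measurableSet_uIoc fun s hs => hC s (Set.uIoc_subset_uIcc hs))

/-- `f` is a primitive of the locally square integrable function `g`: the form in which
trajectories of class `W` enter the integral estimates. -/
structure HasL2Deriv {E : Type*} [NormedAddCommGroup E] [NormedSpace ℝ E] (f g : ℝ → E) :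
    Prop where
  memLp : ∀ a b, MemLp g 2 (volume.restrict (Set.uIoc a b))
  ftc : ∀ a b, f b - f a = ∫ s in a..b, g s

/-- The segment `θ ↦ f (t + θ)` of `f` seen from time `t`; only `θ ∈ [-h, 0]` matters. -/
def history {E : Type*} (f : ℝ → E) (t : ℝ) : ℝ → E := fun θ => f (t + θ)

namespace HasL2Deriv

variable {E F : Type*} [NormedAddCommGroup E] [NormedSpace ℝ E] [NormedAddCommGroup F]
  [NormedSpace ℝ F] {f g : ℝ → E}

lemma intervalIntegrable (H : HasL2Deriv f g) (a b : ℝ) : IntervalIntegrable g volume a b :=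
  intervalIntegrable_iff.2 ((H.memLp a b).integrable one_le_two)

lemma intervalIntegrable_bilin (H : HasL2Deriv f g) (B : E →L[ℝ] E →L[ℝ] ℝ) (a b : ℝ) :
    IntervalIntegrable (fun s => B (g s) (g s)) volume a b :=
  intervalIntegrable_iff.2
    (memLp_one_iff_integrable.1 (B.memLp_of_bilin 1 (H.memLp a b) (H.memLp a b)))

lemma eq_add_integral (H : HasL2Deriv f g) (a t : ℝ) : f t = f a + ∫ s in a..t, g s := by
  rw [← H.ftc, add_sub_cancel]

lemma continuous (H : HasL2Deriv f g) : Continuous f := by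
  rw [funext (H.eq_add_integral 0)]
  exact continuous_const.add (intervalIntegral.continuous_primitive H.intervalIntegrable 0)

lemma history (H : HasL2Deriv f g) (t : ℝ) : HasL2Deriv (history f t) (history g t) where
  memLp a b := by
    have hpre : (fun s : ℝ => t + s) ⁻¹' Set.uIoc (t + a) (t + b) = Set.uIoc a b := by
      ext s
      simp only [Set.mem_preimage, Set.uIoc, Set.mem_Ioc, min_add_add_left, max_add_add_left,
        add_lt_add_iff_left, add_le_add_iff_left]
    have hmp := (measurePreserving_add_left (volume : Measure ℝ) t).restrict_preimage_emb
      (measurableEmbedding_addLeft t) (Set.uIoc (t + a) (t + b))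
    rw [hpre] at hmp
    exact (H.memLp (t + a) (t + b)).comp_measurePreserving hmp
  ftc a b := by
    simp only [ResetPIRI.history]
    rw [H.ftc, intervalIntegral.integral_comp_add_left]

lemma clm_comp [CompleteSpace E] [CompleteSpace F] (H : HasL2Deriv f g) (ℓ : E →L[ℝ] F) :
    HasL2Deriv (fun s => ℓ (f s)) (fun s => ℓ (g s)) where
  memLp a b := ℓ.comp_memLp' (H.memLp a b)
  ftc a b := by
    rw [← map_sub, H.ftc, ℓ.intervalIntegral_comp_comm (H.intervalIntegrable a b)]

lemma ae_hasDerivAt [CompleteSpace E] (H : HasL2Deriv f g) (a b : ℝ) :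
    ∀ᵐ s, s ∈ Set.uIcc a b → HasDerivAt f (g s) s := by
  filter_upwards [(H.intervalIntegrable a b).ae_hasDerivAt_integral] with s hs hsI
  rw [funext (H.eq_add_integral a)]
  exact (hs hsI a Set.left_mem_uIcc).const_add (f a)

lemma absolutelyContinuousOnInterval {f g : ℝ → ℝ} (H : HasL2Deriv f g) (a b : ℝ) :
    AbsolutelyContinuousOnInterval f a b := by
  have hprim := (H.intervalIntegrable a b).absolutelyContinuousOnInterval_intervalIntegral
    (c := a) Set.left_mem_uIcc
  have hconst : AbsolutelyContinuousOnInterval (fun _ : ℝ => f a) a b :=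
    (LipschitzWith.const (f a)).lipschitzOnWith.absolutelyContinuousOnInterval
  rw [funext (H.eq_add_integral a)]
  exact hconst.add hprim

lemma integral_mul {f g : ℝ → ℝ} (H : HasL2Deriv f g) {p : ℝ → ℝ} (hp : ContDiff ℝ 1 p)
    (a b : ℝ) :
    ∫ s in a..b, p s * g s = p b * f b - p a * f a - ∫ s in a..b, deriv p s * f s := by
  rw [← hp.contDiffOn.absolutelyContinuousOnInterval.integral_mul_deriv_eq_deriv_mul
    (H.absolutelyContinuousOnInterval a b)]
  refine intervalIntegral.integral_congr_ae ?_
  filter_upwards [H.ae_hasDerivAt a b] with s hs hsI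
  rw [(hs (Set.uIoc_subset_uIcc hsI)).deriv]

-- Mathlib integrates absolutely continuous functions by parts only for real values; continuous
-- linear functionals transfer the formula to `E`.
lemma integral_smul [CompleteSpace E] (H : HasL2Deriv f g) {p : ℝ → ℝ} (hp : ContDiff ℝ 1 p)
    (a b : ℝ) :
    ∫ s in a..b, p s • g s = p b • f b - p a • f a - ∫ s in a..b, deriv p s • f s := by
  refine SeparatingDual.eq_iff_forall_dual_eq (R := ℝ) |>.2 fun ℓ => ?_
  have hg : IntervalIntegrable (fun s => p s • g s) volume a b :=
    (H.intervalIntegrable a b).continuousOn_smul hp.continuous.continuousOn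
  have hf : IntervalIntegrable (fun s => deriv p s • f s) volume a b :=
    ((hp.continuous_deriv le_rfl).smul H.continuous).intervalIntegrable a b
  simp only [map_sub, map_smul, ← ℓ.intervalIntegral_comp_comm hg,
    ← ℓ.intervalIntegral_comp_comm hf, smul_eq_mul]
  exact (H.clm_comp ℓ).integral_mul hp a b

end HasL2Deriv

section Primitive

variable {E : Type*} [NormedAddCommGroup E] [NormedSpace ℝ E] {f : ℝ → E}

lemma hasDerivAt_integral_smul_history {F : ℝ → E} (hf : Continuous f)
    (hF : ∀ t, HasDerivAt F (f t) t) {p : ℝ → ℝ} (hp : Continuous p) (a b t : ℝ) :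
    HasDerivAt (fun t => ∫ θ in a..b, p θ • history F t θ)
      (∫ θ in a..b, p θ • history f t θ) t := by
  have hFc : Continuous F := continuous_iff_continuousAt.2 fun t => (hF t).continuousAt
  obtain ⟨C, hC⟩ := (isCompact_closedBall t 1).prod (isCompact_uIcc (a := a) (b := b))
    |>.exists_bound_of_continuousOn (f := fun x : ℝ × ℝ => p x.2 • history f x.1 x.2)
    (by unfold history; fun_prop)
  refine (intervalIntegral.hasDerivAt_integral_of_dominated_loc_of_deriv_le (bound := fun _ => C)
    (Metric.closedBall_mem_nhds t one_pos) (.of_forall fun t => ?_) ?_ ?_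
    (.of_forall fun θ hθ x hx => hC (x, θ) ⟨hx, Set.uIoc_subset_uIcc hθ⟩)
    (intervalIntegrable_const) (.of_forall fun θ _ x _ => ?_)).2
  · exact Continuous.aestronglyMeasurable (by unfold history; fun_prop)
  · exact Continuous.intervalIntegrable (by unfold history; fun_prop) _ _
  · exact Continuous.aestronglyMeasurable (by unfold history; fun_prop)
  · exact ((hF (x + θ)).comp_add_const x θ).const_smul (p θ)

variable [CompleteSpace E]

lemma integral_smul_history {F : ℝ → E} (hf : Continuous f) (hF : ∀ t, HasDerivAt F (f t) t)
    {p : ℝ → ℝ} (hp : ContDiff ℝ 1 p) (h t : ℝ) :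
    ∫ θ in (-h)..0, p θ • history f t θ =
      p 0 • F t - p (-h) • F (t - h) - ∫ θ in (-h)..0, deriv p θ • history F t θ := by
  have hparts := intervalIntegral.integral_smul_deriv_eq_deriv_smul (a := -h) (b := 0)
    (fun θ _ => (hp.differentiable one_ne_zero θ).hasDerivAt)
    (fun θ _ => (hF (t + θ)).comp_const_add t θ)
    ((hp.continuous_deriv le_rfl).intervalIntegrable _ _)
    ((hf.comp (continuous_const_add t)).intervalIntegrable _ _)
  simpa only [history, add_zero, ← sub_eq_add_neg] using hparts

lemma hasDerivAt_integral_smul_history_of_contDiff (hf : Continuous f) {p : ℝ → ℝ}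
    (hp : ContDiff ℝ 1 p) (h t : ℝ) :
    HasDerivAt (fun t => ∫ θ in (-h)..0, p θ • history f t θ)
      (p 0 • f t - p (-h) • f (t - h) - ∫ θ in (-h)..0, deriv p θ • history f t θ) t := by
  have hF := fun t => (hf.integral_hasStrictDerivAt 0 t).hasDerivAt
  rw [funext (integral_smul_history hf hF hp h)]
  exact (((hF t).const_smul _).sub (((hF (t - h)).comp_sub_const t h).const_smul _)).sub
    (hasDerivAt_integral_smul_history hf hF (hp.continuous_deriv le_rfl) _ _ t)

end Primitive

/-! ### Legendre moments -/

section Moment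

open Polynomial

variable {E : Type*} [NormedAddCommGroup E] [NormedSpace ℝ E] {h : ℝ}

/-- The `k`-th Legendre moment of `f` on the delay interval `[-h, 0]`. -/
def moment (h : ℝ) (k : ℕ) (f : ℝ → E) : E := ∫ θ in (-h)..0, (legendreDelay h k).eval θ • f θ

/-- The Legendre sum `∑ k < m, L_k • a k` with coefficients `a k`. -/
def legendreSum (h : ℝ) (m : ℕ) (a : ℕ → E) (θ : ℝ) : E :=
  ∑ k ∈ Finset.range m, (legendreDelay h k).eval θ • a k

lemma contDiff_legendreDelay (h : ℝ) (k : ℕ) : ContDiff ℝ 1 fun θ => (legendreDelay h k).eval θ :=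
  by simpa only [coe_aeval_eq_eval] using! (legendreDelay h k).contDiff_aeval (𝕜 := ℝ) 1

lemma continuous_legendreSum (h : ℝ) (m : ℕ) (a : ℕ → E) : Continuous (legendreSum h m a) :=
  continuous_finsetSum _ fun k _ => (legendreDelay h k).continuous.smul continuous_const

lemma integral_deriv_legendreDelay_smul (k : ℕ) {f : ℝ → E} (hf : Continuous f) :
    ∫ θ in (-h)..0, deriv (fun θ => (legendreDelay h k).eval θ) θ • f θ =
      -∑ i ∈ Finset.range k, (gammaCoeff k i / h) • moment h i f := by
  simp only [moment, ← intervalIntegral.integral_smul]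
  rw [← intervalIntegral.integral_finsetSum, ← intervalIntegral.integral_neg]
  · simp only [Polynomial.deriv, derivative_legendreDelay, eval_neg, eval_finsetSum, eval_smul,
      smul_eq_mul, neg_smul, Finset.sum_smul, mul_smul]
  · exact fun i _ => (((legendreDelay h i).continuous.smul hf).const_smul _).intervalIntegrable _ _

lemma moment_history_deriv [CompleteSpace E] (hh : h ≠ 0) (k : ℕ) {f g : ℝ → E}
    (H : HasL2Deriv f g) (t : ℝ) :
    moment h k (history g t) = f t + (-1 : ℝ) ^ (k + 1) • f (t - h)
      + ∑ i ∈ Finset.range k, (gammaCoeff k i / h) • moment h i (history f t) := by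
  rw [moment, (H.history t).integral_smul (contDiff_legendreDelay h k),
    integral_deriv_legendreDelay_smul k (H.history t).continuous, legendreDelay_eval_zero,
    legendreDelay_eval_neg hh, history, history, add_zero, ← sub_eq_add_neg]
  module

lemma hasDerivAt_moment_history [CompleteSpace E] (hh : h ≠ 0) (k : ℕ) {f : ℝ → E}
    (hf : Continuous f) (t : ℝ) :
    HasDerivAt (fun t => moment h k (history f t)) (f t + (-1 : ℝ) ^ (k + 1) • f (t - h)
      + ∑ i ∈ Finset.range k, (gammaCoeff k i / h) • moment h i (history f t)) t := by
  refine (hasDerivAt_integral_smul_history_of_contDiff hf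
    (contDiff_legendreDelay h k) h t).congr_deriv ?_
  rw [integral_deriv_legendreDelay_smul k (f := history f t) (hf.comp (continuous_const_add t)),
    legendreDelay_eval_zero, legendreDelay_eval_neg hh]
  module

lemma exists_norm_moment_le (h : ℝ) (k : ℕ) : ∃ C, 0 ≤ C ∧ ∀ (f : ℝ → E) (B : ℝ),
    (∀ θ ∈ Set.uIcc (-h) 0, ‖f θ‖ ≤ B) → ‖moment h k f‖ ≤ C * B := by
  obtain ⟨C, hC⟩ := isCompact_uIcc.exists_bound_of_continuousOn (s := Set.uIcc (-h) 0)
    (legendreDelay h k).continuous.continuousOn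
  have hC0 : 0 ≤ C := (norm_nonneg _).trans (hC 0 Set.right_mem_uIcc)
  refine ⟨C * |0 - -h|, by positivity, fun f B hB => ?_⟩
  rw [mul_right_comm]
  refine intervalIntegral.norm_integral_le_of_norm_le_const fun θ hθ => ?_
  have hθ' := Set.uIoc_subset_uIcc hθ
  rw [norm_smul]
  gcongr
  exacts [hC θ hθ', hB θ hθ']

lemma moment_legendreSum [CompleteSpace E] (hh : h ≠ 0) {m k : ℕ} (hk : k < m) (a : ℕ → E) :
    moment h k (legendreSum h m a) = (h / (2 * (k : ℝ) + 1)) • a k := by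
  simp only [moment, legendreSum, Finset.smul_sum, smul_smul]
  rw [intervalIntegral.integral_finsetSum
    fun i _ => Continuous.intervalIntegrable (by fun_prop) _ _]
  simp only [intervalIntegral.integral_smul_const, integral_legendreDelay_mul hh, ite_smul,
    zero_smul, Finset.sum_ite_eq, Finset.mem_range.2 hk, if_true]

section Bessel

variable [CompleteSpace E] {f : ℝ → E}

lemma integral_bilin_legendreSum (B : E →L[ℝ] E →L[ℝ] ℝ) (hf : IntervalIntegrable f volume (-h) 0)
    (m : ℕ) (a : ℕ → E) :
    ∫ θ in (-h)..0, B (legendreSum h m a θ) (f θ) =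
      ∑ k ∈ Finset.range m, B (a k) (moment h k f) := by
  have hLf (k : ℕ) : IntervalIntegrable (fun θ => (legendreDelay h k).eval θ • f θ)
      volume (-h) 0 := hf.continuousOn_smul (legendreDelay h k).continuous.continuousOn
  have hpt (θ : ℝ) : B (legendreSum h m a θ) (f θ) =
      ∑ k ∈ Finset.range m, B (a k) ((legendreDelay h k).eval θ • f θ) := by
    simp only [legendreSum, map_sum, map_smul, _root_.sum_apply, _root_.smul_apply]
  simp only [hpt, moment, ← (B _).intervalIntegral_comp_comm (hLf _)]
  refine intervalIntegral.integral_finsetSum fun k _ => ?_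
  exact ⟨(B (a k)).integrable_comp (hLf k).1, (B (a k)).integrable_comp (hLf k).2⟩

-- Expand the nonnegative integral of `B (f - q) (f - q)`, where `q` is the Legendre sum with the
-- moments of `f`.
lemma sum_bilin_moment_le (B : E →L[ℝ] E →L[ℝ] ℝ) (hB : ∀ x, 0 ≤ B x x) (hh : 0 < h) (m : ℕ)
    (hf : MemLp f 2 (volume.restrict (Set.uIoc (-h) 0))) :
    ∑ k ∈ Finset.range m, (2 * (k : ℝ) + 1) * B (moment h k f) (moment h k f) ≤
      h * ∫ θ in (-h)..0, B (f θ) (f θ) := by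
  set c : ℕ → ℝ := fun k => 2 * (k : ℝ) + 1 with hc
  set a : ℕ → E := fun k => (c k / h) • moment h k f with ha
  set q := legendreSum h m a
  have hqc : Continuous q := continuous_legendreSum h m a
  have hq : MemLp q 2 (volume.restrict (Set.uIoc (-h) 0)) :=
    memLp_uIoc_of_continuous hqc _ _
  have hint {u v : ℝ → E} (hu : MemLp u 2 (volume.restrict (Set.uIoc (-h) 0)))
      (hv : MemLp v 2 (volume.restrict (Set.uIoc (-h) 0))) :
      IntervalIntegrable (fun θ => B (u θ) (v θ)) volume (-h) 0 :=
    intervalIntegrable_iff.2 (memLp_one_iff_integrable.1 (B.memLp_of_bilin 1 hu hv))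
  have hf1 : IntervalIntegrable f volume (-h) 0 :=
    intervalIntegrable_iff.2 (hf.integrable one_le_two)
  have hqf : ∫ θ in (-h)..0, B (q θ) (f θ) = ∑ k ∈ Finset.range m, B (a k) (moment h k f) :=
    integral_bilin_legendreSum B hf1 m a
  have hfq : ∫ θ in (-h)..0, B (f θ) (q θ) = ∑ k ∈ Finset.range m, B (moment h k f) (a k) :=
    integral_bilin_legendreSum B.flip hf1 m a
  have hqq : ∫ θ in (-h)..0, B (q θ) (q θ) = ∑ k ∈ Finset.range m, B (a k) (moment h k f) := by
    refine (integral_bilin_legendreSum B (hqc.intervalIntegrable _ _) m a).trans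
      (Finset.sum_congr rfl fun k hk => ?_)
    have hck : c k ≠ 0 := by positivity
    rw [moment_legendreSum hh.ne' (Finset.mem_range.1 hk), ha, smul_smul,
      show h / (2 * (k : ℝ) + 1) * (c k / h) = 1 by simp only [hc] at hck ⊢; field_simp, one_smul]
  have hpos : 0 ≤ ∫ θ in (-h)..0, B (f θ - q θ) (f θ - q θ) :=
    intervalIntegral.integral_nonneg (by linarith) fun θ _ => hB _
  simp only [map_sub, _root_.sub_apply] at hpos
  rw [intervalIntegral.integral_sub ((hint hf hf).sub (hint hq hf))
    ((hint hf hq).sub (hint hq hq)), intervalIntegral.integral_sub (hint hf hf) (hint hq hf),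
    intervalIntegral.integral_sub (hint hf hq) (hint hq hq), hqf, hfq, hqq] at hpos
  simp only [ha, map_smul, _root_.smul_apply, smul_eq_mul, div_mul_eq_mul_div, ← Finset.sum_div]
    at hpos
  rw [sub_self, sub_zero, sub_nonneg, div_le_iff₀' hh] at hpos
  exact hpos

end Bessel

end Moment

/-! ### Quadratic forms -/

section Coercive

variable {E F : Type*} [NormedAddCommGroup E] [NormedSpace ℝ E] [NormedAddCommGroup F]
  [NormedSpace ℝ F]

lemma bilin_self_le (B : E →L[ℝ] E →L[ℝ] ℝ) (x : E) : B x x ≤ ‖B‖ * ‖x‖ ^ 2 :=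
  (le_abs_self _).trans ((B.le_opNorm₂ x x).trans_eq (by ring))

lemma exists_pos_mul_norm_sq_le [FiniteDimensional ℝ E] {B : E →L[ℝ] E →L[ℝ] ℝ}
    (hB : ∀ x, x ≠ 0 → 0 < B x x) : ∃ c > 0, ∀ x, c * ‖x‖ ^ 2 ≤ B x x := by
  rcases subsingleton_or_nontrivial E with hE | hE
  · exact ⟨1, one_pos, fun x => by simp [Subsingleton.elim x 0]⟩
  obtain ⟨u, hu, hmin⟩ := (isCompact_sphere (0 : E) 1).exists_isMinOn
    (NormedSpace.sphere_nonempty.2 zero_le_one)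
    (f := fun x => B x x) (by fun_prop)
  refine ⟨B u u, hB u fun h => by simp [h] at hu, fun x => ?_⟩
  rcases eq_or_ne x 0 with rfl | hx
  · simp
  have hn : ‖x‖ ≠ 0 := norm_ne_zero_iff.2 hx
  have hle : B u u ≤ B (‖x‖⁻¹ • x) (‖x‖⁻¹ • x) := hmin (by simp [norm_smul, hn])
  calc B u u * ‖x‖ ^ 2 ≤ B (‖x‖⁻¹ • x) (‖x‖⁻¹ • x) * ‖x‖ ^ 2 := by gcongr
    _ = B x x := by
      simp only [map_smul, _root_.smul_apply, smul_eq_mul]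
      field_simp

lemma exists_neg_mul_norm_sq_le_add {B : E →L[ℝ] E →L[ℝ] ℝ} {c : ℝ} (hc : 0 < c)
    (hB : ∀ x, c * ‖x‖ ^ 2 ≤ B x x) (Z : E →L[ℝ] F →L[ℝ] ℝ) :
    ∃ C, 0 ≤ C ∧ ∀ x y, -(C * ‖y‖ ^ 2) ≤ B x x + 2 * Z x y := by
  refine ⟨‖Z‖ ^ 2 / c, by positivity, fun x y => ?_⟩
  have hZ : -(‖Z‖ * ‖x‖ * ‖y‖) ≤ Z x y := (abs_le.1 (Z.le_opNorm₂ x y)).1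
  have hsq : 0 ≤ (c * ‖x‖ - ‖Z‖ * ‖y‖) ^ 2 / c := by positivity
  have hexp : (c * ‖x‖ - ‖Z‖ * ‖y‖) ^ 2 / c =
      c * ‖x‖ ^ 2 - 2 * (‖Z‖ * ‖x‖ * ‖y‖) + ‖Z‖ ^ 2 / c * ‖y‖ ^ 2 := by
    field_simp
    ring
  linarith [hB x]

end Coercive

section Bil

open Matrix

/-- The bilinear form `(x, y) ↦ xᵀ M y`, bundled as a continuous bilinear map. -/
def bil {m n : Type*} [Fintype m] [Fintype n] (M : Matrix m n ℝ) :
    (m → ℝ) →L[ℝ] (n → ℝ) →L[ℝ] ℝ :=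
  ((dotProductBilin ℝ ℝ).compl₂ M.mulVecLin).toContinuousBilinearMap

lemma isSymm_of_posDef {m : Type*} {M : Matrix m m ℝ} (hM : M.PosDef) : M.IsSymm := by
  simpa only [IsHermitian, conjTranspose_eq_transpose_of_trivial] using! hM.isHermitian

variable {m n k l : Type*} [Fintype m] [Fintype n] [Fintype k] [Fintype l]

lemma bil_apply (M : Matrix m n ℝ) (x : m → ℝ) (y : n → ℝ) : bil M x y = x ⬝ᵥ M *ᵥ y := rfl

lemma bil_zero (x : m → ℝ) (y : n → ℝ) : bil (0 : Matrix m n ℝ) x y = 0 := by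
  simp only [bil_apply, zero_mulVec, dotProduct_zero]

lemma bil_add (M M' : Matrix m n ℝ) (x : m → ℝ) (y : n → ℝ) :
    bil (M + M') x y = bil M x y + bil M' x y := by
  simp only [bil_apply, add_mulVec, dotProduct_add]

lemma bil_sub (M M' : Matrix m n ℝ) (x : m → ℝ) (y : n → ℝ) :
    bil (M - M') x y = bil M x y - bil M' x y := by
  simp only [bil_apply, sub_mulVec, dotProduct_sub]

lemma bil_neg (M : Matrix m n ℝ) (x : m → ℝ) (y : n → ℝ) : bil (-M) x y = -bil M x y := by
  simp only [bil_apply, neg_mulVec, dotProduct_neg]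

lemma bil_smul (c : ℝ) (M : Matrix m n ℝ) (x : m → ℝ) (y : n → ℝ) :
    bil (c • M) x y = c * bil M x y := by
  simp only [bil_apply, smul_mulVec, dotProduct_smul, smul_eq_mul]

lemma bil_transpose (M : Matrix m n ℝ) (x : m → ℝ) (y : n → ℝ) : bil Mᵀ y x = bil M x y := by
  rw [bil_apply, bil_apply, dotProduct_comm, mulVec_transpose, ← dotProduct_mulVec]

lemma bil_comm_of_isSymm {M : Matrix m m ℝ} (hM : M.IsSymm) (x y : m → ℝ) :
    bil M x y = bil M y x := by
  rw [← bil_transpose, hM.eq]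

lemma bil_transpose_mul_mul (A : Matrix k m ℝ) (P : Matrix k l ℝ) (B : Matrix l n ℝ)
    (x : m → ℝ) (y : n → ℝ) : bil (Aᵀ * P * B) x y = bil P (A *ᵥ x) (B *ᵥ y) := by
  rw [bil_apply, bil_apply, Matrix.mul_assoc, ← mulVec_mulVec, dotProduct_mulVec,
    vecMul_transpose, ← mulVec_mulVec]

lemma bil_mul (A : Matrix m k ℝ) (B : Matrix k n ℝ) (x : m → ℝ) (y : n → ℝ) :
    bil (A * B) x y = bil A x (B *ᵥ y) := by
  rw [bil_apply, bil_apply, ← mulVec_mulVec]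

lemma bil_He (M : Matrix m m ℝ) (x : m → ℝ) : bil (He M) x x = 2 * bil M x x := by
  rw [He, bil_add, bil_transpose, two_mul]

lemma bil_fromBlocks (A : Matrix m m ℝ) (B : Matrix m n ℝ) (C : Matrix n m ℝ) (D : Matrix n n ℝ)
    (x : m → ℝ) (y : n → ℝ) : bil (fromBlocks A B C D) (Sum.elim x y) (Sum.elim x y) =
      bil A x x + bil B x y + bil C y x + bil D y y := by
  rw [bil_apply, fromBlocks_mulVec, sumElim_dotProduct_sumElim, dotProduct_add, dotProduct_add,
    ← add_assoc]
  rfl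

lemma bil_pos {M : Matrix m m ℝ} (hM : M.PosDef) (x : m → ℝ) (hx : x ≠ 0) : 0 < bil M x x := by
  simpa [bil_apply] using hM.dotProduct_mulVec_pos hx

lemma bil_nonneg {M : Matrix m m ℝ} (hM : M.PosDef) (x : m → ℝ) : 0 ≤ bil M x x := by
  simpa [bil_apply] using hM.posSemidef.dotProduct_mulVec_nonneg x

lemma bil_nonpos_of_negDef {M : Matrix m m ℝ} (hM : NegDef M) (x : m → ℝ) : bil M x x ≤ 0 := by
  simpa only [bil_neg, Left.nonneg_neg_iff] using bil_nonneg hM x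

end Bil

/-! ### Evaluation of the LMI matrices -/

section Eval

open Matrix

variable {ν : Type*} [Fintype ν] {N : ℕ}

lemma bil_oddDiag (A : Matrix ν ν ℝ) (m : ℕ) (u : ℕ → ν → ℝ) :
    bil (oddDiag A m) (fun p => u p.2 p.1) (fun p => u p.2 p.1) =
      ∑ k ∈ Finset.range m, (2 * (k : ℝ) + 1) * bil A (u k) (u k) := by
  rw [← Fin.sum_univ_eq_sum_range fun k => (2 * (k : ℝ) + 1) * bil A (u k) (u k)]
  simp only [bil_apply, oddDiag, dotProduct, mulVec, blockDiagonal_apply, Fintype.sum_prod_type,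
    ite_mul, zero_mul, Finset.sum_ite_eq, Finset.mem_univ, if_true, Matrix.smul_apply, smul_eq_mul,
    Finset.mul_sum]
  rw [Finset.sum_comm]
  exact Finset.sum_congr rfl fun k _ => Finset.sum_congr rfl fun i _ =>
    Finset.sum_congr rfl fun j _ => by ring

/-- The vector `(a, b, z, c)` with block heights `n, n, nN, n`. -/
def xiVec (a b : ν → ℝ) (z : ν × Fin N → ℝ) (c : ν → ℝ) : XiIdx ν N → ℝ :=
  Sum.elim a (Sum.elim b (Sum.elim z c))

variable (a b c : ν → ℝ) (z : ν × Fin N → ℝ)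

lemma rowBlocks_mulVec {m : Type*} (A B : Matrix m ν ℝ) (C : Matrix m (ν × Fin N) ℝ)
    (D : Matrix m ν ℝ) :
    rowBlocks A B C D *ᵥ xiVec a b z c = A *ᵥ a + B *ᵥ b + C *ᵥ z + D *ᵥ c := by
  simp only [rowBlocks, xiVec, fromCols_mulVec_sumElim, add_assoc]

lemma matF_mulVec (Λ Λd K : Matrix ν ν ℝ) :
    matF Λ Λd K N *ᵥ xiVec a b z c = Λ *ᵥ a + Λd *ᵥ b + (Λ * K) *ᵥ c := by
  simp only [matF, rowBlocks_mulVec, zero_mulVec, add_zero]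

lemma bil_matSigma (S : Matrix ν ν ℝ) (α h : ℝ) :
    bil (matSigma S N α h) (xiVec a b z c) (xiVec a b z c) =
      bil S a a - Real.exp (-2 * α * h) * bil S b b := by
  rw [matSigma, xiVec, bil_fromBlocks, bil_fromBlocks, bil_neg, bil_smul]
  simp only [bil_zero]
  ring

variable [DecidableEq ν]

lemma N2_mulVec : N2 ν N *ᵥ xiVec a b z c = c := by
  simp only [N2, rowBlocks_mulVec, zero_mulVec, one_mulVec, zero_add]

lemma N12_mulVec : N12 ν N *ᵥ xiVec a b z c = a - c := by
  rw [N12, sub_mulVec, N2_mulVec, N1, rowBlocks_mulVec]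
  simp only [zero_mulVec, one_mulVec, add_zero]

lemma matG_mulVec (h : ℝ) : matG ν N h *ᵥ xiVec a b z c = Sum.elim a (h • z) := by
  rw [matG, fromRows_mulVec, rowBlocks_mulVec, rowBlocks_mulVec]
  simp only [smul_mulVec, zero_mulVec, one_mulVec, add_zero, zero_add]

lemma Gam_mulVec (k : ℕ) : Gam ν N k *ᵥ xiVec a b z c =
    a + (-1 : ℝ) ^ (k + 1) • b + ∑ i : Fin N, gammaCoeff k i • fun j => z (j, i) := by
  ext j
  rw [Gam, rowBlocks_mulVec]
  simp only [Pi.add_apply, one_mulVec, smul_mulVec, zero_mulVec, Pi.zero_apply, add_zero,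
    Finset.sum_apply, Pi.smul_apply, smul_eq_mul]
  congr 1
  simp only [mulVec, dotProduct, of_apply, ite_mul, zero_mul, Fintype.sum_prod_type]
  rw [Finset.sum_comm]
  simp only [Finset.sum_ite_eq, Finset.mem_univ, if_true]

lemma matH_mulVec (Λ Λd K : Matrix ν ν ℝ) (ξ : XiIdx ν N → ℝ) : matH Λ Λd K N *ᵥ ξ =
    Sum.elim (matF Λ Λd K N *ᵥ ξ) fun p => (Gam ν N p.2 *ᵥ ξ) p.1 := by
  rw [matH, fromRows_mulVec]
  rfl

lemma bil_Pi1 (Λ Λd K : Matrix ν ν ℝ) (α h : ℝ) (P : Matrix (AugIdx ν N) (AugIdx ν N) ℝ)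
    (S R Q Z : Matrix ν ν ℝ) (Y : Matrix (XiIdx ν N) ν ℝ) :
    let ξ := xiVec a b z c
    bil (Pi1 Λ Λd K N α h P S R Q Z Y) ξ ξ =
      2 * bil P (matG ν N h *ᵥ ξ) (matH Λ Λd K N *ᵥ ξ)
      + 2 * α * bil P (matG ν N h *ᵥ ξ) (matG ν N h *ᵥ ξ)
      + (bil S a a - Real.exp (-2 * α * h) * bil S b b)
      + h ^ 2 * bil R (matF Λ Λd K N *ᵥ ξ) (matF Λ Λd K N *ᵥ ξ)
      - Real.exp (-2 * α * h) * ∑ k ∈ Finset.range (N + 1), (2 * (k : ℝ) + 1) *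
          bil R (Gam ν N k *ᵥ ξ) (Gam ν N k *ᵥ ξ)
      - bil Q (a - c) (a - c) - 2 * bil Z (a - c) c + 2 * bil Y ξ (a - c) := by
  intro ξ
  rw [Pi1, bil_add, bil_sub, bil_sub, bil_sub, bil_add, bil_add, bil_add, bil_He, bil_He, bil_He,
    bil_smul, bil_smul, bil_matSigma, bil_transpose_mul_mul, bil_transpose_mul_mul,
    bil_transpose_mul_mul, bil_transpose_mul_mul, bil_transpose_mul_mul, bil_transpose_mul_mul,
    bil_mul, matRN, bil_smul, N12_mulVec, N2_mulVec,
    ← bil_oddDiag R (N + 1) fun k => Gam ν N k *ᵥ ξ]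
  rfl

lemma bil_Pi2 (Λ Λd K : Matrix ν ν ℝ) (Q U Z : Matrix ν ν ℝ) :
    let ξ := xiVec a b z c
    bil (Pi2 Λ Λd K N Q U Z) ξ ξ =
      bil U (matF Λ Λd K N *ᵥ ξ) (matF Λ Λd K N *ᵥ ξ)
      + 2 * bil Q (matF Λ Λd K N *ᵥ ξ) (a - c) + 2 * bil Z (matF Λ Λd K N *ᵥ ξ) c := by
  intro ξ
  rw [Pi2, bil_add, bil_add, bil_He, bil_He, bil_transpose_mul_mul, bil_transpose_mul_mul,
    bil_transpose_mul_mul, N12_mulVec, N2_mulVec]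

end Eval

/-! ### The Lyapunov functional -/

section Delay

lemma integral_history (f : ℝ → ℝ) (h t : ℝ) :
    ∫ θ in (-h)..0, history f t θ = ∫ s in (t - h)..t, f s := by
  simp only [history, intervalIntegral.integral_comp_add_left, add_zero, sub_eq_add_neg]

lemma hasDerivAt_exp_two_mul (α τ : ℝ) :
    HasDerivAt (fun s => Real.exp (2 * α * s)) (Real.exp (2 * α * τ) * (2 * α)) τ := by
  simpa using ((hasDerivAt_id τ).const_mul (2 * α)).exp

lemma hasDerivAt_integral_delay {f : ℝ → ℝ} (hf : Continuous f) (h t : ℝ) :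
    HasDerivAt (fun t => ∫ s in (t - h)..t, f s) (f t - f (t - h)) t := by
  have hsplit : (fun t => ∫ s in (t - h)..t, f s) =
      fun t => (∫ s in (0 : ℝ)..t, f s) - ∫ s in (0 : ℝ)..(t - h), f s := by
    ext t
    rw [intervalIntegral.integral_interval_sub_left] <;> exact hf.intervalIntegrable _ _
  rw [hsplit]
  exact (hf.integral_hasStrictDerivAt 0 t).hasDerivAt.sub
    ((hf.integral_hasStrictDerivAt 0 (t - h)).hasDerivAt.comp_sub_const t h)

lemma exp_mul_integral_delay_le {α h : ℝ} (hα : 0 ≤ α) (hh : 0 ≤ h) {f : ℝ → ℝ} (t : ℝ)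
    (hf : ∀ s, 0 ≤ f s) (hi : IntervalIntegrable f volume (t - h) t) :
    Real.exp (-2 * α * h) * ∫ s in (t - h)..t, f s ≤
      Real.exp (-2 * α * t) * ∫ s in (t - h)..t, Real.exp (2 * α * s) * f s := by
  rw [← intervalIntegral.integral_const_mul, ← intervalIntegral.integral_const_mul]
  refine intervalIntegral.integral_mono_on (by linarith) (hi.const_mul _)
    ((hi.continuousOn_mul (by fun_prop)).const_mul _) fun s hs => ?_
  rw [← mul_assoc, ← Real.exp_add]
  gcongr
  · exact hf s
  · nlinarith [hs.1]

end Delay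

section Energy

variable {E : Type*} [NormedAddCommGroup E] [NormedSpace ℝ E] {f g : ℝ → E} {α h : ℝ}
  {B : E →L[ℝ] E →L[ℝ] ℝ}

lemma hasDerivAt_integral_of_continuousOn {F : Type*} [NormedAddCommGroup F]
    [NormedSpace ℝ F] [CompleteSpace F] {G : ℝ → F} {a b s : ℝ}
    (hi : ∀ a b, IntervalIntegrable G volume a b) (hG : ContinuousOn G (Set.Ioo a b))
    (hs : s ∈ Set.Ioo a b) : HasDerivAt (fun t => ∫ r in (0 : ℝ)..t, G r) (G s) s :=
  intervalIntegral.integral_hasDerivAt_right (hi _ _)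
    (hG.stronglyMeasurableAtFilter isOpen_Ioo s hs) (hG.continuousAt (isOpen_Ioo.mem_nhds hs))

lemma HasL2Deriv.hasDerivAt [CompleteSpace E] (H : HasL2Deriv f g) {a b s : ℝ}
    (hg : ContinuousOn g (Set.Ioo a b)) (hs : s ∈ Set.Ioo a b) : HasDerivAt f (g s) s := by
  rw [funext (H.eq_add_integral 0)]
  exact (hasDerivAt_integral_of_continuousOn H.intervalIntegrable hg hs).const_add _

/-- The primitive of `e^{2αs} B(g(s), g(s))` that vanishes at `0`: the weighted energy of the
derivative `g` of a trajectory. -/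
def energy (α : ℝ) (B : E →L[ℝ] E →L[ℝ] ℝ) (g : ℝ → E) (t : ℝ) : ℝ :=
  ∫ s in (0 : ℝ)..t, Real.exp (2 * α * s) * B (g s) (g s)

lemma HasL2Deriv.intervalIntegrable_exp_mul (H : HasL2Deriv f g) (α : ℝ)
    (B : E →L[ℝ] E →L[ℝ] ℝ) (a b : ℝ) :
    IntervalIntegrable (fun s => Real.exp (2 * α * s) * B (g s) (g s)) volume a b :=
  (H.intervalIntegrable_bilin B a b).continuousOn_mul (by fun_prop)

lemma continuous_energy (H : HasL2Deriv f g) (α : ℝ) (B : E →L[ℝ] E →L[ℝ] ℝ) :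
    Continuous (energy α B g) :=
  intervalIntegral.continuous_primitive (H.intervalIntegrable_exp_mul α B) 0

lemma energy_sub (H : HasL2Deriv f g) (α : ℝ) (B : E →L[ℝ] E →L[ℝ] ℝ) (a b : ℝ) :
    energy α B g b - energy α B g a = ∫ s in a..b, Real.exp (2 * α * s) * B (g s) (g s) :=
  intervalIntegral.integral_interval_sub_left (H.intervalIntegrable_exp_mul α B _ _)
    (H.intervalIntegrable_exp_mul α B _ _)

lemma hasDerivAt_energy (H : HasL2Deriv f g) (α : ℝ) (B : E →L[ℝ] E →L[ℝ] ℝ) {a b s : ℝ}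
    (hg : ContinuousOn g (Set.Ioo a b)) (hs : s ∈ Set.Ioo a b) :
    HasDerivAt (energy α B g) (Real.exp (2 * α * s) * B (g s) (g s)) s :=
  hasDerivAt_integral_of_continuousOn (H.intervalIntegrable_exp_mul α B)
    (by fun_prop) hs

lemma monotone_energy (H : HasL2Deriv f g) (α : ℝ) (hB : ∀ x, 0 ≤ B x x) :
    Monotone (energy α B g) := by
  intro a b hab
  rw [← sub_nonneg, energy_sub H]
  exact intervalIntegral.integral_nonneg hab fun s _ => mul_nonneg (Real.exp_pos _).le (hB _)

lemma integral_delay_energy_mem_Icc (H : HasL2Deriv f g) (hh : 0 ≤ h) (hB : ∀ x, 0 ≤ B x x)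
    (t : ℝ) : ∫ s in (t - h)..t, energy α B g s ∈
      Set.Icc (h * energy α B g (t - h)) (h * energy α B g t) := by
  have hle : t - h ≤ t := by linarith
  have hint := (continuous_energy H α B).intervalIntegrable (μ := volume) (t - h) t
  have hmono := monotone_energy H α hB
  constructor
  · simpa only [intervalIntegral.integral_const, sub_sub_cancel, smul_eq_mul] using
      intervalIntegral.integral_mono_on hle intervalIntegrable_const hint
        fun s hs => hmono hs.1
  · simpa only [intervalIntegral.integral_const, sub_sub_cancel, smul_eq_mul] using
      intervalIntegral.integral_mono_on hle hint intervalIntegrable_const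
        fun s hs => hmono hs.2

lemma energy_sub_delay_le (H : HasL2Deriv f g) (hα : 0 ≤ α) (hh : 0 ≤ h) (t : ℝ) :
    energy α B g t - energy α B g (t - h) ≤
      ‖B‖ * Real.exp (2 * α * t) * ∫ s in (t - h)..t, ‖g s‖ ^ 2 := by
  rw [energy_sub H, ← intervalIntegral.integral_const_mul]
  refine intervalIntegral.integral_mono_on (by linarith) (H.intervalIntegrable_exp_mul α B _ _)
    ((intervalIntegrable_iff.2 (H.memLp _ _).norm.integrable_sq).const_mul _) fun s hs => ?_
  calc Real.exp (2 * α * s) * B (g s) (g s)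
      ≤ Real.exp (2 * α * t) * (‖B‖ * ‖g s‖ ^ 2) := by
        refine (mul_le_mul_of_nonneg_left (bilin_self_le B _) (Real.exp_pos _).le).trans ?_
        gcongr
        exact hs.2
    _ = ‖B‖ * Real.exp (2 * α * t) * ‖g s‖ ^ 2 := by ring

end Energy

section Augmented

open Matrix

variable {ν : Type*} [Fintype ν] {N : ℕ} {h : ℝ}

/-- The augmented state `(X(t), ∫ L₀ X, …, ∫ L_{N-1} X)`. -/
def augState (h : ℝ) (N : ℕ) (X : ℝ → ν → ℝ) (t : ℝ) : AugIdx ν N → ℝ :=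
  Sum.elim (X t) fun p => moment h p.2 (history X t) p.1

/-- The vector `(X(t), X(t-h), h⁻¹ ∫ L_i X, c)` to which the LMIs are applied. -/
def xiState (h : ℝ) (N : ℕ) (X : ℝ → ν → ℝ) (c : ν → ℝ) (t : ℝ) : XiIdx ν N → ℝ :=
  xiVec (X t) (X (t - h)) (h⁻¹ • fun p => moment h p.2 (history X t) p.1) c

variable {X v : ℝ → ν → ℝ}

lemma hasDerivAt_augState (hh : h ≠ 0) (H : HasL2Deriv X v) {s : ℝ}
    (hX : HasDerivAt X (v s) s) : HasDerivAt (augState h N X) (augState h N v s) s := by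
  rw [hasDerivAt_pi]
  rintro (j | ⟨j, k⟩)
  · exact hasDerivAt_pi.1 hX j
  · have hmom : HasDerivAt (fun t => moment h k (history X t)) (moment h k (history v s)) s :=
      (hasDerivAt_moment_history hh k H.continuous s).congr_deriv
        (moment_history_deriv hh k H s).symm
    exact hasDerivAt_pi.1 hmom j

lemma continuous_augState (hh : h ≠ 0) (hX : Continuous X) : Continuous (augState h N X) := by
  refine continuous_pi ?_
  rintro (j | ⟨j, k⟩)
  · exact (continuous_apply j).comp hX
  · exact (continuous_apply j).comp (continuous_iff_continuousAt.2 fun s =>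
      (hasDerivAt_moment_history hh k hX s).continuousAt)

lemma norm_le_norm_augState (X : ℝ → ν → ℝ) (t : ℝ) : ‖X t‖ ≤ ‖augState h N X t‖ :=
  (pi_norm_le_iff_of_nonneg (norm_nonneg _)).2 fun j =>
    norm_le_pi_norm (augState h N X t) (Sum.inl j)

lemma exists_norm_augState_le (h : ℝ) (N : ℕ) : ∃ C, 0 ≤ C ∧ ∀ (X : ℝ → ν → ℝ) (t B : ℝ),
    (∀ s ∈ Set.uIcc (t - h) t, ‖X s‖ ≤ B) → ‖augState h N X t‖ ≤ C * B := by
  choose C hC0 hC using exists_norm_moment_le (E := ν → ℝ) h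
  refine ⟨1 + ∑ k ∈ Finset.range N, C k,
    add_nonneg zero_le_one (Finset.sum_nonneg fun k _ => hC0 k), fun X t B hB => ?_⟩
  have hB0 : 0 ≤ B := (norm_nonneg _).trans (hB t Set.right_mem_uIcc)
  have hhist : ∀ θ ∈ Set.uIcc (-h) 0, ‖history X t θ‖ ≤ B := fun θ hθ => hB _ <| by
    simpa only [Set.image_const_add_uIcc, add_zero, ← sub_eq_add_neg] using
      Set.mem_image_of_mem (t + ·) hθ
  refine (pi_norm_le_iff_of_nonneg
    (mul_nonneg (add_nonneg zero_le_one (Finset.sum_nonneg fun k _ => hC0 k)) hB0)).2 ?_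
  rintro (j | ⟨j, k⟩)
  · refine (norm_le_pi_norm (X t) j).trans ((hB t Set.right_mem_uIcc).trans ?_)
    exact le_mul_of_one_le_left hB0 (le_add_of_nonneg_right (Finset.sum_nonneg fun k _ => hC0 k))
  · refine (norm_le_pi_norm (moment h k (history X t)) j).trans ((hC k _ B hhist).trans ?_)
    gcongr
    exact (Finset.single_le_sum (fun k _ => hC0 k) (Finset.mem_range.2 k.2)).trans
      (le_add_of_nonneg_left zero_le_one)

lemma continuousOn_of_flow {Λ Λd : Matrix ν ν ℝ} {u : ν → ℝ} {a b : ℝ} (hX : Continuous X)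
    (hv : ∀ s ∈ Set.Ioo a b, v s = Λ *ᵥ X s + Λd *ᵥ X (s - h) + u) :
    ContinuousOn v (Set.Ioo a b) :=
  ContinuousOn.congr (Continuous.continuousOn (by fun_prop)) hv

variable [DecidableEq ν]

lemma matG_mulVec_xiState (hh : h ≠ 0) (X : ℝ → ν → ℝ) (c : ν → ℝ) (t : ℝ) :
    matG ν N h *ᵥ xiState h N X c t = augState h N X t := by
  rw [xiState, matG_mulVec, smul_inv_smul₀ hh, augState]

lemma Gam_mulVec_xiState (hh : h ≠ 0) {k : ℕ} (hk : k ≤ N) (H : HasL2Deriv X v) (c : ν → ℝ)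
    (t : ℝ) : Gam ν N k *ᵥ xiState h N X c t = moment h k (history v t) := by
  rw [xiState, Gam_mulVec, moment_history_deriv hh k H]
  congr 1
  set w : ℕ → ν → ℝ := fun i => (gammaCoeff k i / h) • moment h i (history X t) with hw
  have hterm : ∀ i : Fin N, (gammaCoeff k i • fun j =>
      (h⁻¹ • fun p : ν × Fin N => moment h p.2 (history X t) p.1) (j, i)) = w i := fun i => by
    ext j
    simp only [hw, Pi.smul_apply, smul_eq_mul]
    ring
  rw [Finset.sum_congr rfl fun i _ => hterm i, Fin.sum_univ_eq_sum_range w,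
    ← Finset.sum_subset (Finset.range_mono hk)]
  intro i _ hi
  have hzero : gammaCoeff k i = 0 := by
    rcases (not_lt.1 (Finset.mem_range.not.1 hi)).eq_or_lt with rfl | hlt
    · simp [gammaCoeff, ← two_mul]
    · exact if_neg hlt.not_ge
  simp only [hw, hzero, zero_div, zero_smul]

lemma matH_mulVec_xiState (hh : h ≠ 0) (H : HasL2Deriv X v) {Λ Λd K : Matrix ν ν ℝ} {c : ν → ℝ}
    {t : ℝ} (hF : matF Λ Λd K N *ᵥ xiState h N X c t = v t) :
    matH Λ Λd K N *ᵥ xiState h N X c t = augState h N v t := by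
  rw [matH_mulVec, hF, augState]
  exact congrArg _ (funext fun p => congrFun (Gam_mulVec_xiState hh p.2.is_lt.le H c t) p.1)

end Augmented

section Lyapunov

open Matrix

variable {ν : Type*} [Fintype ν] {N : ℕ} {α h : ℝ} {X v : ℝ → ν → ℝ}

/-- The Lyapunov-Krasovskii functional of the trajectory `X` with derivative `v`, multiplied by
`e^{2αt}`; its last term is `h ∫_{t-h}^t ∫_θ^t e^{2αs} v(s)ᵀ R v(s) ds dθ`. -/
def lyap (N : ℕ) (α h : ℝ) (P : Matrix (AugIdx ν N) (AugIdx ν N) ℝ) (S R : Matrix ν ν ℝ)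
    (X v : ℝ → ν → ℝ) (t : ℝ) : ℝ :=
  Real.exp (2 * α * t) * bil P (augState h N X t) (augState h N X t)
    + (∫ s in (t - h)..t, Real.exp (2 * α * s) * bil S (X s) (X s))
    + h * (h * energy α (bil R) v t - ∫ s in (t - h)..t, energy α (bil R) v s)

/-- The quadratic form bounding `e^{-2αt}` times the derivative of `lyap`, once its integral term
has been estimated by the Legendre moments of the derivative `v`. -/
def lyapRate (N : ℕ) (α h : ℝ) (P : Matrix (AugIdx ν N) (AugIdx ν N) ℝ) (S R : Matrix ν ν ℝ)
    (X v : ℝ → ν → ℝ) (t : ℝ) : ℝ :=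
  2 * bil P (augState h N X t) (augState h N v t)
    + 2 * α * bil P (augState h N X t) (augState h N X t)
    + (bil S (X t) (X t) - Real.exp (-2 * α * h) * bil S (X (t - h)) (X (t - h)))
    + h ^ 2 * bil R (v t) (v t)
    - Real.exp (-2 * α * h) * ∑ k ∈ Finset.range (N + 1), (2 * (k : ℝ) + 1) *
        bil R (moment h k (history v t)) (moment h k (history v t))

lemma sum_bil_moment_history_le (hα : 0 ≤ α) (hh : 0 < h) {S : Matrix ν ν ℝ} (hS : S.PosDef)
    (m : ℕ) {f : ℝ → ν → ℝ} (hf : ∀ a b, MemLp f 2 (volume.restrict (Set.uIoc a b))) (t : ℝ)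
    (hft : MemLp (history f t) 2 (volume.restrict (Set.uIoc (-h) 0))) :
    Real.exp (-2 * α * h) * ∑ k ∈ Finset.range m, (2 * (k : ℝ) + 1) *
        bil S (moment h k (history f t)) (moment h k (history f t)) ≤
      h * (Real.exp (-2 * α * t) *
        ∫ s in (t - h)..t, Real.exp (2 * α * s) * bil S (f s) (f s)) := by
  have hint : IntervalIntegrable (fun s => bil S (f s) (f s)) volume (t - h) t :=
    intervalIntegrable_iff.2
      (memLp_one_iff_integrable.1 ((bil S).memLp_of_bilin 1 (hf _ _) (hf _ _)))
  have hdelay := exp_mul_integral_delay_le hα hh.le t (fun s => bil_nonneg hS (f s)) hint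
  have hbessel := sum_bilin_moment_le (bil S) (bil_nonneg hS) hh m hft
  rw [show (∫ θ in (-h)..0, bil S (history f t θ) (history f t θ)) = _ from
    integral_history (fun s => bil S (f s) (f s)) h t] at hbessel
  calc _ ≤ Real.exp (-2 * α * h) * (h * ∫ s in (t - h)..t, bil S (f s) (f s)) := by gcongr
    _ ≤ _ := by
      rw [mul_left_comm]
      gcongr

lemma continuous_exp_mul_bil (α : ℝ) (S : Matrix ν ν ℝ) (hX : Continuous X) :
    Continuous fun s => Real.exp (2 * α * s) * bil S (X s) (X s) := by
  fun_prop

lemma continuous_lyap (hh : h ≠ 0) (P : Matrix (AugIdx ν N) (AugIdx ν N) ℝ) (S R : Matrix ν ν ℝ)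
    (H : HasL2Deriv X v) : Continuous (lyap N α h P S R X v) := by
  have haug := continuous_augState (N := N) hh H.continuous
  have henergy := continuous_energy H α (bil R)
  have hdelay : ∀ {f : ℝ → ℝ}, Continuous f → Continuous fun t => ∫ s in (t - h)..t, f s :=
    fun hf => continuous_iff_continuousAt.2 fun t => (hasDerivAt_integral_delay hf h t).continuousAt
  exact (((by fun_prop : Continuous fun s : ℝ => Real.exp (2 * α * s)).mul
    (by fun_prop)).add (hdelay (continuous_exp_mul_bil α S H.continuous))).add
    (continuous_const.mul ((continuous_const.mul henergy).sub (hdelay henergy)))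

lemma exists_mul_norm_sq_le_lyap (hα : 0 ≤ α) (hh : 0 < h)
    {P : Matrix (AugIdx ν N) (AugIdx ν N) ℝ} {S R : Matrix ν ν ℝ} (hS : S.PosDef) (hR : R.PosDef)
    (hP : (P + (Real.exp (-2 * α * h) / h) • Matrix.fromBlocks 0 0 0 (oddDiag S N)).PosDef) :
    ∃ c > 0, ∀ X v : ℝ → ν → ℝ, HasL2Deriv X v → ∀ t,
      c * Real.exp (2 * α * t) * ‖X t‖ ^ 2 ≤ lyap N α h P S R X v t := by
  obtain ⟨c, hc, hcP⟩ := exists_pos_mul_norm_sq_le (bil_pos hP)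
  refine ⟨c, hc, fun X v H t => ?_⟩
  set I := ∫ s in (t - h)..t, Real.exp (2 * α * s) * bil S (X s) (X s)
  have hlower : c * ‖X t‖ ^ 2 ≤ bil P (augState h N X t) (augState h N X t)
      + Real.exp (-2 * α * h) / h * ∑ k ∈ Finset.range N, (2 * (k : ℝ) + 1) *
        bil S (moment h k (history X t)) (moment h k (history X t)) := by
    have haug := hcP (augState h N X t)
    rw [bil_add, bil_smul] at haug
    nth_rw 4 5 [augState] at haug
    rw [bil_fromBlocks, bil_zero, bil_zero, bil_zero, zero_add, zero_add, zero_add,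
      bil_oddDiag S N fun k => moment h k (history X t)] at haug
    refine le_trans ?_ haug
    gcongr
    exact norm_le_norm_augState X t
  have hbessel : Real.exp (-2 * α * h) / h * ∑ k ∈ Finset.range N, (2 * (k : ℝ) + 1) *
        bil S (moment h k (history X t)) (moment h k (history X t)) ≤
      Real.exp (-2 * α * t) * I := by
    rw [div_mul_eq_mul_div, div_le_iff₀' hh]
    exact sum_bil_moment_history_le hα hh hS N (memLp_uIoc_of_continuous H.continuous) t
      (memLp_uIoc_of_continuous (H.history t).continuous _ _)
  have hcancel : Real.exp (2 * α * t) * (Real.exp (-2 * α * t) * I) = I := by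
    rw [← mul_assoc, ← Real.exp_add, neg_mul, neg_mul, add_neg_cancel, Real.exp_zero, one_mul]
  have henergy : 0 ≤ h * (h * energy α (bil R) v t - ∫ s in (t - h)..t, energy α (bil R) v s) :=
    mul_nonneg hh.le (sub_nonneg.2 (integral_delay_energy_mem_Icc H hh.le (bil_nonneg hR) t).2)
  calc c * Real.exp (2 * α * t) * ‖X t‖ ^ 2 = Real.exp (2 * α * t) * (c * ‖X t‖ ^ 2) := by ring
    _ ≤ Real.exp (2 * α * t) * (bil P (augState h N X t) (augState h N X t)
        + Real.exp (-2 * α * t) * I) := by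
      gcongr
      exact hlower.trans (by gcongr)
    _ ≤ lyap N α h P S R X v t := by
      rw [mul_add, hcancel, lyap]
      exact le_add_of_nonneg_right henergy

lemma exists_lyap_le (N : ℕ) (hα : 0 ≤ α) (hh : 0 < h) (P : Matrix (AugIdx ν N) (AugIdx ν N) ℝ)
    (S : Matrix ν ν ℝ) {R : Matrix ν ν ℝ} (hR : R.PosDef) :
    ∃ C, 0 ≤ C ∧ ∀ X v : ℝ → ν → ℝ, HasL2Deriv X v → ∀ t B,
      (∀ s ∈ Set.Icc (t - h) t, ‖X s‖ ≤ B) → (∫ s in (t - h)..t, ‖v s‖ ^ 2) ≤ B ^ 2 →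
        lyap N α h P S R X v t ≤ C * Real.exp (2 * α * t) * B ^ 2 := by
  obtain ⟨C, -, hC⟩ := exists_norm_augState_le (ν := ν) h N
  refine ⟨‖bil P‖ * C ^ 2 + h * ‖bil S‖ + h * (h * ‖bil R‖), by positivity,
    fun X v H t B hX hv => ?_⟩
  have hle : t - h ≤ t := by linarith
  have haug : bil P (augState h N X t) (augState h N X t) ≤ ‖bil P‖ * (C * B) ^ 2 := by
    refine (bilin_self_le _ _).trans ?_
    gcongr
    exact hC X t B (by rwa [Set.uIcc_of_le hle])
  have hstate : ∫ s in (t - h)..t, Real.exp (2 * α * s) * bil S (X s) (X s) ≤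
      h * (Real.exp (2 * α * t) * (‖bil S‖ * B ^ 2)) := by
    have hmono := intervalIntegral.integral_mono_on (μ := volume) hle
      ((continuous_exp_mul_bil α S H.continuous).intervalIntegrable _ _)
      (intervalIntegrable_const (c := Real.exp (2 * α * t) * (‖bil S‖ * B ^ 2))) fun s hs => ?_
    · rwa [intervalIntegral.integral_const, sub_sub_cancel, smul_eq_mul] at hmono
    · refine (mul_le_mul_of_nonneg_left (bilin_self_le _ _) (Real.exp_pos _).le).trans ?_
      gcongr
      exacts [hs.2, hX s hs]
  have henergy : h * energy α (bil R) v t - ∫ s in (t - h)..t, energy α (bil R) v s ≤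
      h * (‖bil R‖ * Real.exp (2 * α * t) * B ^ 2) := by
    calc _ ≤ h * (energy α (bil R) v t - energy α (bil R) v (t - h)) := by
          linarith [(integral_delay_energy_mem_Icc H hh.le (bil_nonneg hR) t (α := α)).1]
      _ ≤ _ := by
          gcongr
          exact (energy_sub_delay_le H hα hh.le t).trans (by gcongr)
  calc lyap N α h P S R X v t
      ≤ Real.exp (2 * α * t) * (‖bil P‖ * (C * B) ^ 2)
        + h * (Real.exp (2 * α * t) * (‖bil S‖ * B ^ 2))
        + h * (h * (‖bil R‖ * Real.exp (2 * α * t) * B ^ 2)) := by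
        rw [lyap]
        gcongr
    _ = _ := by ring

lemma exists_hasDerivAt_lyap_le (hα : 0 ≤ α) (hh : 0 < h)
    {P : Matrix (AugIdx ν N) (AugIdx ν N) ℝ} (hP : P.IsSymm) (S : Matrix ν ν ℝ)
    {R : Matrix ν ν ℝ} (hR : R.PosDef) (H : HasL2Deriv X v) {a b s : ℝ}
    (hv : ContinuousOn v (Set.Ioo a b)) (hs : s ∈ Set.Ioo a b) :
    ∃ D, HasDerivAt (lyap N α h P S R X v) D s ∧
      D ≤ Real.exp (2 * α * s) * lyapRate N α h P S R X v s := by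
  have haug := hasDerivAt_augState (N := N) hh.ne' H (H.hasDerivAt hv hs)
  have hquad := (bil P).hasDerivAt_of_bilinear (fun _ => haug) (fun _ => haug)
  have hstate := hasDerivAt_integral_delay (continuous_exp_mul_bil α S H.continuous) h s
  have henergy := hasDerivAt_energy H α (bil R) hv hs
  have hdelay := hasDerivAt_integral_delay (continuous_energy H α (bil R)) h s
  refine ⟨_, (((hasDerivAt_exp_two_mul α s).mul hquad).add hstate).add
    (((henergy.const_mul h).sub hdelay).const_mul h), ?_⟩
  have hbessel := mul_le_mul_of_nonneg_left
    (sum_bil_moment_history_le hα hh hR (N + 1) H.memLp s ((H.history s).memLp _ _))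
    (Real.exp_pos (2 * α * s)).le
  rw [mul_left_comm _ h, ← mul_assoc (Real.exp (2 * α * s)) (Real.exp (-2 * α * s)),
    ← Real.exp_add, show 2 * α * s + -2 * α * s = 0 by ring, Real.exp_zero, one_mul] at hbessel
  have hsplit : Real.exp (2 * α * (s - h)) = Real.exp (2 * α * s) * Real.exp (-2 * α * h) := by
    rw [← Real.exp_add]
    ring_nf
  rw [energy_sub H, hsplit, bil_comm_of_isSymm hP (augState h N v s), lyapRate]
  linarith

lemma bil_Pi1_xiState [DecidableEq ν] (hh : h ≠ 0) (H : HasL2Deriv X v) {Λ Λd K : Matrix ν ν ℝ}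
    (α : ℝ) (P : Matrix (AugIdx ν N) (AugIdx ν N) ℝ) (S R Q Z : Matrix ν ν ℝ)
    (Y : Matrix (XiIdx ν N) ν ℝ) {c : ν → ℝ} {t : ℝ}
    (hF : matF Λ Λd K N *ᵥ xiState h N X c t = v t) :
    bil (Pi1 Λ Λd K N α h P S R Q Z Y) (xiState h N X c t) (xiState h N X c t) =
      lyapRate N α h P S R X v t - bil Q (X t - c) (X t - c) - 2 * bil Z (X t - c) c
        + 2 * bil Y (xiState h N X c t) (X t - c) := by
  have hsum : ∑ k ∈ Finset.range (N + 1), (2 * (k : ℝ) + 1) *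
      bil R (Gam ν N k *ᵥ xiState h N X c t) (Gam ν N k *ᵥ xiState h N X c t) =
      ∑ k ∈ Finset.range (N + 1), (2 * (k : ℝ) + 1) *
        bil R (moment h k (history v t)) (moment h k (history v t)) :=
    Finset.sum_congr rfl fun k hk => by
      rw [Gam_mulVec_xiState hh (Nat.lt_succ_iff.1 (Finset.mem_range.1 hk)) H]
  refine (bil_Pi1 _ _ _ _ _ _ _ _ _ _ _ _ _ _ _).trans ?_
  rw [← xiState, matG_mulVec_xiState hh, matH_mulVec_xiState hh H hF, hF, hsum, lyapRate]

end Lyapunov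

/-! ### Scalar weights of the looped functional -/

section Weights

variable {α : ℝ}

lemma affine_exp_nonpos (hα : 0 ≤ α) {a b r s t : ℝ} (hr : a + b * Real.exp (2 * α * r) ≤ 0)
    (ht : a + b * Real.exp (2 * α * t) ≤ 0) (hs : s ∈ Set.Icc r t) :
    a + b * Real.exp (2 * α * s) ≤ 0 := by
  have hrs : Real.exp (2 * α * r) ≤ Real.exp (2 * α * s) := by gcongr; exact hs.1
  have hst : Real.exp (2 * α * s) ≤ Real.exp (2 * α * t) := by gcongr; exact hs.2
  rcases le_total 0 b with hb | hb
  · exact (add_le_add_right (mul_le_mul_of_nonneg_left hst hb) a).trans ht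
  · exact (add_le_add_right (mul_le_mul_of_nonpos_left hrs hb) a).trans hr

/- The left-hand side is affine in `e^{2αT}` for `τ = 0` and for `τ = T`, and affine in `e^{2ατ}`
for fixed `T`. -/
lemma weighted_sum_nonpos (hα : 0 ≤ α) {T₀ T₁ T τ p q x u : ℝ}
    (hT : T ∈ Set.Icc T₀ T₁) (hτ : τ ∈ Set.Icc 0 T)
    (hzero₀ : h1 α 0 * p + h2 α 0 T₀ * q + h4 α 0 T₁ * x ≤ 0)
    (hzero₁ : h1 α 0 * p + h2 α 0 T₁ * q + h4 α 0 T₁ * x ≤ 0)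
    (hend₀ : h1 α T₀ * p + h4 α T₀ T₁ * x + h3 α T₀ T₁ * u ≤ 0)
    (hend₁ : h1 α T₁ * p + h4 α T₁ T₁ * x + h3 α T₁ T₁ * u ≤ 0) :
    h1 α τ * p + h2 α τ T * q + h4 α τ T₁ * x + h3 α τ T₁ * u ≤ 0 := by
  set κ := (Real.exp (α * T₁) - 4) * Real.exp (α * T₁) + 1 with hκ
  set μ := Real.exp (2 * α * T₁) with hμ
  have hzero_eq : ∀ S, h1 α 0 * p + h2 α 0 S * q + h4 α 0 T₁ * x =
      p + h4 α 0 T₁ * x - q / (2 * α) + q / (2 * α) * Real.exp (2 * α * S) := fun S => by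
    simp only [h1, h2, mul_zero, Real.exp_zero]
    ring
  have hend_eq : ∀ S, h1 α S * p + h4 α S T₁ * x + h3 α S T₁ * u =
      2 * μ * x - μ / (2 * α) * u + (p + κ * x + μ / (2 * α) * u) * Real.exp (2 * α * S) :=
    fun S => by
      simp only [h1, h3, h4, hκ, hμ]
      ring
  have hsum_eq : ∀ s, h1 α s * p + h2 α s T * q + h4 α s T₁ * x + h3 α s T₁ * u =
      Real.exp (2 * α * T) / (2 * α) * q + 2 * μ * x - μ / (2 * α) * u
        + (p - q / (2 * α) + κ * x + μ / (2 * α) * u) * Real.exp (2 * α * s) := fun s => by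
    simp only [h1, h2, h3, h4, hκ, hμ]
    ring
  have hzero : h1 α 0 * p + h2 α 0 T * q + h4 α 0 T₁ * x ≤ 0 := by
    rw [hzero_eq] at hzero₀ hzero₁ ⊢
    exact affine_exp_nonpos hα hzero₀ hzero₁ hT
  have hend : h1 α T * p + h4 α T T₁ * x + h3 α T T₁ * u ≤ 0 := by
    rw [hend_eq] at hend₀ hend₁ ⊢
    exact affine_exp_nonpos hα hend₀ hend₁ hT
  have h2_self : h2 α T T = 0 := by rw [h2, sub_self, zero_div]
  have h3_zero : h3 α 0 T₁ = 0 := by rw [h3, mul_zero, Real.exp_zero, sub_self, zero_div, mul_zero]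
  rw [hsum_eq]
  refine affine_exp_nonpos hα ?_ ?_ hτ <;> rw [← hsum_eq]
  · rwa [h3_zero, zero_mul, add_zero]
  · rwa [h2_self, zero_mul, add_zero]

/-- The primitive of `h4 α · T₁` that vanishes at `0`: the weight of the sampled state in the
looped functional. -/
def h4Prim (α T₁ τ : ℝ) : ℝ :=
  ((Real.exp (α * T₁) - 4) * Real.exp (α * T₁) + 1) * ((Real.exp (2 * α * τ) - 1) / (2 * α))
    + 2 * Real.exp (2 * α * T₁) * τ

lemma hasDerivAt_h4Prim (hα : α ≠ 0) (T₁ τ : ℝ) : HasDerivAt (h4Prim α T₁) (h4 α τ T₁) τ := by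
  refine (((((hasDerivAt_exp_two_mul α τ).sub_const 1).div_const (2 * α)).const_mul _).add
    ((hasDerivAt_id τ).const_mul _)).congr_deriv ?_
  rw [h4, mul_div_cancel_right₀ _ (by positivity), mul_one]

lemma hasDerivAt_h2 (hα : α ≠ 0) (T τ : ℝ) : HasDerivAt (fun τ => h2 α τ T) (-h1 α τ) τ := by
  refine (((hasDerivAt_exp_two_mul α τ).const_sub _).div_const (2 * α)).congr_deriv ?_
  rw [h1, neg_div, mul_div_cancel_right₀ _ (by positivity)]

lemma sinh_mul_two_sub_cosh_le {y : ℝ} (hy : 0 ≤ y) : Real.sinh y * (2 - Real.cosh y) ≤ y := by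
  have hderiv : ∀ x, HasDerivAt (fun x => x - Real.sinh x * (2 - Real.cosh x))
      (2 * Real.cosh x * (Real.cosh x - 1)) x := fun x => by
    refine ((hasDerivAt_id x).sub ((Real.hasDerivAt_sinh x).mul
      ((Real.hasDerivAt_cosh x).const_sub 2))).congr_deriv ?_
    linear_combination -Real.cosh_sq x
  have hmono : Monotone fun x => x - Real.sinh x * (2 - Real.cosh x) :=
    monotone_of_hasDerivAt_nonneg hderiv fun x =>
      mul_nonneg (mul_nonneg zero_le_two (Real.cosh_pos x).le) (sub_nonneg.2 (Real.one_le_cosh x))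
  simpa using hmono hy

lemma h4Prim_self (hα : α ≠ 0) (T : ℝ) : h4Prim α T T =
    2 * Real.exp (2 * α * T) / α *
      (α * T - Real.sinh (α * T) * (2 - Real.cosh (α * T))) := by
  have hsq : Real.exp (2 * α * T) = Real.exp (α * T) ^ 2 := by
    rw [← Real.exp_nat_mul]
    push_cast
    ring_nf
  rw [h4Prim, Real.sinh_eq, Real.cosh_eq, Real.exp_neg, hsq]
  field_simp
  ring

lemma exp_sub_one_mul_le {c τ T : ℝ} (hτ : τ ∈ Set.Icc 0 T) :
    (Real.exp (c * τ) - 1) * T ≤ τ * (Real.exp (c * T) - 1) := by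
  rcases (hτ.1.trans hτ.2).eq_or_lt with rfl | hT
  · rw [le_antisymm hτ.2 hτ.1, mul_zero, zero_mul]
  · have hconv := convexOn_exp.2 (Set.mem_univ 0) (Set.mem_univ (c * T))
      (sub_nonneg.2 ((div_le_one hT).2 hτ.2)) (div_nonneg hτ.1 hT.le) (sub_add_cancel 1 (τ / T))
    have harg : τ / T * (c * T) = c * τ := by field_simp
    simp only [smul_eq_mul, mul_zero, zero_add, Real.exp_zero, mul_one, harg] at hconv
    calc (Real.exp (c * τ) - 1) * T
        ≤ (1 - τ / T + τ / T * Real.exp (c * T) - 1) * T := by gcongr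
      _ = τ * (Real.exp (c * T) - 1) := by
        field_simp
        ring

/- If the coefficient of the exponential is negative then `h4Prim α T₁` is concave, so it suffices
to look at both ends of `[0, T₁]`. -/
lemma h4Prim_nonneg (hα : 0 < α) {T₁ τ : ℝ} (hτ : τ ∈ Set.Icc 0 T₁) : 0 ≤ h4Prim α T₁ τ := by
  obtain ⟨h0, h1⟩ := hτ
  rcases le_total 0 ((Real.exp (α * T₁) - 4) * Real.exp (α * T₁) + 1) with hκ | hκ
  · have hexp : 0 ≤ Real.exp (2 * α * τ) - 1 := sub_nonneg.2 (Real.one_le_exp (by positivity))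
    unfold h4Prim
    positivity
  rcases (h0.trans h1).eq_or_lt with rfl | hT
  · simp [h4Prim, le_antisymm h1 h0]
  have hself : 0 ≤ h4Prim α T₁ T₁ := by
    rw [h4Prim_self hα.ne']
    have := sinh_mul_two_sub_cosh_le (mul_nonneg hα.le hT.le)
    exact mul_nonneg (by positivity) (sub_nonneg.2 this)
  refine nonneg_of_mul_nonneg_left ((mul_nonneg h0 hself).trans ?_) hT
  have hchord : (Real.exp (2 * α * τ) - 1) / (2 * α) * T₁ ≤
      τ * ((Real.exp (2 * α * T₁) - 1) / (2 * α)) := by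
    rw [div_mul_eq_mul_div, mul_div_assoc']
    exact div_le_div_of_nonneg_right (exp_sub_one_mul_le ⟨h0, h1⟩) (by positivity)
  calc τ * h4Prim α T₁ T₁
      = ((Real.exp (α * T₁) - 4) * Real.exp (α * T₁) + 1) *
          (τ * ((Real.exp (2 * α * T₁) - 1) / (2 * α)))
        + 2 * Real.exp (2 * α * T₁) * τ * T₁ := by
        rw [h4Prim]
        ring
    _ ≤ ((Real.exp (α * T₁) - 4) * Real.exp (α * T₁) + 1) *
          ((Real.exp (2 * α * τ) - 1) / (2 * α) * T₁)
        + 2 * Real.exp (2 * α * T₁) * τ * T₁ :=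
        add_le_add_left (mul_le_mul_of_nonpos_left hchord hκ) _
    _ = h4Prim α T₁ τ * T₁ := by
        rw [h4Prim]
        ring

lemma h2_nonneg (hα : 0 ≤ α) {τ T : ℝ} (h : τ ≤ T) : 0 ≤ h2 α τ T := by
  have hexp : Real.exp (2 * α * τ) ≤ Real.exp (2 * α * T) := by gcongr
  exact div_nonneg (sub_nonneg.2 hexp) (by positivity)

lemma h2_le (hα : 0 ≤ α) (τ : ℝ) {T Tmax : ℝ} (h : T ≤ Tmax) :
    h2 α τ T ≤ Real.exp (2 * α * Tmax) / (2 * α) := by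
  unfold h2
  gcongr
  exact (sub_le_self _ (Real.exp_pos _).le).trans (by gcongr)

lemma mul_h1_le_h3 (hα : 0 < α) {τ T : ℝ} (hτ : τ ∈ Set.Icc 0 T) : h1 α τ * τ ≤ h3 α τ T := by
  have hh1 : h1 α τ ≤ Real.exp (2 * α * T) := by
    unfold h1
    gcongr
    exact hτ.2
  have hexp : τ ≤ (Real.exp (2 * α * τ) - 1) / (2 * α) := by
    rw [le_div_iff₀' (by positivity), le_sub_iff_add_le]
    exact Real.add_one_le_exp _
  exact mul_le_mul hh1 hexp hτ.1 (Real.exp_pos _).le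

lemma exists_mem_Icc_castSucc_succ {M : ℕ} (hM : 1 ≤ M) (𝒯 : Fin (M + 1) → ℝ) {T : ℝ}
    (hT : T ∈ Set.Icc (𝒯 0) (𝒯 (Fin.last M))) :
    ∃ i : Fin M, T ∈ Set.Icc (𝒯 i.castSucc) (𝒯 i.succ) := by
  by_contra! hcon
  have hle : ∀ i : Fin (M + 1), 𝒯 i ≤ T := Fin.induction hT.1 fun i ih =>
    le_of_not_ge fun hge => hcon i ⟨ih, hge⟩
  obtain ⟨m, rfl⟩ := Nat.exists_eq_succ_of_ne_zero (Nat.one_le_iff_ne_zero.1 hM)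
  exact hcon (Fin.last m) ⟨hle _, hT.2⟩

end Weights

/-! ### The looped functional and exponential decay -/

section Looped

open Matrix

lemma neg_integral_bilin_le {E : Type*} [NormedAddCommGroup E] [NormedSpace ℝ E]
    [CompleteSpace E] {f g : ℝ → E} (H : HasL2Deriv f g) {B : E →L[ℝ] E →L[ℝ] ℝ}
    (hB : ∀ x, 0 ≤ B x x) (hsymm : ∀ x y, B x y = B y x) (η : E) {a s : ℝ} (has : a ≤ s) :
    -∫ r in a..s, B (g r) (g r) ≤ 2 * B (f s - f a) η + (s - a) * B η η := by
  have hsq : ∀ r, B (g r + η) (g r + η) = B (g r) (g r) + 2 * B.flip η (g r) + B η η := fun r => by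
    rw [map_add, map_add, _root_.add_apply, _root_.add_apply, hsymm η, B.flip_apply]
    ring
  have hg := H.intervalIntegrable a s
  have hBg := H.intervalIntegrable_bilin B a s
  have hlin : IntervalIntegrable (fun r => 2 * B.flip η (g r)) volume a s :=
    IntervalIntegrable.const_mul
      ⟨(B.flip η).integrable_comp hg.1, (B.flip η).integrable_comp hg.2⟩ 2
  have hnonneg : 0 ≤ ∫ r in a..s, B (g r + η) (g r + η) :=
    intervalIntegral.integral_nonneg has fun r _ => hB _
  rw [intervalIntegral.integral_congr fun r _ => hsq r,
    intervalIntegral.integral_add (hBg.add hlin) intervalIntegrable_const,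
    intervalIntegral.integral_add hBg hlin, intervalIntegral.integral_const_mul,
    (B.flip η).intervalIntegral_comp_comm hg, ← H.ftc, intervalIntegral.integral_const,
    smul_eq_mul, B.flip_apply] at hnonneg
  linarith

variable {ν : Type*} [Fintype ν] {α h T T₀ T₁ a b s : ℝ} {Q Z U W : Matrix ν ν ℝ}
  {X v : ℝ → ν → ℝ}

/-- The looped functional on a sampling interval of length `T` that starts at `a`; it vanishes at
`a` and is nonnegative at `a + T`. The matrix written `X_i` in the LMIs is called `W` here. -/
def looped (α T T₁ a : ℝ) (Q Z U W : Matrix ν ν ℝ) (X v : ℝ → ν → ℝ) (s : ℝ) : ℝ :=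
  h2 α (s - a) T * (bil Q (X s - X a) (X s - X a) + 2 * bil Z (X s - X a) (X a)
      + ∫ r in a..s, bil U (v r) (v r))
    + h4Prim α T₁ (s - a) * bil W (X a) (X a)

lemma looped_self (α T T₁ a : ℝ) (Q Z U W : Matrix ν ν ℝ) (X v : ℝ → ν → ℝ) :
    looped α T T₁ a Q Z U W X v a = 0 := by
  simp [looped, h4Prim]

lemma looped_end_nonneg (hα : 0 < α) (hT : T ∈ Set.Icc 0 T₁) (a : ℝ) (Q Z U : Matrix ν ν ℝ)
    (hW : W.PosDef) (X v : ℝ → ν → ℝ) : 0 ≤ looped α T T₁ a Q Z U W X v (a + T) := by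
  rw [looped, add_sub_cancel_left, h2, sub_self, zero_div, zero_mul, zero_add]
  exact mul_nonneg (h4Prim_nonneg hα hT) (bil_nonneg hW _)

lemma continuous_looped (hα : α ≠ 0) (T T₁ a : ℝ) (Q Z U W : Matrix ν ν ℝ)
    (H : HasL2Deriv X v) : Continuous (looped α T T₁ a Q Z U W X v) := by
  have hX := H.continuous
  have hh2 : Continuous fun τ => h2 α τ T :=
    continuous_iff_continuousAt.2 fun τ => (hasDerivAt_h2 hα T τ).continuousAt
  have hh4 : Continuous (h4Prim α T₁) :=
    continuous_iff_continuousAt.2 fun τ => (hasDerivAt_h4Prim hα T₁ τ).continuousAt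
  have hU := intervalIntegral.continuous_primitive (H.intervalIntegrable_bilin (bil U)) a
  unfold looped
  fun_prop

/-- The derivative of `looped` on the sampling interval. -/
def loopedRate (α T T₁ a : ℝ) (Q Z U W : Matrix ν ν ℝ) (X v : ℝ → ν → ℝ) (s : ℝ) : ℝ :=
  -h1 α (s - a) * (bil Q (X s - X a) (X s - X a) + 2 * bil Z (X s - X a) (X a)
      + ∫ r in a..s, bil U (v r) (v r))
    + h2 α (s - a) T * (2 * bil Q (v s) (X s - X a) + 2 * bil Z (v s) (X a) + bil U (v s) (v s))
    + h4 α (s - a) T₁ * bil W (X a) (X a)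

lemma hasDerivAt_looped (hα : α ≠ 0) (T T₁ : ℝ) (hQ : Q.IsSymm) (Z U W : Matrix ν ν ℝ)
    (H : HasL2Deriv X v) (hv : ContinuousOn v (Set.Ioo a b)) (hs : s ∈ Set.Ioo a b) :
    HasDerivAt (looped α T T₁ a Q Z U W X v) (loopedRate α T T₁ a Q Z U W X v s) s := by
  have hX : HasDerivAt (fun s => X s - X a) (v s) s := (H.hasDerivAt hv hs).sub_const _
  have hderivQ := (bil Q).hasDerivAt_of_bilinear (fun _ => hX) (fun _ => hX)
  have hderivZ := ((bil Z).flip (X a)).hasFDerivAt.comp_hasDerivAt s hX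
  have hderivU : HasDerivAt (fun s => ∫ r in a..s, bil U (v r) (v r)) (bil U (v s) (v s)) s :=
    intervalIntegral.integral_hasDerivAt_right (H.intervalIntegrable_bilin (bil U) _ _)
      (ContinuousOn.stronglyMeasurableAtFilter isOpen_Ioo (by fun_prop) s hs)
      (ContinuousOn.continuousAt (by fun_prop) (isOpen_Ioo.mem_nhds hs))
  have hderiv2 := (hasDerivAt_h2 hα T (s - a)).comp_sub_const s a
  have hderiv4 := (hasDerivAt_h4Prim hα T₁ (s - a)).comp_sub_const s a
  refine ((hderiv2.mul ((hderivQ.add (hderivZ.const_mul 2)).add hderivU)).add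
    (hderiv4.mul_const (bil W (X a) (X a)))).congr_deriv ?_
  rw [loopedRate, bil_comm_of_isSymm hQ (X s - X a)]
  simp only [Pi.add_apply, Function.comp_apply, ContinuousLinearMap.flip_apply]
  ring

/- Only the first summand of `looped` can be negative, and the quadratic form of `Q` controls the
cross term of `Z` from below. -/
lemma exists_neg_mul_norm_sq_le_looped (hα : 0 < α) (T₁ : ℝ) (hQ : Q.PosDef)
    (Z : Matrix ν ν ℝ) (hU : U.PosDef) (hW : W.PosDef) :
    ∃ D, 0 ≤ D ∧ ∀ (X v : ℝ → ν → ℝ) (T a : ℝ), T ≤ T₁ → ∀ s ∈ Set.Icc a (a + T),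
      -(D * ‖X a‖ ^ 2) ≤ looped α T T₁ a Q Z U W X v s := by
  obtain ⟨c, hc, hcQ⟩ := exists_pos_mul_norm_sq_le (bil_pos hQ)
  obtain ⟨C, hC0, hC⟩ := exists_neg_mul_norm_sq_le_add hc hcQ (bil Z)
  refine ⟨Real.exp (2 * α * T₁) / (2 * α) * C, by positivity, fun X v T a hT s hs => ?_⟩
  have hτ : s - a ∈ Set.Icc 0 T := ⟨sub_nonneg.2 hs.1, sub_le_iff_le_add'.2 hs.2⟩
  have henergy : 0 ≤ ∫ r in a..s, bil U (v r) (v r) :=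
    intervalIntegral.integral_nonneg hs.1 fun r _ => bil_nonneg hU _
  have hsampled : 0 ≤ h4Prim α T₁ (s - a) * bil W (X a) (X a) :=
    mul_nonneg (h4Prim_nonneg hα ⟨hτ.1, hτ.2.trans hT⟩) (bil_nonneg hW _)
  calc -(Real.exp (2 * α * T₁) / (2 * α) * C * ‖X a‖ ^ 2)
      ≤ -(h2 α (s - a) T * C * ‖X a‖ ^ 2) := by
        gcongr
        exact h2_le hα.le _ hT
    _ = h2 α (s - a) T * -(C * ‖X a‖ ^ 2) := by ring
    _ ≤ h2 α (s - a) T * (bil Q (X s - X a) (X s - X a) + 2 * bil Z (X s - X a) (X a)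
          + ∫ r in a..s, bil U (v r) (v r)) :=
        mul_le_mul_of_nonneg_left ((hC _ _).trans (le_add_of_nonneg_right henergy))
          (h2_nonneg hα.le hτ.2)
    _ ≤ looped α T T₁ a Q Z U W X v s := le_add_of_nonneg_right hsampled

end Looped

section Decrease

open Matrix

/-- The LMIs at the two ends of a sub-interval `[T₀, T₁]` of dwell times, in the matrices `A`, `B`
and `C` that stand for `Π_{1,i}`, `Π_{2,i}` and `N₂ᵀ X_i N₂`. -/
def VertexLMI {m n : Type*} [Fintype m] [Fintype n] (α T₀ T₁ : ℝ) (A B C : Matrix m m ℝ)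
    (Y : Matrix m n ℝ) (U : Matrix n n ℝ) : Prop :=
  NegDef (h1 α 0 • A + h2 α 0 T₀ • B + h4 α 0 T₁ • C) ∧
  NegDef (h1 α 0 • A + h2 α 0 T₁ • B + h4 α 0 T₁ • C) ∧
  NegDef (fromBlocks (h1 α T₀ • A + h4 α T₀ T₁ • C) (h3 α T₀ T₁ • Y) (h3 α T₀ T₁ • Y)ᵀ
    (-(h3 α T₀ T₁ • U))) ∧
  NegDef (fromBlocks (h1 α T₁ • A + h4 α T₁ T₁ • C) (h3 α T₁ T₁ • Y) (h3 α T₁ T₁ • Y)ᵀ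
    (-(h3 α T₁ T₁ • U)))

lemma bil_fromBlocks_of_mulVec_eq {m n : Type*} [Fintype m] [Fintype n] (A : Matrix m m ℝ)
    {Y : Matrix m n ℝ} {U : Matrix n n ℝ} (c : ℝ) {ξ : m → ℝ} {η : n → ℝ}
    (hη : U *ᵥ η = Yᵀ *ᵥ ξ) :
    bil (fromBlocks A (c • Y) (c • Y)ᵀ (-(c • U))) (Sum.elim ξ η) (Sum.elim ξ η) =
      bil A ξ ξ + c * bil U η η := by
  have hY : bil Y ξ η = bil U η η := by
    rw [← bil_transpose, bil_apply, ← hη, bil_apply]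
  rw [bil_fromBlocks, bil_transpose, bil_smul, bil_neg, bil_smul, hY]
  ring

lemma VertexLMI.weighted_bil_nonpos {m n : Type*} [Fintype m] [Fintype n]
    {α T T₀ T₁ τ : ℝ} {A B C : Matrix m m ℝ} {Y : Matrix m n ℝ} {U : Matrix n n ℝ}
    (hLMI : VertexLMI α T₀ T₁ A B C Y U) (hα : 0 ≤ α) (hT : T ∈ Set.Icc T₀ T₁)
    (hτ : τ ∈ Set.Icc 0 T) {ξ : m → ℝ} {η : n → ℝ} (hη : U *ᵥ η = Yᵀ *ᵥ ξ) :
    h1 α τ * bil A ξ ξ + h2 α τ T * bil B ξ ξ + h4 α τ T₁ * bil C ξ ξ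
      + h3 α τ T₁ * bil U η η ≤ 0 := by
  obtain ⟨hzero₀, hzero₁, hend₀, hend₁⟩ := hLMI
  refine weighted_sum_nonpos hα hT hτ ?_ ?_ ?_ ?_
  · simpa only [bil_add, bil_smul] using bil_nonpos_of_negDef hzero₀ ξ
  · simpa only [bil_add, bil_smul] using bil_nonpos_of_negDef hzero₁ ξ
  · simpa only [bil_fromBlocks_of_mulVec_eq _ _ hη, bil_add, bil_smul] using
      bil_nonpos_of_negDef hend₀ (Sum.elim ξ η)
  · simpa only [bil_fromBlocks_of_mulVec_eq _ _ hη, bil_add, bil_smul] using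
      bil_nonpos_of_negDef hend₁ (Sum.elim ξ η)

variable {ν : Type*} [Fintype ν] [DecidableEq ν] {N : ℕ} {α h T₀ T₁ a b s : ℝ}
  {P : Matrix (AugIdx ν N) (AugIdx ν N) ℝ} {S R Q Z U W Λ Λd K : Matrix ν ν ℝ}
  {Y : Matrix (XiIdx ν N) ν ℝ} {X v : ℝ → ν → ℝ}

/- With `η = U⁻¹ Yᵀ ξ`, completing the square in the integral of `vᵀ U v` produces exactly the
Schur complement of the block LMI. -/
lemma lyapRate_add_loopedRate_nonpos (hα : 0 < α) (hh : h ≠ 0) (hU : U.PosDef)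
    (hLMI : VertexLMI α T₀ T₁ (Pi1 Λ Λd K N α h P S R Q Z Y) (Pi2 Λ Λd K N Q U Z)
      ((N2 ν N)ᵀ * W * N2 ν N) Y U)
    (H : HasL2Deriv X v) (hT : b - a ∈ Set.Icc T₀ T₁) (hs : s ∈ Set.Icc a b)
    (hflow : v s = Λ *ᵥ X s + Λd *ᵥ X (s - h) + (Λ * K) *ᵥ X a) :
    h1 α (s - a) * lyapRate N α h P S R X v s
      + loopedRate α (b - a) T₁ a Q Z U W X v s ≤ 0 := by
  set ξ := xiState h N X (X a) s with hξ
  obtain ⟨η, hη⟩ : ∃ η, U *ᵥ η = Yᵀ *ᵥ ξ :=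
    ⟨U⁻¹ *ᵥ (Yᵀ *ᵥ ξ), by
      rw [mulVec_mulVec, mul_nonsing_inv _ ((isUnit_iff_isUnit_det U).1 hU.isUnit), one_mulVec]⟩
  have hF : matF Λ Λd K N *ᵥ ξ = v s := by rw [hξ, xiState, matF_mulVec, hflow]
  have hτ : s - a ∈ Set.Icc 0 (b - a) := ⟨sub_nonneg.2 hs.1, sub_le_sub_right hs.2 a⟩
  have hPi2 : bil (Pi2 Λ Λd K N Q U Z) ξ ξ =
      bil U (v s) (v s) + 2 * bil Q (v s) (X s - X a) + 2 * bil Z (v s) (X a) := by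
    rw [← hF]
    exact bil_Pi2 _ _ _ _ _ _ _ _ _ _
  have hW : bil ((N2 ν N)ᵀ * W * N2 ν N) ξ ξ = bil W (X a) (X a) := by
    rw [bil_transpose_mul_mul, hξ, xiState, N2_mulVec]
  have hY : bil U (X s - X a) η = bil Y ξ (X s - X a) := by
    rw [bil_apply, hη, ← bil_transpose Y, bil_apply]
  have hlmi := hLMI.weighted_bil_nonpos hα.le hT hτ hη
  rw [bil_Pi1_xiState hh H α P S R Q Z Y hF, hPi2, hW] at hlmi
  have hsquare := mul_le_mul_of_nonneg_left (neg_integral_bilin_le H (bil_nonneg hU)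
    (bil_comm_of_isSymm (isSymm_of_posDef hU)) η hs.1) (Real.exp_pos (2 * α * (s - a))).le
  rw [hY, ← h1] at hsquare
  have hweight := mul_le_mul_of_nonneg_right (mul_h1_le_h3 hα ⟨hτ.1, hτ.2.trans hT.2⟩)
    (bil_nonneg hU η)
  rw [loopedRate]
  linarith

lemma exists_hasDerivAt_lyap_add_looped_nonpos (hα : 0 < α) (hh : 0 < h) (hP : P.IsSymm)
    (hR : R.PosDef) (hQ : Q.PosDef) (hU : U.PosDef)
    (hLMI : VertexLMI α T₀ T₁ (Pi1 Λ Λd K N α h P S R Q Z Y) (Pi2 Λ Λd K N Q U Z)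
      ((N2 ν N)ᵀ * W * N2 ν N) Y U)
    (H : HasL2Deriv X v) (hT : b - a ∈ Set.Icc T₀ T₁)
    (hflow : ∀ s ∈ Set.Ioo a b, v s = Λ *ᵥ X s + Λd *ᵥ X (s - h) + (Λ * K) *ᵥ X a)
    (hs : s ∈ Set.Ioo a b) :
    ∃ D ≤ 0, HasDerivAt (fun s => lyap N α h P S R X v s + Real.exp (2 * α * a) *
      looped α (b - a) T₁ a Q Z U W X v s) D s := by
  have hv : ContinuousOn v (Set.Ioo a b) := continuousOn_of_flow H.continuous hflow
  obtain ⟨D, hD, hDle⟩ := exists_hasDerivAt_lyap_le (N := N) hα.le hh hP S hR H hv hs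
  have hloop := hasDerivAt_looped hα.ne' (b - a) T₁ (isSymm_of_posDef hQ) Z U W H hv hs
  refine ⟨_, ?_, hD.add (hloop.const_mul (Real.exp (2 * α * a)))⟩
  have hexp : Real.exp (2 * α * s) = Real.exp (2 * α * a) * h1 α (s - a) := by
    rw [h1, ← Real.exp_add]
    ring_nf
  rw [hexp, mul_assoc] at hDle
  refine (add_le_add_left hDle _).trans ?_
  rw [← mul_add]
  exact mul_nonpos_of_nonneg_of_nonpos (Real.exp_pos _).le
    (lyapRate_add_loopedRate_nonpos hα hh.ne' hU hLMI H hT ⟨hs.1.le, hs.2.le⟩ (hflow s hs))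

lemma lyap_add_looped_le (hα : 0 < α) (hh : 0 < h) (hP : P.IsSymm)
    (hR : R.PosDef) (hQ : Q.PosDef) (hU : U.PosDef)
    (hLMI : VertexLMI α T₀ T₁ (Pi1 Λ Λd K N α h P S R Q Z Y) (Pi2 Λ Λd K N Q U Z)
      ((N2 ν N)ᵀ * W * N2 ν N) Y U)
    (H : HasL2Deriv X v) (hT : b - a ∈ Set.Icc T₀ T₁)
    (hflow : ∀ s ∈ Set.Ioo a b, v s = Λ *ᵥ X s + Λd *ᵥ X (s - h) + (Λ * K) *ᵥ X a)
    (hs : s ∈ Set.Icc a b) :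
    lyap N α h P S R X v s + Real.exp (2 * α * a) * looped α (b - a) T₁ a Q Z U W X v s ≤
      lyap N α h P S R X v a := by
  have hcont : Continuous fun s => lyap N α h P S R X v s +
      Real.exp (2 * α * a) * looped α (b - a) T₁ a Q Z U W X v s :=
    (continuous_lyap hh.ne' P S R H).add
    ((continuous_looped hα.ne' (b - a) T₁ a Q Z U W H).const_mul (Real.exp (2 * α * a)))
  have hderiv := fun s (hs : s ∈ interior (Set.Icc a b)) =>
    exists_hasDerivAt_lyap_add_looped_nonpos hα hh hP hR hQ hU hLMI H hT hflow
      (interior_Icc (a := a) ▸ hs)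
  have hanti := antitoneOn_of_deriv_nonpos (convex_Icc a b) hcont.continuousOn
    (fun s hs => by
      obtain ⟨D, -, hD⟩ := hderiv s hs
      exact hD.differentiableAt.differentiableWithinAt)
    (fun s hs => by
      obtain ⟨D, hD0, hD⟩ := hderiv s hs
      exact hD.deriv.trans_le hD0)
  simpa only [looped_self, mul_zero, add_zero] using
    hanti (Set.left_mem_Icc.2 (hs.1.trans hs.2)) hs hs.1

lemma exists_lyap_le_of_vertexLMI (hα : 0 < α) (hh : 0 < h) (hP : P.IsSymm) (hS : S.PosDef)
    (hR : R.PosDef) (hQ : Q.PosDef) (hU : U.PosDef) (hW : W.PosDef)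
    (hpos : (P + (Real.exp (-2 * α * h) / h) • fromBlocks 0 0 0 (oddDiag S N)).PosDef)
    (hLMI : VertexLMI α T₀ T₁ (Pi1 Λ Λd K N α h P S R Q Z Y) (Pi2 Λ Λd K N Q U Z)
      ((N2 ν N)ᵀ * W * N2 ν N) Y U) :
    ∃ D, 0 ≤ D ∧ ∀ (X v : ℝ → ν → ℝ) (a b : ℝ), HasL2Deriv X v → a ≤ b →
      b - a ∈ Set.Icc T₀ T₁ →
      (∀ s ∈ Set.Ioo a b, v s = Λ *ᵥ X s + Λd *ᵥ X (s - h) + (Λ * K) *ᵥ X a) →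
      lyap N α h P S R X v b ≤ lyap N α h P S R X v a ∧
      ∀ s ∈ Set.Icc a b, lyap N α h P S R X v s ≤ D * lyap N α h P S R X v a := by
  obtain ⟨c, hc, hlower⟩ := exists_mul_norm_sq_le_lyap hα.le hh hS hR hpos
  obtain ⟨D, hD0, hD⟩ := exists_neg_mul_norm_sq_le_looped hα T₁ hQ Z hU hW
  refine ⟨1 + D / c, by positivity, fun X v a b H hab hT hflow => ⟨?_, fun s hs => ?_⟩⟩
  · have hle := lyap_add_looped_le hα hh hP hR hQ hU hLMI H hT hflow (Set.right_mem_Icc.2 hab)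
    have hend := looped_end_nonneg hα ⟨sub_nonneg.2 hab, hT.2⟩ a Q Z U hW X v
    rw [add_sub_cancel] at hend
    exact (le_add_of_nonneg_right (mul_nonneg (Real.exp_pos _).le hend)).trans hle
  · have hle := lyap_add_looped_le hα hh hP hR hQ hU hLMI H hT hflow hs
    have hloop := hD X v (b - a) a hT.2 s (by rwa [add_sub_cancel])
    calc lyap N α h P S R X v s
        ≤ lyap N α h P S R X v a + Real.exp (2 * α * a) * (D * ‖X a‖ ^ 2) := by
          nlinarith [Real.exp_pos (2 * α * a)]
      _ = lyap N α h P S R X v a + D / c * (c * Real.exp (2 * α * a) * ‖X a‖ ^ 2) := by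
          field_simp
      _ ≤ lyap N α h P S R X v a + D / c * lyap N α h P S R X v a := by
          gcongr
          exact hlower X v H a
      _ = _ := by ring

lemma le_sqrt_mul_exp_mul {c C x B α s r : ℝ} (hc : 0 < c) (hC : 0 ≤ C) (hB : 0 ≤ B)
    (hx : c * Real.exp (2 * α * s) * x ^ 2 ≤ C * Real.exp (2 * α * r) * B ^ 2) :
    x ≤ √(C / c) * Real.exp (-α * (s - r)) * B := by
  have hexp : Real.exp (2 * α * r) = Real.exp (2 * α * s) * Real.exp (-α * (s - r)) ^ 2 := by
    rw [← Real.exp_nat_mul, ← Real.exp_add]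
    push_cast
    ring_nf
  refine (abs_le_of_sq_le_sq' ?_ (by positivity)).2
  rw [mul_pow, mul_pow, Real.sq_sqrt (by positivity), div_mul_eq_mul_div, div_mul_eq_mul_div,
    le_div_iff₀' hc]
  rw [hexp] at hx
  refine le_of_mul_le_mul_left (a := Real.exp (2 * α * s)) ?_ (Real.exp_pos _)
  linarith

theorem exists_norm_le_of_LMIFeasible {M : ℕ} (hα : 0 < α) (hh : 0 < h) (hM : 1 ≤ M)
    {𝒯 : Fin (M + 1) → ℝ} (hLMI : LMIFeasible Λ Λd K N M α h 𝒯) :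
    ∃ C, 0 ≤ C ∧ ∀ (t : ℕ → ℝ) (X v : ℝ → ν → ℝ) (B : ℝ), Monotone t →
      (∀ k, t (k + 1) - t k ∈ Set.Icc (𝒯 0) (𝒯 (Fin.last M))) → HasL2Deriv X v →
      (∀ k, ∀ s ∈ Set.Ioo (t k) (t (k + 1)),
        v s = Λ *ᵥ X s + Λd *ᵥ X (s - h) + (Λ * K) *ᵥ X (t k)) →
      (∀ s ∈ Set.Icc (t 0 - h) (t 0), ‖X s‖ ≤ B) → (∫ s in (t 0 - h)..(t 0), ‖v s‖ ^ 2) ≤ B ^ 2 →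
      ∀ k, ∀ s ∈ Set.Icc (t k) (t (k + 1)), ‖X s‖ ≤ C * Real.exp (-α * (s - t 0)) * B := by
  obtain ⟨P, S, R, Q, W, U, Z, Y, hP, hS, hR, hQWU, hpos, hvertex⟩ := hLMI
  obtain ⟨c, hc, hlower⟩ := exists_mul_norm_sq_le_lyap hα.le hh hS hR hpos
  obtain ⟨C, hC0, hupper⟩ := exists_lyap_le N hα.le hh P S hR
  choose D hD0 hD using fun i => exists_lyap_le_of_vertexLMI hα hh hP hS hR (hQWU i).1
    (hQWU i).2.2 (hQWU i).2.1 hpos (hvertex i)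
  refine ⟨√((∑ i, D i) * C / c), Real.sqrt_nonneg _,
    fun t X v B hmono hdwell H hflow hX hv k s hs => ?_⟩
  have hB : 0 ≤ B := (norm_nonneg _).trans (hX _ (Set.right_mem_Icc.2 (by linarith)))
  have hstep : ∀ k, lyap N α h P S R X v (t (k + 1)) ≤ lyap N α h P S R X v (t k) ∧
      ∀ s ∈ Set.Icc (t k) (t (k + 1)),
        lyap N α h P S R X v s ≤ (∑ i, D i) * lyap N α h P S R X v (t k) := fun k => by
    obtain ⟨i, hi⟩ := exists_mem_Icc_castSucc_succ hM 𝒯 (hdwell k)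
    obtain ⟨hend, hle⟩ := hD i X v (t k) (t (k + 1)) H (hmono k.le_succ) hi (hflow k)
    refine ⟨hend, fun s hs => (hle s hs).trans (mul_le_mul_of_nonneg_right ?_ ?_)⟩
    · exact Finset.single_le_sum (fun i _ => hD0 i) (Finset.mem_univ i)
    · exact le_trans (by positivity) (hlower X v H (t k))
  have hanti : lyap N α h P S R X v (t k) ≤ lyap N α h P S R X v (t 0) :=
    antitone_nat_of_succ_le (f := fun k => lyap N α h P S R X v (t k)) (fun k => (hstep k).1)
      k.zero_le
  have hDnonneg : 0 ≤ ∑ i, D i := Finset.sum_nonneg fun i _ => hD0 i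
  have hsq : c * Real.exp (2 * α * s) * ‖X s‖ ^ 2 ≤
      (∑ i, D i) * (C * Real.exp (2 * α * t 0) * B ^ 2) :=
    calc _ ≤ _ := hlower X v H s
      _ ≤ (∑ i, D i) * lyap N α h P S R X v (t k) := (hstep k).2 s hs
      _ ≤ _ := mul_le_mul_of_nonneg_left (hanti.trans (hupper X v H _ B hX hv)) hDnonneg
  exact le_sqrt_mul_exp_mul hc (by positivity) hB (hsq.trans_eq (by ring))

end Decrease

/-! ### Initial functions -/

lemma absolutelyContinuousOnInterval_of_dist_le_mul {X Y : Type*} [PseudoMetricSpace X]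
    [PseudoMetricSpace Y] {f : ℝ → X} {g : ℝ → Y} {a b C : ℝ} (hC : 0 ≤ C)
    (hf : AbsolutelyContinuousOnInterval f a b)
    (hfg : ∀ x ∈ Set.uIcc a b, ∀ y ∈ Set.uIcc a b, dist (g x) (g y) ≤ C * dist (f x) (f y)) :
    AbsolutelyContinuousOnInterval g a b := by
  rw [absolutelyContinuousOnInterval_iff] at hf ⊢
  intro ε hε
  obtain ⟨δ, hδ, hsum⟩ := hf (ε / (C + 1)) (by positivity)
  refine ⟨δ, hδ, fun I hI hlt => ?_⟩
  have hlt' := (lt_div_iff₀' (by positivity)).1 (hsum I hI hlt)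
  calc _ ≤ C * ∑ i ∈ Finset.range I.1, dist (f (I.2 i).1) (f (I.2 i).2) := by
        rw [Finset.mul_sum]
        exact Finset.sum_le_sum fun i hi => hfg _ (hI.1 i hi).1 _ (hI.1 i hi).2
    _ ≤ (C + 1) * ∑ i ∈ Finset.range I.1, dist (f (I.2 i).1) (f (I.2 i).2) :=
        mul_le_mul_of_nonneg_right (by linarith) (Finset.sum_nonneg fun _ _ => dist_nonneg)
    _ < ε := hlt'

section InitialFunctions

variable {E F : Type*} [NormedAddCommGroup E] [NormedSpace ℝ E] [NormedAddCommGroup F]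
  [NormedSpace ℝ F] {φ ψ : ℝ → E} {h : ℝ}

lemma deriv_ae_eq_of_eqOn {a b : ℝ} (hφψ : Set.EqOn φ ψ (Set.Icc a b)) :
    deriv φ =ᵐ[volume.restrict (Set.Icc a b)] deriv ψ := by
  rw [EventuallyEq, ← Measure.restrict_congr_set Ioo_ae_eq_Icc, ae_restrict_iff' measurableSet_Ioo]
  exact .of_forall fun s hs => (hφψ.eventuallyEq_of_mem (Icc_mem_nhds hs.1 hs.2)).deriv_eq

lemma integral_norm_deriv_sq_eq_setIntegral (hh : 0 ≤ h) (φ : ℝ → E) :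
    ∫ θ in (-h)..0, ‖deriv φ θ‖ ^ 2 = ∫ θ in Set.Icc (-h) 0, ‖deriv φ θ‖ ^ 2 := by
  rw [intervalIntegral.integral_of_le (neg_nonpos.2 hh), integral_Icc_eq_integral_Ioc]

lemma normW_nonneg (h : ℝ) (φ : ℝ → E) : 0 ≤ normW h φ :=
  add_nonneg (Real.iSup_nonneg fun _ => norm_nonneg _) (Real.sqrt_nonneg _)

lemma normW_congr (hh : 0 ≤ h) (hφψ : Set.EqOn φ ψ (Set.Icc (-h) 0)) : normW h φ = normW h ψ := by
  rw [normW, normW, integral_norm_deriv_sq_eq_setIntegral hh,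
    integral_norm_deriv_sq_eq_setIntegral hh]
  congr 2
  · exact funext fun θ => by rw [hφψ θ.2]
  · refine integral_congr_ae ?_
    filter_upwards [deriv_ae_eq_of_eqOn hφψ] with θ hθ
    rw [hθ]

lemma integral_norm_deriv_sq_le_normW_sq (h : ℝ) (φ : ℝ → E) :
    ∫ θ in (-h)..0, ‖deriv φ θ‖ ^ 2 ≤ normW h φ ^ 2 :=
  (Real.sqrt_le_left (normW_nonneg h φ)).1
    (le_add_of_nonneg_left (Real.iSup_nonneg fun _ => norm_nonneg _))

namespace MemW

lemma continuousOn (hh : 0 ≤ h) (hφ : MemW h φ) : ContinuousOn φ (Set.Icc (-h) 0) :=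
  Set.uIcc_of_le (neg_nonpos.2 hh) ▸ hφ.1.continuousOn

lemma congr (hh : 0 ≤ h) (hφ : MemW h φ) (hφψ : Set.EqOn φ ψ (Set.Icc (-h) 0)) : MemW h ψ := by
  refine ⟨absolutelyContinuousOnInterval_of_dist_le_mul zero_le_one hφ.1 fun x hx y hy => ?_,
    (memLp_congr_ae (deriv_ae_eq_of_eqOn hφψ)).1 hφ.2⟩
  rw [Set.uIcc_of_le (neg_nonpos.2 hh)] at hx hy
  rw [hφψ hx, hφψ hy, one_mul]

lemma norm_le_iSup (hh : 0 ≤ h) (hφ : MemW h φ) {s : ℝ} (hs : s ∈ Set.Icc (-h) 0) :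
    ‖φ s‖ ≤ ⨆ θ : Set.Icc (-h) (0 : ℝ), ‖φ θ‖ := by
  obtain ⟨C, hC⟩ := isCompact_Icc.exists_bound_of_continuousOn (hφ.continuousOn hh)
  exact le_ciSup (f := fun θ : Set.Icc (-h) (0 : ℝ) => ‖φ θ‖)
    ⟨C, Set.forall_mem_range.2 fun θ => hC θ θ.2⟩ ⟨s, hs⟩

lemma norm_le_normW (hh : 0 ≤ h) (hφ : MemW h φ) {s : ℝ} (hs : s ∈ Set.Icc (-h) 0) :
    ‖φ s‖ ≤ normW h φ :=
  (hφ.norm_le_iSup hh hs).trans (le_add_of_nonneg_right (Real.sqrt_nonneg _))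

variable [FiniteDimensional ℝ E]

lemma ae_deriv_clm_comp (hh : 0 ≤ h) (hφ : MemW h φ) (ℓ : E →L[ℝ] F) :
    ∀ᵐ s ∂volume.restrict (Set.Icc (-h) 0), deriv (fun s => ℓ (φ s)) s = ℓ (deriv φ s) := by
  rw [ae_restrict_iff' measurableSet_Icc, ← Set.uIcc_of_le (neg_nonpos.2 hh)]
  filter_upwards [hφ.1.boundedVariationOn.ae_differentiableAt_of_mem_uIcc] with s hs hsI
  exact (ℓ.hasFDerivAt.comp_hasDerivAt s (hs hsI).hasDerivAt).deriv

lemma clm_comp (hh : 0 ≤ h) (hφ : MemW h φ) (ℓ : E →L[ℝ] F) : MemW h fun s => ℓ (φ s) := by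
  refine ⟨absolutelyContinuousOnInterval_of_dist_le_mul (norm_nonneg ℓ) hφ.1
    fun x _ y _ => ℓ.dist_le_opNorm _ _, ?_⟩
  refine (memLp_congr_ae ?_).1 (ℓ.comp_memLp' hφ.2)
  filter_upwards [hφ.ae_deriv_clm_comp hh ℓ] with s hs using hs.symm

lemma normW_clm_comp_le (hh : 0 ≤ h) (hφ : MemW h φ) (ℓ : E →L[ℝ] F) :
    normW h (fun s => ℓ (φ s)) ≤ ‖ℓ‖ * normW h φ := by
  have hint : ∫ θ in (-h)..0, ‖deriv (fun s => ℓ (φ s)) θ‖ ^ 2 ≤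
      ‖ℓ‖ ^ 2 * ∫ θ in (-h)..0, ‖deriv φ θ‖ ^ 2 := by
    rw [integral_norm_deriv_sq_eq_setIntegral hh, integral_norm_deriv_sq_eq_setIntegral hh,
      ← integral_const_mul]
    refine integral_mono_ae ((hφ.clm_comp hh ℓ).2.integrable_norm_pow two_ne_zero)
      ((hφ.2.integrable_norm_pow two_ne_zero).const_mul _) ?_
    filter_upwards [hφ.ae_deriv_clm_comp hh ℓ] with s hs
    rw [hs, ← mul_pow]
    gcongr
    exact ℓ.le_opNorm _
  rw [normW, normW, mul_add]
  refine add_le_add (Real.iSup_le (fun θ => ?_) ?_) ((Real.sqrt_le_sqrt hint).trans_eq ?_)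
  · exact (ℓ.le_opNorm _).trans
      (mul_le_mul_of_nonneg_left (hφ.norm_le_iSup hh θ.2) (norm_nonneg ℓ))
  · exact mul_nonneg (norm_nonneg ℓ) (Real.iSup_nonneg fun _ => norm_nonneg _)
  · rw [Real.sqrt_mul (sq_nonneg _), Real.sqrt_sq (norm_nonneg ℓ)]

lemma integral_deriv_eq_sub (hh : 0 ≤ h) (hφ : MemW h φ) {b : ℝ} (hb : b ∈ Set.Icc (-h) 0) :
    ∫ s in (-h)..b, deriv φ s = φ b - φ (-h) := by
  have hsub : Set.Ioc (-h) b ⊆ Set.Icc (-h) 0 := fun s hs => ⟨hs.1.le, hs.2.trans hb.2⟩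
  have hint : IntervalIntegrable (deriv φ) volume (-h) b :=
    (intervalIntegrable_iff_integrableOn_Ioc_of_le hb.1).2
      (IntegrableOn.mono_set (hφ.2.integrable one_le_two) hsub)
  refine SeparatingDual.eq_iff_forall_dual_eq (R := ℝ) |>.2 fun ℓ => ?_
  have hac : AbsolutelyContinuousOnInterval (fun s => ℓ (φ s)) (-h) b :=
    (hφ.clm_comp hh ℓ).1.mono
      (by simpa only [Set.uIcc_of_le hb.1, Set.uIcc_of_le (neg_nonpos.2 hh)]
        using Set.Icc_subset_Icc_right hb.2)
  rw [map_sub, ← hac.integral_deriv_eq_sub, ← ℓ.intervalIntegral_comp_comm hint,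
    intervalIntegral.integral_of_le hb.1, intervalIntegral.integral_of_le hb.1]
  refine integral_congr_ae ?_
  filter_upwards [ae_restrict_of_ae_restrict_of_subset hsub (hφ.ae_deriv_clm_comp hh ℓ)] with s hs
  exact hs.symm

end MemW

end InitialFunctions

/-! ### Solutions with piecewise constant input -/

section Extension

variable {E : Type*} [NormedAddCommGroup E] [NormedSpace ℝ E] {f g : ℝ → E} {a : ℝ}

lemma hasL2Deriv_max (hg : ∀ b, MemLp g 2 (volume.restrict (Set.Icc a b)))
    (hftc : ∀ b, a ≤ b → f b - f a = ∫ s in a..b, g s) :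
    HasL2Deriv (fun s => f (max s a)) ((Set.Ici a).indicator g) := by
  have hmem : ∀ b c, MemLp ((Set.Ici a).indicator g) 2 (volume.restrict (Set.uIoc b c)) := by
    intro b c
    rw [memLp_indicator_iff_restrict measurableSet_Ici, Measure.restrict_restrict measurableSet_Ici]
    exact (hg (max b c)).mono_measure
      (Measure.restrict_mono (fun s hs => Set.mem_Icc.2 ⟨hs.1, hs.2.2⟩) le_rfl)
  have hint : ∀ b c, IntervalIntegrable ((Set.Ici a).indicator g) volume b c := fun b c =>
    intervalIntegrable_iff.2 ((hmem b c).integrable one_le_two)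
  have hprim : ∀ b, f (max b a) - f a = ∫ s in a..b, (Set.Ici a).indicator g s := by
    intro b
    rcases le_total a b with hab | hba
    · rw [max_eq_left hab, hftc b hab]
      refine intervalIntegral.integral_congr fun s hs => (Set.indicator_of_mem ?_ g).symm
      rw [Set.uIcc_of_le hab] at hs
      exact hs.1
    · rw [max_eq_right hba, sub_self, intervalIntegral.integral_of_ge hba,
        integral_Ioc_eq_integral_Ioo, eq_comm, neg_eq_zero]
      exact setIntegral_eq_zero_of_forall_eq_zero fun s hs =>
        Set.indicator_of_notMem (not_le.2 hs.2) g
  refine ⟨hmem, fun b c => ?_⟩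
  rw [← intervalIntegral.integral_interval_sub_left (hint a c) (hint a b), ← hprim, ← hprim,
    sub_sub_sub_cancel_right]

end Extension

section ResetSequence

variable {Tm TM : ℝ} {t : ℕ → ℝ}

namespace IsResetSequence

lemma nonneg (ht : IsResetSequence Tm TM t) (k : ℕ) : 0 ≤ t k :=
  ht.zero ▸ ht.strictMono.monotone k.zero_le

lemma exists_mem_Ioc (ht : IsResetSequence Tm TM t) {s : ℝ} (hs : 0 < s) :
    ∃ k, s ∈ Set.Ioc (t k) (t (k + 1)) :=
  ht.strictMono.exists_between_of_tendsto_atTop ht.tendsto (ht.zero ▸ hs)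

lemma exists_mem_Ioo (ht : IsResetSequence Tm TM t) {s : ℝ} (hs : 0 < s) (hst : s ∉ Set.range t) :
    ∃ k, s ∈ Set.Ioo (t k) (t (k + 1)) :=
  let ⟨k, hk⟩ := ht.exists_mem_Ioc hs
  ⟨k, hk.1, hk.2.lt_of_ne fun he => hst ⟨k + 1, he.symm⟩⟩

lemma notMem_range_of_mem_Ioo (ht : IsResetSequence Tm TM t) {k : ℕ} {s : ℝ}
    (hs : s ∈ Set.Ioo (t k) (t (k + 1))) : s ∉ Set.range t := by
  rintro ⟨m, rfl⟩
  have hkm := ht.strictMono.lt_iff_lt.1 hs.1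
  have hmk := ht.strictMono.lt_iff_lt.1 hs.2
  lia

lemma apply_one_mem_Ioc (ht : IsResetSequence Tm TM t) : t 1 ∈ Set.Ioc 0 TM := by
  have hdwell := (ht.dwell 0).2
  rw [ht.zero, sub_zero] at hdwell
  exact ⟨ht.zero ▸ ht.strictMono Nat.zero_lt_one, hdwell⟩

end IsResetSequence

end ResetSequence

section Affine

variable {E : Type*} [NormedAddCommGroup E] [NormedSpace ℝ E]

/-- `Y` is continuous on `[-h, ∞)` and `Y' = A Y + Ad Y(· - h) + u k` on every `(t k, t (k + 1))`.
The sampled-data system has this form, and so does the reset system once the reset component is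
eliminated. -/
structure IsAffineSolution (A Ad : E →L[ℝ] E) (h : ℝ) (t : ℕ → ℝ) (u : ℕ → E) (Y : ℝ → E) :
    Prop where
  continuousOn : ContinuousOn Y (Set.Ici (-h))
  flow : ∀ k, ∀ s ∈ Set.Ioo (t k) (t (k + 1)), HasDerivAt Y (A (Y s) + Ad (Y (s - h)) + u k) s

namespace IsAffineSolution

variable {A Ad : E →L[ℝ] E} {h Tm TM : ℝ} {t : ℕ → ℝ} {u : ℕ → E} {Y : ℝ → E}

lemma exists_norm_deriv_le (hh : 0 ≤ h) (ht : IsResetSequence Tm TM t)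
    (H : IsAffineSolution A Ad h t u Y) (b : ℝ) :
    ∃ C, ∀ s ∈ Set.Ioc 0 b, s ∉ Set.range t → ‖deriv Y s‖ ≤ C := by
  obtain ⟨C, hC⟩ := isCompact_Icc.exists_bound_of_continuousOn
    (H.continuousOn.mono (Set.Icc_subset_Ici_self : Set.Icc (-h) b ⊆ _))
  obtain ⟨m, hm⟩ := (ht.tendsto.eventually_ge_atTop b).exists
  refine ⟨‖A‖ * C + ‖Ad‖ * C + ∑ k ∈ Finset.range m, ‖u k‖, fun s hs hst => ?_⟩
  obtain ⟨k, hk⟩ := ht.exists_mem_Ioo hs.1 hst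
  have hkm : k < m := ht.strictMono.lt_iff_lt.1 (hk.1.trans_le (hs.2.trans hm))
  rw [(H.flow k s hk).deriv]
  refine (norm_add₃_le).trans (add_le_add_three ?_ ?_ ?_)
  · exact A.le_opNorm_of_le (hC s ⟨by linarith [hs.1], hs.2⟩)
  · exact Ad.le_opNorm_of_le (hC (s - h) ⟨by linarith [hs.1], by linarith [hs.2]⟩)
  · exact Finset.single_le_sum (fun _ _ => norm_nonneg _) (Finset.mem_range.2 hkm)

lemma memLp_deriv_Icc [CompleteSpace E] (hh : 0 ≤ h) (ht : IsResetSequence Tm TM t)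
    (H : IsAffineSolution A Ad h t u Y) (hY : MemW h Y) (b : ℝ) :
    MemLp (deriv Y) 2 (volume.restrict (Set.Icc (-h) b)) := by
  obtain ⟨C, hC⟩ := H.exists_norm_deriv_le hh ht b
  have hpos : MemLp (deriv Y) 2 (volume.restrict (Set.Ioc 0 b)) := by
    refine .of_bound (aestronglyMeasurable_deriv Y _) C
      ((ae_restrict_iff' measurableSet_Ioc).2 ?_)
    filter_upwards [(Set.countable_range t).ae_notMem volume] with s hst hs using hC s hs hst
  rw [memLp_two_iff_integrable_sq_norm (aestronglyMeasurable_deriv Y _)]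
  refine IntegrableOn.mono_set (s := Set.Icc (-h) b) (t := Set.Icc (-h) 0 ∪ Set.Ioc 0 b)
    (IntegrableOn.union (hY.2.integrable_norm_pow two_ne_zero)
      (hpos.integrable_norm_pow two_ne_zero)) fun s hs => ?_
  exact (le_or_gt s 0).imp (fun h0 => ⟨hs.1, h0⟩) fun h0 => ⟨h0, hs.2⟩

lemma integral_deriv_eq_sub [FiniteDimensional ℝ E] (hh : 0 ≤ h) (ht : IsResetSequence Tm TM t)
    (H : IsAffineSolution A Ad h t u Y) (hY : MemW h Y) {b : ℝ} (hb : -h ≤ b) :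
    ∫ s in (-h)..b, deriv Y s = Y b - Y (-h) := by
  have := FiniteDimensional.complete ℝ E
  rcases le_or_gt b 0 with hb0 | hb0
  · exact hY.integral_deriv_eq_sub hh ⟨hb, hb0⟩
  have hint : ∀ {a c : ℝ}, -h ≤ a → a ≤ c → c ≤ b → IntervalIntegrable (deriv Y) volume a c :=
    fun ha hac hcb => (intervalIntegrable_iff_integrableOn_Icc_of_le hac).2
      (IntegrableOn.mono_set ((H.memLp_deriv_Icc hh ht hY b).integrable one_le_two)
        (Set.Icc_subset_Icc ha hcb))
  have hpos : ∫ s in (0 : ℝ)..b, deriv Y s = Y b - Y 0 := by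
    refine integral_eq_of_hasDerivAt_off_countable_of_le Y _ hb0.le (Set.countable_range t)
      (H.continuousOn.mono fun s hs => (neg_nonpos.2 hh).trans hs.1) (fun s hs => ?_)
      (hint (neg_nonpos.2 hh) hb0.le le_rfl)
    obtain ⟨k, hk⟩ := ht.exists_mem_Ioo hs.1.1 hs.2
    exact (H.flow k s hk).differentiableAt.hasDerivAt
  rw [← intervalIntegral.integral_add_adjacent_intervals
      (hint le_rfl (neg_nonpos.2 hh) hb0.le) (hint (neg_nonpos.2 hh) hb0.le le_rfl), hpos,
    hY.integral_deriv_eq_sub hh ⟨neg_nonpos.2 hh, le_rfl⟩]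
  abel

lemma exists_hasL2Deriv [FiniteDimensional ℝ E] (hh : 0 ≤ h) (ht : IsResetSequence Tm TM t)
    (H : IsAffineSolution A Ad h t u Y) (hY : MemW h Y) :
    ∃ X v, HasL2Deriv X v ∧ Set.EqOn X Y (Set.Ici (-h)) ∧ Set.EqOn v (deriv Y) (Set.Ici (-h)) ∧
      ∀ k, ∀ s ∈ Set.Ioo (t k) (t (k + 1)), v s = A (X s) + Ad (X (s - h)) + u k := by
  have := FiniteDimensional.complete ℝ E
  refine ⟨_, _, hasL2Deriv_max (H.memLp_deriv_Icc hh ht hY)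
    fun b hb => (H.integral_deriv_eq_sub hh ht hY hb).symm, fun s hs => ?_, fun s hs => ?_,
    fun k s hs => ?_⟩
  · exact congrArg Y (max_eq_left hs)
  · exact Set.indicator_of_mem hs _
  · have hs0 : 0 < s := (ht.nonneg k).trans_lt hs.1
    have hmem : s ∈ Set.Ici (-h) := (neg_nonpos.2 hh).trans hs0.le
    rw [Set.indicator_of_mem hmem, (H.flow k s hs).deriv, max_eq_left hmem,
      max_eq_left (show -h ≤ s - h by linarith)]

end IsAffineSolution

/-! ### The first sampling interval -/

variable {X v : ℝ → E}

lemma gronwallBound_self_eq_mul (B K x : ℝ) :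
    gronwallBound B K B x = gronwallBound 1 K 1 x * B := by
  by_cases hK : K = 0
  · simp only [hK, gronwallBound_K0]
    ring
  · simp only [gronwallBound_of_K_ne_0 hK]
    ring

lemma HasL2Deriv.norm_le_add_integral {p : ℝ → ℝ} {B T s : ℝ} (H : HasL2Deriv X v)
    (hp : Continuous p) (h0 : ‖X 0‖ ≤ B) (hv : ∀ s ∈ Set.Ioo 0 T, ‖v s‖ ≤ p s)
    (hs : s ∈ Set.Icc 0 T) : ‖X s‖ ≤ B + ∫ r in (0 : ℝ)..s, p r := by
  rw [H.eq_add_integral 0 s]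
  refine norm_add_le_of_le h0 (intervalIntegral.norm_integral_le_of_norm_le hs.1 ?_
    (hp.intervalIntegrable _ _))
  filter_upwards [volume.ae_ne T] with r hrT hr
  exact hv r ⟨hr.1, (hr.2.trans hs.2).lt_of_ne hrT⟩

lemma HasL2Deriv.norm_le_gronwallBound_of_delay {a b h B T : ℝ} (H : HasL2Deriv X v) (ha : 0 ≤ a)
    (hb : 0 ≤ b) (hh : 0 ≤ h) (hB : 0 ≤ B) (hT : 0 ≤ T) (hinit : ∀ s ∈ Set.Icc (-h) 0, ‖X s‖ ≤ B)
    (hv : ∀ s ∈ Set.Ioo 0 T, ‖v s‖ ≤ a * ‖X s‖ + b * ‖X (s - h)‖ + B) :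
    ∀ s ∈ Set.Icc (-h) T, ‖X s‖ ≤ gronwallBound B (a + b) B T := by
  set p : ℝ → ℝ := fun s => a * ‖X s‖ + b * ‖X (s - h)‖ + B
  have hX := H.continuous
  have hpc : Continuous p := by fun_prop
  have hp0 : ∀ s, 0 ≤ p s := fun s => by positivity
  set w : ℝ → ℝ := fun s => B + ∫ r in (0 : ℝ)..s, p r with hw
  have hwd : ∀ s, HasDerivAt w (p s) s := fun s =>
    (hpc.integral_hasStrictDerivAt 0 s).hasDerivAt.const_add B
  have hmono : Monotone w := monotone_of_hasDerivAt_nonneg hwd hp0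
  have hw0 : w 0 = B := by simp only [hw, intervalIntegral.integral_same, add_zero]
  have hXw : ∀ s ∈ Set.Icc (-h) T, ‖X s‖ ≤ w (max s 0) := by
    intro s hs
    rcases le_total s 0 with hs0 | hs0
    · rw [max_eq_right hs0, hw0]
      exact hinit s ⟨hs.1, hs0⟩
    · rw [max_eq_left hs0]
      exact H.norm_le_add_integral hpc (hinit 0 ⟨neg_nonpos.2 hh, le_rfl⟩) hv ⟨hs0, hs.2⟩
  have hpw : ∀ s ∈ Set.Ico 0 T, p s ≤ (a + b) * w s + B := by
    intro s hs
    have hXs := hXw s ⟨by linarith [hs.1], hs.2.le⟩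
    have hXsh := (hXw (s - h) ⟨by linarith [hs.1], by linarith [hs.2]⟩).trans
      (hmono (max_le (by linarith) hs.1))
    rw [max_eq_left hs.1] at hXs
    rw [add_mul]
    exact add_le_add_left (add_le_add (mul_le_mul_of_nonneg_left hXs ha)
      (mul_le_mul_of_nonneg_left hXsh hb)) B
  have hgron : w T ≤ gronwallBound B (a + b) B (T - 0) :=
    le_gronwallBound_of_liminf_deriv_right_le (fun s _ => (hwd s).continuousAt.continuousWithinAt)
      (fun s _ r hr => (hwd s).hasDerivWithinAt.liminf_right_slope_le hr) hw0.le hpw T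
      ⟨hT, le_rfl⟩
  rw [sub_zero] at hgron
  exact fun s hs => (hXw s hs).trans ((hmono (max_le hs.2 hT)).trans hgron)

lemma HasL2Deriv.intervalIntegrable_norm_sq (H : HasL2Deriv X v) (a b : ℝ) :
    IntervalIntegrable (fun s => ‖v s‖ ^ 2) volume a b :=
  intervalIntegrable_iff.2 ((H.memLp a b).integrable_norm_pow two_ne_zero)

section FirstInterval

variable {A Ad : E →L[ℝ] E} {h T B : ℝ} {u : E}

lemma HasL2Deriv.norm_le_gronwallBound_mul (H : HasL2Deriv X v) (hh : 0 ≤ h) (hT : 0 ≤ T)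
    (hflow : ∀ s ∈ Set.Ioo 0 T, v s = A (X s) + Ad (X (s - h)) + u)
    (hinit : ∀ s ∈ Set.Icc (-h) 0, ‖X s‖ ≤ B) (hu : ‖u‖ ≤ B) :
    ∀ s ∈ Set.Icc (-h) T, ‖X s‖ ≤ gronwallBound 1 (‖A‖ + ‖Ad‖) 1 T * B := by
  rw [← gronwallBound_self_eq_mul]
  refine H.norm_le_gronwallBound_of_delay (norm_nonneg A) (norm_nonneg Ad) hh
    ((norm_nonneg u).trans hu) hT hinit fun s hs => ?_
  rw [hflow s hs]
  exact norm_add₃_le.trans (add_le_add_three (A.le_opNorm _) (Ad.le_opNorm _) hu)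

lemma HasL2Deriv.integral_norm_sq_le (H : HasL2Deriv X v) (hh : 0 ≤ h) (hT : 0 ≤ T)
    (hflow : ∀ s ∈ Set.Ioo 0 T, v s = A (X s) + Ad (X (s - h)) + u)
    (hX : ∀ s ∈ Set.Icc (-h) T, ‖X s‖ ≤ B) (hv : ∫ s in (-h)..0, ‖v s‖ ^ 2 ≤ B ^ 2)
    (hu : ‖u‖ ≤ B) :
    ∫ s in (T - h)..T, ‖v s‖ ^ 2 ≤ (1 + T * (‖A‖ + ‖Ad‖ + 1) ^ 2) * B ^ 2 := by
  have hvB : ∀ s ∈ Set.Ioo 0 T, ‖v s‖ ≤ (‖A‖ + ‖Ad‖ + 1) * B := by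
    intro s hs
    rw [hflow s hs, add_mul, add_mul, one_mul]
    exact norm_add₃_le.trans (add_le_add_three
      (A.le_opNorm_of_le (hX s ⟨by linarith [hs.1], hs.2.le⟩))
      (Ad.le_opNorm_of_le (hX (s - h) ⟨by linarith [hs.1], by linarith [hs.2]⟩)) hu)
  have hvT : ∫ s in (0 : ℝ)..T, ‖v s‖ ^ 2 ≤ T * ((‖A‖ + ‖Ad‖ + 1) * B) ^ 2 := by
    refine (intervalIntegral.integral_mono_on_of_le_Ioo hT (H.intervalIntegrable_norm_sq 0 T)
      intervalIntegrable_const fun s hs =>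
        pow_le_pow_left₀ (norm_nonneg _) (hvB s hs) 2).trans_eq ?_
    rw [intervalIntegral.integral_const, smul_eq_mul, sub_zero]
  calc ∫ s in (T - h)..T, ‖v s‖ ^ 2
      ≤ ∫ s in (-h)..T, ‖v s‖ ^ 2 :=
        intervalIntegral.integral_mono_interval (by linarith) (by linarith) le_rfl
          (.of_forall fun s => sq_nonneg _) (H.intervalIntegrable_norm_sq _ _)
    _ = (∫ s in (-h)..0, ‖v s‖ ^ 2) + ∫ s in (0 : ℝ)..T, ‖v s‖ ^ 2 :=
        (intervalIntegral.integral_add_adjacent_intervals (H.intervalIntegrable_norm_sq _ _)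
          (H.intervalIntegrable_norm_sq _ _)).symm
    _ ≤ (1 + T * (‖A‖ + ‖Ad‖ + 1) ^ 2) * B ^ 2 := by linarith

end FirstInterval

lemma exists_first_interval_bounds (A Ad : E →L[ℝ] E) {h TM : ℝ} (hh : 0 ≤ h) (hTM : 0 ≤ TM) :
    ∃ C, 0 ≤ C ∧ ∀ (X v : ℝ → E) (u : E) (T B : ℝ), T ∈ Set.Icc 0 TM → HasL2Deriv X v →
      (∀ s ∈ Set.Ioo 0 T, v s = A (X s) + Ad (X (s - h)) + u) →
      (∀ s ∈ Set.Icc (-h) 0, ‖X s‖ ≤ B) → ∫ s in (-h)..0, ‖v s‖ ^ 2 ≤ B ^ 2 → ‖u‖ ≤ B →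
      (∀ s ∈ Set.Icc (-h) T, ‖X s‖ ≤ C * B) ∧ ∫ s in (T - h)..T, ‖v s‖ ^ 2 ≤ (C * B) ^ 2 := by
  have hmono : Monotone (gronwallBound 1 (‖A‖ + ‖Ad‖) 1) :=
    gronwallBound_mono zero_le_one zero_le_one (by positivity)
  set g := gronwallBound 1 (‖A‖ + ‖Ad‖) 1 TM
  have hg : 1 ≤ g := (gronwallBound_x0 ..).symm.trans_le (hmono hTM)
  set c := ‖A‖ + ‖Ad‖ + 1
  have hc : 0 ≤ c := by positivity
  refine ⟨(1 + (1 + TM) * c) * g, by positivity, fun X v u T B hT H hflow hinit hv hu => ?_⟩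
  have hB : 0 ≤ B := (norm_nonneg u).trans hu
  have hBg : B ≤ g * B := le_mul_of_one_le_left hB hg
  have hX : ∀ s ∈ Set.Icc (-h) T, ‖X s‖ ≤ g * B := fun s hs =>
    (H.norm_le_gronwallBound_mul hh hT.1 hflow hinit hu s hs).trans
      (mul_le_mul_of_nonneg_right (hmono hT.2) hB)
  have hconst : 1 + T * c ^ 2 ≤ (1 + (1 + TM) * c) ^ 2 := by
    have hTc : T * c ^ 2 ≤ TM * c ^ 2 := mul_le_mul_of_nonneg_right hT.2 (sq_nonneg c)
    nlinarith [mul_nonneg hTM hc, mul_nonneg hTM (sq_nonneg c), sq_nonneg (TM * c)]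
  rw [mul_assoc]
  refine ⟨fun s hs => (hX s hs).trans (le_mul_of_one_le_left (by positivity)
    (le_add_of_nonneg_right (by positivity))), ?_⟩
  rw [mul_pow]
  exact (H.integral_norm_sq_le hh hT.1 hflow hX (hv.trans (pow_le_pow_left₀ hB hBg 2))
    (hu.trans hBg)).trans (mul_le_mul_of_nonneg_right hconst (sq_nonneg _))

end Affine

/-! ### Exponential stability of the sampled-data system -/

section Decay

open Matrix

variable {ν : Type*} [Fintype ν]

/-- `x ↦ A x` as a continuous linear map for the sup norm on `ν → ℝ`. -/
def mulVecCLM (A : Matrix ν ν ℝ) : (ν → ℝ) →L[ℝ] ν → ℝ :=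
  LinearMap.toContinuousLinearMap A.mulVecLin

lemma exp_neg_mul_le {α r s T : ℝ} (hα : 0 ≤ α) (hr : s - T ≤ r) :
    Real.exp (-α * r) ≤ Real.exp (α * T) * Real.exp (-α * s) := by
  rw [← Real.exp_add]
  exact Real.exp_le_exp.2 (by nlinarith [mul_le_mul_of_nonneg_left hr hα])

lemma one_le_exp_mul_exp_neg_mul {α s T : ℝ} (hα : 0 ≤ α) (hs : s ≤ T) :
    1 ≤ Real.exp (α * T) * Real.exp (-α * s) := by
  simpa using exp_neg_mul_le (r := 0) hα (sub_nonpos.2 hs)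

lemma exists_pos_forall_mul_mul_exp_lt {C ε : ℝ} (hC : 0 ≤ C) (hε : 0 < ε) :
    ∃ δ > 0, ∀ W < δ, ∀ r, C * W * Real.exp r < ε * Real.exp r := by
  obtain ⟨δ, hδ, hlt⟩ := exists_pos_mul_lt hε C
  refine ⟨δ, hδ, fun W hW r => mul_lt_mul_of_pos_right ?_ (Real.exp_pos r)⟩
  exact (mul_le_mul_of_nonneg_left hW.le hC).trans_lt hlt

lemma euclideanSpace_norm_le_mul_norm_ofLp (x : EuclideanSpace ℝ ν) :
    ‖x‖ ≤ ‖((EuclideanSpace.equiv ν ℝ).symm : (ν → ℝ) →L[ℝ] EuclideanSpace ℝ ν)‖ * ‖x.ofLp‖ :=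
  ContinuousLinearMap.le_opNorm
    ((EuclideanSpace.equiv ν ℝ).symm : (ν → ℝ) →L[ℝ] EuclideanSpace ℝ ν) x.ofLp

lemma IsResetSequence.sub_le {Tm TM s : ℝ} {t : ℕ → ℝ} (ht : IsResetSequence Tm TM t) {k : ℕ}
    (hs : s ≤ t (k + 1)) : s - TM ≤ t k := by
  linarith [(ht.dwell k).2]

lemma integral_norm_sq_le_of_eqOn_deriv {E : Type*} [NormedAddCommGroup E] [NormedSpace ℝ E]
    {Y v : ℝ → E} {h B : ℝ} (hh : 0 ≤ h) (hv : Set.EqOn v (deriv Y) (Set.Ici (-h)))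
    (hY : normW h Y ≤ B) : ∫ r in (-h)..0, ‖v r‖ ^ 2 ≤ B ^ 2 := by
  refine le_trans (le_of_eq (intervalIntegral.integral_congr fun r hr => ?_))
    ((integral_norm_deriv_sq_le_normW_sq h Y).trans (pow_le_pow_left₀ (normW_nonneg h Y) hY 2))
  rw [Set.uIcc_of_le (neg_nonpos.2 hh)] at hr
  exact congrArg (‖·‖ ^ 2) (hv hr.1)

variable [DecidableEq ν] {Λ Λd K : Matrix ν ν ℝ} {N M : ℕ} {α h : ℝ} {𝒯 : Fin (M + 1) → ℝ}

/- The input `u 0` is arbitrary, so the Lyapunov estimate starts at `t 1` only, and the loss on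
`[0, t 1]` is controlled by Grönwall's inequality. -/
theorem exists_norm_isAffineSolution_le (hα : 0 < α) (hh : 0 < h) (hM : 1 ≤ M)
    (hTM : 0 ≤ 𝒯 (Fin.last M)) (hLMI : LMIFeasible Λ Λd K N M α h 𝒯) :
    ∃ C, 0 ≤ C ∧ ∀ (t : ℕ → ℝ) (u : ℕ → ν → ℝ) (Y : ℝ → ν → ℝ) (B : ℝ),
      IsResetSequence (𝒯 0) (𝒯 (Fin.last M)) t → MemW h Y →
      IsAffineSolution (mulVecCLM Λ) (mulVecCLM Λd) h t u Y →
      (∀ k, u (k + 1) = (Λ * K) *ᵥ Y (t (k + 1))) → normW h Y ≤ B → ‖u 0‖ ≤ B →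
      ∀ s, 0 ≤ s → ‖Y s‖ ≤ C * B * Real.exp (-α * s) := by
  obtain ⟨C₁, hC₁, hfirst⟩ := exists_first_interval_bounds (mulVecCLM Λ) (mulVecCLM Λd) hh.le hTM
  obtain ⟨C₂, hC₂, hdecay⟩ := exists_norm_le_of_LMIFeasible hα hh hM hLMI
  refine ⟨(1 + C₂) * C₁ * Real.exp (α * 𝒯 (Fin.last M)), by positivity,
    fun t u Y B ht hY H hu hYB huB s hs => ?_⟩
  obtain ⟨X, v, hXv, hXY, hvY, hflow⟩ := H.exists_hasL2Deriv hh.le ht hY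
  have hB : 0 ≤ B := (normW_nonneg h Y).trans hYB
  have ht1 := ht.apply_one_mem_Ioc
  have hX0 : ∀ r ∈ Set.Icc (-h) 0, ‖X r‖ ≤ B := fun r hr => by
    rw [hXY hr.1]
    exact (hY.norm_le_normW hh.le hr).trans hYB
  obtain ⟨hX1, hv1⟩ := hfirst X v (u 0) (t 1) B ⟨ht1.1.le, ht1.2⟩ hXv
    (fun r hr => hflow 0 r (by rwa [ht.zero])) hX0
    (integral_norm_sq_le_of_eqOn_deriv hh.le hvY hYB) huB
  have hshift : ∀ k, ∀ r ∈ Set.Ioo (t (k + 1)) (t (k + 1 + 1)),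
      v r = Λ *ᵥ X r + Λd *ᵥ X (r - h) + (Λ * K) *ᵥ X (t (k + 1)) := fun k r hr => by
    rw [hflow (k + 1) r hr, hu, hXY ((neg_nonpos.2 hh.le).trans (ht.nonneg (k + 1)))]
    rfl
  rw [← hXY ((neg_nonpos.2 hh.le).trans hs)]
  have hCB : 0 ≤ C₁ * B := mul_nonneg hC₁ hB
  rcases le_or_gt s (t 1) with hs1 | hs1
  · have hone := one_le_exp_mul_exp_neg_mul hα.le (hs1.trans ht1.2)
    calc ‖X s‖ ≤ C₁ * B := hX1 s ⟨(neg_nonpos.2 hh.le).trans hs, hs1⟩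
      _ ≤ (1 + C₂) * (C₁ * B) * (Real.exp (α * 𝒯 (Fin.last M)) * Real.exp (-α * s)) := by
          nlinarith [mul_nonneg hC₂ hCB]
      _ = _ := by ring
  · obtain ⟨k | k, hk⟩ := ht.exists_mem_Ioc (ht1.1.trans hs1)
    · exact absurd hk.2 hs1.not_ge
    have hexp := exp_neg_mul_le (r := s - t 1) hα.le (sub_le_sub_left ht1.2 s)
    calc ‖X s‖ ≤ C₂ * Real.exp (-α * (s - t 1)) * (C₁ * B) :=
          hdecay (fun k => t (k + 1)) X v (C₁ * B) (fun i j hij => ht.strictMono.monotone (by lia))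
            (fun k => ht.dwell (k + 1)) hXv hshift
            (fun r hr => hX1 r ⟨by linarith [hr.1, ht1.1], hr.2⟩) hv1 k s ⟨hk.1.le, hk.2⟩
      _ ≤ (1 + C₂) * (Real.exp (α * 𝒯 (Fin.last M)) * Real.exp (-α * s)) * (C₁ * B) := by
          gcongr
          linarith
      _ = _ := by ring

lemma IsSampledSolution.isAffineSolution {t : ℕ → ℝ} {φ X : ℝ → EuclideanSpace ℝ ν}
    (H : IsSampledSolution Λ Λd K h t φ X) :
    IsAffineSolution (mulVecCLM Λ) (mulVecCLM Λd) h t (fun k => (Λ * K) *ᵥ (X (t k)).ofLp)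
      fun s => EuclideanSpace.equiv ν ℝ (X s) := by
  refine ⟨(EuclideanSpace.equiv ν ℝ).continuous.comp_continuousOn H.continuousOn, fun k s hs => ?_⟩
  have hX := (H.flow k s (Set.Ioo_subset_Ioc_self hs)).hasDerivAt (Ioc_mem_nhds hs.1 hs.2)
  refine ((EuclideanSpace.equiv ν ℝ).hasFDerivAt.comp_hasDerivAt s hX).congr_deriv ?_
  rw [← mulVec_mulVec]
  rfl

theorem exists_norm_sampled_le (hα : 0 < α) (hh : 0 < h) (hM : 1 ≤ M)
    (hTM : 0 ≤ 𝒯 (Fin.last M)) (hLMI : LMIFeasible Λ Λd K N M α h 𝒯) :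
    ∃ C, 0 ≤ C ∧ ∀ (t : ℕ → ℝ) (φ X : ℝ → EuclideanSpace ℝ ν),
      IsResetSequence (𝒯 0) (𝒯 (Fin.last M)) t → MemW h φ → IsSampledSolution Λ Λd K h t φ X →
      ∀ s, 0 ≤ s → ‖X s‖ ≤ C * normW h φ * Real.exp (-α * s) := by
  obtain ⟨C, hC, hdecay⟩ := exists_norm_isAffineSolution_le hα hh hM hTM hLMI
  let ℓ : EuclideanSpace ℝ ν →L[ℝ] ν → ℝ := EuclideanSpace.equiv ν ℝ
  set c := ‖((EuclideanSpace.equiv ν ℝ).symm : (ν → ℝ) →L[ℝ] EuclideanSpace ℝ ν)‖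
  set b := (1 + ‖mulVecCLM (Λ * K)‖) * ‖ℓ‖ with hb
  refine ⟨c * (C * b), by positivity, fun t φ X ht hφ H s hs => ?_⟩
  set W := normW h φ
  have hW0 : 0 ≤ W := normW_nonneg h φ
  have hXW : MemW h X := hφ.congr hh.le fun s hs => (H.init s hs).symm
  have hXφ : normW h X = W := normW_congr hh.le H.init
  have hℓW : 0 ≤ ‖ℓ‖ * W := by positivity
  have hX0 : ‖ℓ (X (t 0))‖ ≤ ‖ℓ‖ * W := by
    rw [ht.zero, ← hXφ]
    exact ℓ.le_opNorm_of_le (hXW.norm_le_normW hh.le ⟨neg_nonpos.2 hh.le, le_rfl⟩)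
  have hY := hdecay t _ _ (b * W) ht (hXW.clm_comp hh.le ℓ) H.isAffineSolution (fun k => rfl)
    ?_ ?_ s hs
  · exact (euclideanSpace_norm_le_mul_norm_ofLp (X s)).trans
      ((mul_le_mul_of_nonneg_left hY (norm_nonneg _)).trans_eq (by ring))
  · refine (hXW.normW_clm_comp_le hh.le ℓ).trans ?_
    rw [hXφ, hb, mul_assoc]
    exact le_mul_of_one_le_left hℓW (le_add_of_nonneg_right (norm_nonneg _))
  · refine ((mulVecCLM (Λ * K)).le_opNorm_of_le hX0).trans ?_
    rw [hb, mul_assoc]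
    exact mul_le_mul_of_nonneg_right (le_add_of_nonneg_left zero_le_one) hℓW

theorem sampledExpStable_of_LMIFeasible (hα : 0 < α) (hh : 0 < h) (hM : 1 ≤ M)
    (hTM : 0 ≤ 𝒯 (Fin.last M)) (hLMI : LMIFeasible Λ Λd K N M α h 𝒯) :
    SampledExpStable Λ Λd K h (𝒯 0) (𝒯 (Fin.last M)) α := by
  obtain ⟨C, hC, hdecay⟩ := exists_norm_sampled_le hα hh hM hTM hLMI
  intro ε hε
  obtain ⟨δ, hδ, hlt⟩ := exists_pos_forall_mul_mul_exp_lt hC hε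
  exact ⟨δ, hδ, fun t φ X ht hφ H hφδ s hs =>
    (hdecay t φ X ht hφ H s hs).trans_lt (hlt _ hφδ _)⟩

end Decay

/-! ### Reduction of the reset system to the sampled-data system -/

lemma eq_of_hasDerivAt_zero_of_tendsto {E : Type*} [NormedAddCommGroup E] [NormedSpace ℝ E]
    {g : ℝ → E} {a b s : ℝ} {L : E} (hd : ∀ r ∈ Set.Ioo a b, HasDerivAt g 0 r)
    (hb : ContinuousWithinAt g (Set.Iic b) b) (hL : Tendsto g (𝓝[>] a) (𝓝 L))
    (hs : s ∈ Set.Ioc a b) : g s = L := by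
  have hcont : ∀ q ∈ Set.Ioc a b, ContinuousWithinAt g (Set.Iic b) q := fun q hq =>
    hq.2.eq_or_lt.elim (fun he => he ▸ hb) fun hlt =>
      (hd q ⟨hq.1, hlt⟩).continuousAt.continuousWithinAt
  have hconst : ∀ r ∈ Set.Ioo a s, g r = g s := fun r hr =>
    (constant_of_has_deriv_right_zero
      (fun q hq => (hcont q ⟨hr.1.trans_le hq.1, hq.2.trans hs.2⟩).mono fun p hp => hp.2.trans hs.2)
      (fun q hq => (hd q ⟨hr.1.trans_le hq.1, hq.2.trans_le hs.2⟩).hasDerivWithinAt)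
      s ⟨hr.2.le, le_rfl⟩).symm
  refine tendsto_nhds_unique (tendsto_const_nhds.congr' ?_) hL
  filter_upwards [Ioo_mem_nhdsGT hs.1] with r hr using (hconst r hr).symm

section Reset

open Matrix

variable {np : ℕ} {Ap : Matrix (Fin np) (Fin np) ℝ} {Bp : Matrix (Fin np) (Fin 1) ℝ}
  {Cp : Matrix (Fin 1) (Fin np) ℝ} {kp ki pr h : ℝ}

/-- The components `(x_p, x_i)` of the state `(x_p, (x_i, x_ri))` of the reset system. -/
def dropReset (np : ℕ) : EuclideanSpace ℝ (RIdx np) →L[ℝ] SIdx np → ℝ :=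
  .pi fun j => EuclideanSpace.proj (Sum.map id (fun _ => 0) j)

/-- The difference `x_ri - x_i`, which only jumps at resets. -/
def resetOffset (np : ℕ) : EuclideanSpace ℝ (RIdx np) →L[ℝ] ℝ :=
  EuclideanSpace.proj (Sum.inr 1) - EuclideanSpace.proj (Sum.inr 0)

lemma resetOffset_apply (x : EuclideanSpace ℝ (RIdx np)) :
    resetOffset np x = x (Sum.inr 1) - x (Sum.inr 0) :=
  rfl

lemma dropReset_clAR (x : EuclideanSpace ℝ (RIdx np)) :
    dropReset np ((clAR np).toEuclideanLin x) = dropReset np x := by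
  ext (p | i) <;> simp [dropReset, clAR, mulVec, dotProduct, Fintype.sum_sum_type, Matrix.one_apply]

lemma resetOffset_clAR (x : EuclideanSpace ℝ (RIdx np)) :
    resetOffset np ((clAR np).toEuclideanLin x) = -x (Sum.inr 0) := by
  simp [resetOffset_apply, clAR, mulVec, dotProduct, Fintype.sum_sum_type]

lemma resetOffset_closedLoop (x y : EuclideanSpace ℝ (RIdx np)) :
    resetOffset np ((clA Ap Bp pr).toEuclideanLin x + (clAd Bp Cp kp ki).toEuclideanLin y) = 0 := by
  simp [resetOffset_apply, clA, clAd, Br, mulVec, dotProduct, Fintype.sum_sum_type]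

lemma dropReset_closedLoop (x y : EuclideanSpace ℝ (RIdx np)) :
    dropReset np ((clA Ap Bp pr).toEuclideanLin x + (clAd Bp Cp kp ki).toEuclideanLin y) =
      Lam Ap Bp *ᵥ dropReset np x + LamD Bp Cp kp ki *ᵥ dropReset np y
        + Lam Ap Bp *ᵥ Sum.elim 0 fun _ => pr * resetOffset np x := by
  ext (p | i)
  · simp [dropReset, resetOffset_apply, clA, clAd, Lam, LamD, Cr, mulVec, dotProduct,
      Fintype.sum_sum_type, Matrix.mul_apply]
    ring
  · fin_cases i
    simp [dropReset, clA, clAd, Lam, LamD, Br, mulVec, dotProduct, Fintype.sum_sum_type,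
      vecMul]

lemma Lam_mul_gainK_mulVec (x : SIdx np → ℝ) :
    (Lam Ap Bp * gainK np pr) *ᵥ x = Lam Ap Bp *ᵥ Sum.elim 0 fun _ => pr * -x (Sum.inr 0) := by
  rw [← mulVec_mulVec]
  congr 1
  ext (p | i)
  · simp [gainK, mulVec, dotProduct, Fintype.sum_sum_type]
  · fin_cases i
    simp [gainK, mulVec, dotProduct, Fintype.sum_sum_type]

lemma norm_ofLp_le_dropReset_add_resetOffset (x : EuclideanSpace ℝ (RIdx np)) :
    ‖x.ofLp‖ ≤ ‖dropReset np x‖ + |resetOffset np x| := by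
  have hdrop : ∀ j, ‖dropReset np x j‖ ≤ ‖dropReset np x‖ + |resetOffset np x| := fun j =>
    (norm_le_pi_norm (dropReset np x) j).trans (le_add_of_nonneg_right (abs_nonneg _))
  refine (pi_norm_le_iff_of_nonneg (by positivity)).2 ?_
  rintro (p | i)
  · exact hdrop (Sum.inl p)
  · fin_cases i
    · exact hdrop (Sum.inr 0)
    · calc ‖x (Sum.inr 1)‖ = ‖dropReset np x (Sum.inr 0) + resetOffset np x‖ := by
            rw [resetOffset_apply]
            exact congrArg norm (add_sub_cancel (x (Sum.inr 0)) (x (Sum.inr 1))).symm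
        _ ≤ ‖dropReset np x (Sum.inr 0)‖ + ‖resetOffset np x‖ := norm_add_le _ _
        _ ≤ ‖dropReset np x‖ + |resetOffset np x| := by
            gcongr
            exacts [norm_le_pi_norm _ _, le_rfl]

lemma norm_sumElim_zero_le (a : ℝ) :
    ‖(Sum.elim 0 fun _ => a : SIdx np → ℝ)‖ ≤ |a| := by
  refine (pi_norm_le_iff_of_nonneg (abs_nonneg a)).2 ?_
  rintro (_ | _)
  · exact norm_zero.trans_le (abs_nonneg a)
  · exact le_rfl

lemma abs_resetOffset_le (x : EuclideanSpace ℝ (RIdx np)) : |resetOffset np x| ≤ 2 * ‖x‖ := by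
  have h0 := PiLp.norm_apply_le x (Sum.inr 0)
  have h1 := PiLp.norm_apply_le x (Sum.inr 1)
  rw [Real.norm_eq_abs] at h0 h1
  rw [resetOffset_apply]
  linarith [abs_sub (x (Sum.inr 1)) (x (Sum.inr 0))]

namespace IsResetSolution

variable {S : Set (ℝ × EuclideanSpace ℝ (RIdx np))} {t : ℕ → ℝ}
  {φ x : ℝ → EuclideanSpace ℝ (RIdx np)} {Tm TM s : ℝ}

lemma norm_apply_zero_le (hh : 0 ≤ h) (hφ : MemW h φ)
    (H : IsResetSolution (clA Ap Bp pr) (clAd Bp Cp kp ki) (clAR np) h S t φ x) :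
    ‖x 0‖ ≤ normW h φ := by
  have h0 : (0 : ℝ) ∈ Set.Icc (-h) 0 := ⟨neg_nonpos.2 hh, le_rfl⟩
  rw [H.init 0 h0]
  exact hφ.norm_le_normW hh h0

lemma tendsto_nhdsGT_or
    (H : IsResetSolution (clA Ap Bp pr) (clAd Bp Cp kp ki) (clAR np) h S t φ x) (hs : 0 ≤ s) :
    Tendsto x (𝓝[>] s) (𝓝 (x s)) ∨ Tendsto x (𝓝[>] s) (𝓝 ((clAR np).toEuclideanLin (x s))) := by
  by_cases hS : (s, x s) ∈ S
  · exact .inr (H.jump s hs hS)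
  refine .inl ?_
  rcases hs.eq_or_lt with rfl | hs0
  · exact (H.start hS).tendsto.mono_left (nhdsWithin_mono _ Set.Ioi_subset_Ici_self)
  · exact (H.flow s hs0 hS).continuousAt.tendsto.mono_left nhdsWithin_le_nhds

lemma tendsto_dropReset_nhdsGT
    (H : IsResetSolution (clA Ap Bp pr) (clAd Bp Cp kp ki) (clAR np) h S t φ x) (hs : 0 ≤ s) :
    Tendsto (fun s => dropReset np (x s)) (𝓝[>] s) (𝓝 (dropReset np (x s))) := by
  rcases H.tendsto_nhdsGT_or hs with hx | hx
  · exact ((dropReset np).continuous.tendsto _).comp hx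
  · rw [← dropReset_clAR (x s)]
    exact ((dropReset np).continuous.tendsto _).comp hx

lemma continuousOn_dropReset (hh : 0 ≤ h) (hφ : MemW h φ)
    (H : IsResetSolution (clA Ap Bp pr) (clAd Bp Cp kp ki) (clAR np) h S t φ x) :
    ContinuousOn (fun s => dropReset np (x s)) (Set.Ici (-h)) := by
  have hpast : ContinuousOn (fun s => dropReset np (x s)) (Set.Icc (-h) 0) :=
    (dropReset np).continuous.comp_continuousOn ((hφ.continuousOn hh).congr H.init)
  have hfuture : ContinuousOn (fun s => dropReset np (x s)) (Set.Ici 0) := by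
    intro s hs
    have hright := continuousWithinAt_Ioi_iff_Ici.1 (H.tendsto_dropReset_nhdsGT hs)
    rcases (Set.mem_Ici.1 hs).eq_or_lt with rfl | hs0
    · exact hright
    · have hleft := (dropReset np).continuous.continuousAt.comp_continuousWithinAt
        (H.left_cont s hs0)
      exact (continuousAt_iff_continuous_left_right.2 ⟨hleft, hright⟩).continuousWithinAt
  rw [← Set.Icc_union_Ici_eq_Ici (neg_nonpos.2 hh)]
  exact hpast.union_of_isClosed hfuture isClosed_Icc isClosed_Ici

lemma hasDerivAt (ht : IsResetSequence Tm TM t)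
    (H : IsResetSolution (clA Ap Bp pr) (clAd Bp Cp kp ki) (clAR np) h S t φ x) {k : ℕ}
    (hs : s ∈ Set.Ioo (t k) (t (k + 1))) :
    HasDerivAt x ((clA Ap Bp pr).toEuclideanLin (x s)
      + (clAd Bp Cp kp ki).toEuclideanLin (x (s - h))) s := by
  have hs0 : 0 < s := (ht.nonneg k).trans_lt hs.1
  refine H.flow s hs0 fun hS => ?_
  obtain ⟨m, hm⟩ := (H.instants s hs0).1 hS
  exact ht.notMem_range_of_mem_Ioo hs ⟨m + 1, hm⟩

lemma exists_tendsto_resetOffset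
    (H : IsResetSolution (clA Ap Bp pr) (clAd Bp Cp kp ki) (clAR np) h S t φ x) (hs : 0 ≤ s) :
    ∃ L, |L| ≤ 2 * ‖x s‖ ∧ Tendsto (fun s => resetOffset np (x s)) (𝓝[>] s) (𝓝 L) := by
  rcases H.tendsto_nhdsGT_or hs with hx | hx
  · exact ⟨_, abs_resetOffset_le _, ((resetOffset np).continuous.tendsto _).comp hx⟩
  · refine ⟨_, ?_, ((resetOffset np).continuous.tendsto _).comp hx⟩
    rw [resetOffset_clAR, abs_neg]
    have hi := PiLp.norm_apply_le (x s) (Sum.inr 0)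
    rw [Real.norm_eq_abs] at hi
    linarith [norm_nonneg (x s)]

lemma tendsto_resetOffset_succ (ht : IsResetSequence Tm TM t)
    (H : IsResetSolution (clA Ap Bp pr) (clAd Bp Cp kp ki) (clAR np) h S t φ x) (k : ℕ) :
    Tendsto (fun s => resetOffset np (x s)) (𝓝[>] t (k + 1)) (𝓝 (-x (t (k + 1)) (Sum.inr 0))) := by
  have hpos : 0 < t (k + 1) := ht.zero ▸ ht.strictMono k.succ_pos
  rw [← resetOffset_clAR]
  exact ((resetOffset np).continuous.tendsto _).comp
    (H.jump _ hpos.le ((H.instants _ hpos).2 ⟨k, rfl⟩))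

lemma exists_resetOffset_eq (ht : IsResetSequence Tm TM t)
    (H : IsResetSolution (clA Ap Bp pr) (clAd Bp Cp kp ki) (clAR np) h S t φ x) :
    ∃ r : ℕ → ℝ, |r 0| ≤ 2 * ‖x 0‖ ∧ (∀ k, r (k + 1) = -x (t (k + 1)) (Sum.inr 0)) ∧
      ∀ k, ∀ s ∈ Set.Ioc (t k) (t (k + 1)), resetOffset np (x s) = r k := by
  obtain ⟨L, hL, hlim⟩ := H.exists_tendsto_resetOffset le_rfl
  let r : ℕ → ℝ
    | 0 => L
    | k + 1 => -x (t (k + 1)) (Sum.inr 0)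
  have hr : ∀ k, Tendsto (fun s => resetOffset np (x s)) (𝓝[>] t k) (𝓝 (r k))
    | 0 => ht.zero.symm ▸ hlim
    | k + 1 => H.tendsto_resetOffset_succ ht k
  refine ⟨r, hL, fun _ => rfl, fun k s hs => ?_⟩
  refine eq_of_hasDerivAt_zero_of_tendsto (g := fun s => resetOffset np (x s))
    (fun q hq => ?_) ?_ (hr k) hs
  · exact ((resetOffset np).hasFDerivAt.comp_hasDerivAt q (H.hasDerivAt ht hq)).congr_deriv
      (resetOffset_closedLoop _ _)
  · exact (resetOffset np).continuous.continuousAt.comp_continuousWithinAt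
      (H.left_cont _ ((ht.nonneg k).trans_lt (hs.1.trans_le hs.2)))

lemma isAffineSolution (hh : 0 ≤ h) (ht : IsResetSequence Tm TM t) (hφ : MemW h φ)
    (H : IsResetSolution (clA Ap Bp pr) (clAd Bp Cp kp ki) (clAR np) h S t φ x) {r : ℕ → ℝ}
    (hr : ∀ k, ∀ s ∈ Set.Ioc (t k) (t (k + 1)), resetOffset np (x s) = r k) :
    IsAffineSolution (mulVecCLM (Lam Ap Bp)) (mulVecCLM (LamD Bp Cp kp ki)) h t
      (fun k => Lam Ap Bp *ᵥ Sum.elim 0 fun _ => pr * r k) fun s => dropReset np (x s) := by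
  refine ⟨H.continuousOn_dropReset hh hφ, fun k s hs => ?_⟩
  refine ((dropReset np).hasFDerivAt.comp_hasDerivAt s (H.hasDerivAt ht hs)).congr_deriv ?_
  rw [dropReset_closedLoop, hr k s (Set.Ioo_subset_Ioc_self hs)]
  rfl

end IsResetSolution

variable {N M : ℕ} {α : ℝ} {𝒯 : Fin (M + 1) → ℝ}

theorem exists_norm_dropReset_le (hα : 0 < α) (hh : 0 < h) (hM : 1 ≤ M)
    (hTM : 0 ≤ 𝒯 (Fin.last M))
    (hLMI : LMIFeasible (Lam Ap Bp) (LamD Bp Cp kp ki) (gainK np pr) N M α h 𝒯) :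
    ∃ C, 0 ≤ C ∧ ∀ (S : Set (ℝ × EuclideanSpace ℝ (RIdx np))) (t : ℕ → ℝ)
      (φ x : ℝ → EuclideanSpace ℝ (RIdx np)), IsResetSequence (𝒯 0) (𝒯 (Fin.last M)) t →
      MemW h φ → IsResetSolution (clA Ap Bp pr) (clAd Bp Cp kp ki) (clAR np) h S t φ x →
      ∀ s, 0 ≤ s → ‖dropReset np (x s)‖ ≤ C * normW h φ * Real.exp (-α * s) := by
  obtain ⟨C, hC, hdecay⟩ := exists_norm_isAffineSolution_le hα hh hM hTM hLMI
  set a := ‖mulVecCLM (Lam Ap Bp)‖ * (|pr| * 2)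
  refine ⟨C * (‖dropReset np‖ + a), by positivity, fun S t φ x ht hφ H s hs => ?_⟩
  set W := normW h φ
  have hW : 0 ≤ W := normW_nonneg h φ
  have hxW : MemW h x := hφ.congr hh.le fun s hs => (H.init s hs).symm
  obtain ⟨r, hr0, hrsucc, hr⟩ := H.exists_resetOffset_eq ht
  have hpast : normW h (fun s => dropReset np (x s)) ≤ ‖dropReset np‖ * W :=
    (hxW.normW_clm_comp_le hh.le _).trans_eq (by rw [normW_congr hh.le H.init])
  have hoffset : ‖(Sum.elim 0 fun _ => pr * r 0 : SIdx np → ℝ)‖ ≤ |pr| * (2 * W) := by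
    refine (norm_sumElim_zero_le _).trans ?_
    rw [abs_mul]
    gcongr
    exact hr0.trans (mul_le_mul_of_nonneg_left (H.norm_apply_zero_le hh.le hφ) zero_le_two)
  have hinput := (mulVecCLM (Lam Ap Bp)).le_opNorm_of_le hoffset
  rw [mul_assoc]
  refine (hdecay t _ _ ((‖dropReset np‖ + a) * W) ht (hxW.clm_comp hh.le _)
    (H.isAffineSolution hh.le ht hφ hr) (fun k => ?_) (hpast.trans ?_) (hinput.trans ?_)
    s hs).trans_eq (by ring)
  · rw [Lam_mul_gainK_mulVec, hrsucc]
    rfl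
  · exact mul_le_mul_of_nonneg_right (le_add_of_nonneg_right (by positivity)) hW
  · rw [← mul_assoc |pr|, ← mul_assoc]
    exact mul_le_mul_of_nonneg_right (le_add_of_nonneg_left (norm_nonneg _)) hW

theorem exists_abs_resetOffset_le (hα : 0 < α) (hh : 0 < h) (hM : 1 ≤ M)
    (hTM : 0 ≤ 𝒯 (Fin.last M))
    (hLMI : LMIFeasible (Lam Ap Bp) (LamD Bp Cp kp ki) (gainK np pr) N M α h 𝒯) :
    ∃ C, 0 ≤ C ∧ ∀ (S : Set (ℝ × EuclideanSpace ℝ (RIdx np))) (t : ℕ → ℝ)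
      (φ x : ℝ → EuclideanSpace ℝ (RIdx np)), IsResetSequence (𝒯 0) (𝒯 (Fin.last M)) t →
      MemW h φ → IsResetSolution (clA Ap Bp pr) (clAd Bp Cp kp ki) (clAR np) h S t φ x →
      ∀ s, 0 ≤ s → |resetOffset np (x s)| ≤ C * normW h φ * Real.exp (-α * s) := by
  obtain ⟨C, hC, hdecay⟩ := exists_norm_dropReset_le hα hh hM hTM hLMI
  set e := Real.exp (α * 𝒯 (Fin.last M))
  refine ⟨(2 + C) * e, by positivity, fun S t φ x ht hφ H s hs => ?_⟩
  set W := normW h φ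
  have hW : 0 ≤ W := normW_nonneg h φ
  have hx0 := mul_le_mul_of_nonneg_left (H.norm_apply_zero_le hh.le hφ) (zero_le_two (α := ℝ))
  have hinitial : ∀ {q}, |q| ≤ 2 * W → s ≤ 𝒯 (Fin.last M) →
      |q| ≤ (2 + C) * e * W * Real.exp (-α * s) := fun {q} hq hsT => by
    have hone := one_le_exp_mul_exp_neg_mul hα.le hsT
    calc |q| ≤ (2 + C) * W * 1 := by nlinarith [mul_nonneg hC hW]
      _ ≤ (2 + C) * W * (e * Real.exp (-α * s)) := by gcongr
      _ = _ := by ring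
  obtain ⟨r, hr0, hrsucc, hr⟩ := H.exists_resetOffset_eq ht
  rcases hs.eq_or_lt with rfl | hs0
  · exact hinitial ((abs_resetOffset_le _).trans hx0) hTM
  obtain ⟨k, hk⟩ := ht.exists_mem_Ioc hs0
  rw [hr k s hk]
  rcases k with _ | k
  · exact hinitial (hr0.trans hx0) (hk.2.trans ht.apply_one_mem_Ioc.2)
  · rw [hrsucc, abs_neg]
    have hexp := exp_neg_mul_le hα.le (ht.sub_le hk.2)
    calc |x (t (k + 1)) (Sum.inr 0)| ≤ ‖dropReset np (x (t (k + 1)))‖ :=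
          norm_le_pi_norm (dropReset np (x (t (k + 1)))) (Sum.inr 0)
      _ ≤ C * W * Real.exp (-α * t (k + 1)) := hdecay S t φ x ht hφ H _ (ht.nonneg _)
      _ ≤ (2 + C) * W * (e * Real.exp (-α * s)) := by
          gcongr
          linarith
      _ = _ := by ring

theorem resetExpStable_of_LMIFeasible (hα : 0 < α) (hh : 0 < h) (hM : 1 ≤ M)
    (hTM : 0 ≤ 𝒯 (Fin.last M))
    (hLMI : LMIFeasible (Lam Ap Bp) (LamD Bp Cp kp ki) (gainK np pr) N M α h 𝒯)
    (S : Set (ℝ × EuclideanSpace ℝ (RIdx np))) :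
    ResetExpStable (clA Ap Bp pr) (clAd Bp Cp kp ki) (clAR np) h S (𝒯 0) (𝒯 (Fin.last M)) α := by
  obtain ⟨C₁, hC₁, hdrop⟩ := exists_norm_dropReset_le hα hh hM hTM hLMI
  obtain ⟨C₂, hC₂, hoffset⟩ := exists_abs_resetOffset_le hα hh hM hTM hLMI
  set c := ‖((EuclideanSpace.equiv (RIdx np) ℝ).symm :
    (RIdx np → ℝ) →L[ℝ] EuclideanSpace ℝ (RIdx np))‖
  intro ε hε
  obtain ⟨δ, hδ, hlt⟩ := exists_pos_forall_mul_mul_exp_lt (C := c * (C₁ + C₂)) (by positivity) hε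
  refine ⟨δ, hδ, fun t φ x ht hφ H hφδ s hs => (hlt _ hφδ _).trans_le' ?_⟩
  calc ‖x s‖ ≤ c * ‖(x s).ofLp‖ := euclideanSpace_norm_le_mul_norm_ofLp _
    _ ≤ c * (C₁ * normW h φ * Real.exp (-α * s) + C₂ * normW h φ * Real.exp (-α * s)) := by
        gcongr
        exact (norm_ofLp_le_dropReset_add_resetOffset _).trans
          (add_le_add (hdrop S t φ x ht hφ H s hs) (hoffset S t φ x ht hφ H s hs))
    _ = c * (C₁ + C₂) * normW h φ * Real.exp (-α * s) := by ring

end Reset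

end ResetPIRI

end

theorem proposition3 {np : ℕ}
    (Ap : Matrix (Fin np) (Fin np) ℝ) (Bp : Matrix (Fin np) (Fin 1) ℝ)
    (Cp : Matrix (Fin 1) (Fin np) ℝ) (kp ki pr h : ℝ) (hh : 0 < h)
    (α Tm TM : ℝ) (hα : 0 < α) (hTm : 0 ≤ Tm) (hTmM : Tm ≤ TM)
    (N M : ℕ) (hM : 1 ≤ M) (𝒯 : Fin (M + 1) → ℝ) (h𝒯 : Monotone 𝒯)
    (h𝒯0 : 𝒯 0 = Tm) (h𝒯M : 𝒯 (Fin.last M) = TM)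
    (hLMI : ResetPIRI.LMIFeasible (ResetPIRI.Lam Ap Bp) (ResetPIRI.LamD Bp Cp kp ki)
      (ResetPIRI.gainK np pr) N M α h 𝒯) :
    ResetPIRI.SampledExpStable (ResetPIRI.Lam Ap Bp) (ResetPIRI.LamD Bp Cp kp ki)
        (ResetPIRI.gainK np pr) h Tm TM α ∧
      ∀ S : Set (ℝ × EuclideanSpace ℝ (ResetPIRI.RIdx np)),
        ResetPIRI.ResetExpStable (ResetPIRI.clA Ap Bp pr) (ResetPIRI.clAd Bp Cp kp ki)
          (ResetPIRI.clAR np) h S Tm TM α := by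
  subst h𝒯0 h𝒯M
  have hTM := hTm.trans hTmM
  exact ⟨ResetPIRI.sampledExpStable_of_LMIFeasible hα hh hM hTM hLMI,
    ResetPIRI.resetExpStable_of_LMIFeasible hα hh hM hTM hLMI⟩
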